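/- Consider MALL without units: formulas are generated by $A ::= A⅋A \mid A\otimes A\mid A\,\&\,A\mid A\oplus A\mid X\mid X^*$, with de Morgan duality $(-)^*$, and (cut-free) proofs of one-sided sequents $\vdash\Gamma$ (finite families of formulas) are built from axioms $\vdash A,A^*$ ($A$ any formula) and the usual rules for $⅋,\otimes,\&,\oplus$ and exchange. *Games.* An asynchronous game is a graph of positions and transitions with an initial position from which every position is reachable, a polarity $O$ or $P$ for each transition, and a symmetric tiling relation $m\cdot p\diamond n\cdot q$ between paths of length two with the same source and target, such that a path of length two is in at most one tile, a transition $m$ has at most one residual $q$ after $n$, and residuals have the same polarity. Homotopy is the congruence on paths generated by tiles. Given an interpretation $\rho$ of the variables by asynchronous games, the game of $A⅋B$ (resp. $A\otimes B$) is the asynchronous product of those of $A$ and $B$ with a new initial position $\dag$ and one $O$ (resp. $P$) transition from $\dag$ to the former initial position; that of $A\&B$ (resp. $A\oplus B$) is their disjoint union with a new initial position $\dag$ and one $O$ (resp. $P$) transition from $\dag$ to the initial position of each; $X^*$ is interpreted by the game $\rho(X)$ with polarities exchanged; a sequent is interpreted by the asynchronous product of the games of its formulas. *Strategies.* A strategy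 is a prefix-closed set of plays (paths from the initial position). It is courteous if, for every tile $m\cdot p\diamond n\cdot q$ with $m$ a $P$ transition or $p$ an $O$ transition, replacing $m\cdot p$ by $n\cdot q$ in a play of the strategy gives a play of the strategy. The strategy $[\![\pi]\!]_\rho$ of a proof $\pi$ is defined by induction on $\pi$: an axiom $\vdash A,A^*$ is interpreted by the copy-cat strategy (the plays all of whose prefixes have, up to homotopy, projections $w\cdot u$ on $A$ and $w\cdot v$ on $A^*$, where $u$ and $v$ consist of Opponent moves of $A$, resp. of $A^*$); for the other logical rules, a play is empty, or is the transition introducing the connective (for $\&$, either of the two; for $\oplus$, the one selected by the rule) followed by a play of the strategy of the (selected) premise, or, for $\otimes$, by a play whose projections on the two premises are plays of their strategies. The asynchronous strategy interpreting $\pi$ is the smallest courteous strategy $\sigma_{\pi,\rho}$ containing $[\![\pi]\!]_\rho$. *Focusing.* A proof is focusing if, read bottom-up, as long as the sequent contains a formula whose main connective is $⅋$ or $\&$, such a formula is decomposed; otherwise a positive formula ($A\otimes B$, $A\oplus B$ or a variable $X$) is chosen and it and its immediate subformulas are decomposed repeatedly, in each premise, until a negative formula ($A⅋B$, $A\&B$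 or $X^*$) is reached, where this discipline starts again, or a variable $X$ is reached, where the sequent must be closed by the axiom $\vdash X,X^*$. Axioms are only used on variables. **Theorem.** For every MALL proof $\pi$ of a sequent $\vdash\Gamma$ there is a focusing proof $\pi'$ of the same sequent $\vdash\Gamma$ such that, for every interpretation $\rho$ of the variables, $[\![\pi']\!]_\rho\subseteq\sigma_{\pi,\rho}$ and $\sigma_{\pi',\rho}\subseteq\sigma_{\pi,\rho}$. That is, every asynchronous strategy interpreting a proof contains the strategy interpreting a focusing proof of the same sequent. -/

import Mathlib

universe u v

namespace MALL

/-! ### Asynchronous graphs and games -/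

inductive Polarity : Type
  | O
  | P

/-- Exchange of Opponent and Proponent. -/
def Polarity.dual : Polarity → Polarity
  | .O => .P
  | .P => .O

/-- An asynchronous graph. `tile m p n q` is the tile `m · p ◇ n · q`; in it `q` is the residual
of `m` after `n`, and `p` is the residual of `n` after `m`. -/
structure AsyncGraph : Type (u + 1) where
  Pos : Type u
  Trans : Type u
  src : Trans → Pos
  tgt : Trans → Pos
  tile : Trans → Trans → Trans → Trans → Prop
  tile_src : ∀ {m p n q}, tile m p n q → src m = src n
  tile_left : ∀ {m p n q}, tile m p n q → src p = tgt m
  tile_right : ∀ {m p n q}, tile m p n q → src q = tgt n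
  tile_tgt : ∀ {m p n q}, tile m p n q → tgt p = tgt q
  tile_symm : ∀ {m p n q}, tile m p n q → tile n q m p
  /-- A path of length two belongs to at most one tile. -/
  tile_unique : ∀ {m p n q n' q'}, tile m p n q → tile m p n' q' → n = n' ∧ q = q'
  /-- A transition has at most one residual after another one. -/
  residual_unique : ∀ {m p n q p' q'}, tile m p n q → tile m p' n q' → q = q'

/-- An asynchronous game. -/
structure AsyncGame : Type (u + 1) extends AsyncGraph.{u} where
  init : Pos
  pol : Trans → Polarity
  pol_residual : ∀ {m p n q}, tile m p n q → pol q = pol m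
  reachable : ∀ x, Relation.ReflTransGen (fun y z => ∃ m, src m = y ∧ tgt m = z) init x

namespace AsyncGraph

variable (G : AsyncGraph.{u})

/-- `G.IsPath x s y`: the list of transitions `s` is a path from `x` to `y`. -/
def IsPath : G.Pos → List G.Trans → G.Pos → Prop
  | x, [], y => x = y
  | x, m :: s, y => G.src m = x ∧ IsPath (G.tgt m) s y

/-- Homotopy: the smallest congruence containing the tiling relation. -/
def Homotopic : List G.Trans → List G.Trans → Prop :=
  Relation.EqvGen fun s t => ∃ a b m p n q, G.tile m p n q ∧
    s = a ++ m :: p :: b ∧ t = a ++ n :: q :: b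

theorem isPath_append {x z : G.Pos} {s t : List G.Trans} :
    G.IsPath x (s ++ t) z ↔ ∃ y, G.IsPath x s y ∧ G.IsPath y t z := by
  induction s generalizing x with
  | nil => simp [IsPath]
  | cons m s ih => simp [IsPath, ih, and_assoc]

end AsyncGraph

/-- A play is a path starting from the initial position. -/
def AsyncGame.IsPlay (G : AsyncGame.{u}) (s : List G.Trans) : Prop :=
  ∃ y, G.IsPath G.init s y

theorem AsyncGame.IsPlay.prefix {G : AsyncGame.{u}} {s t : List G.Trans}
    (h : G.IsPlay (s ++ t)) : G.IsPlay s := by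
  obtain ⟨y, hy⟩ := h
  obtain ⟨z, hz, -⟩ := G.isPath_append.1 hy
  exact ⟨z, hz⟩

/-! ### Strategies -/

/-- A strategy is a prefix-closed set of plays. -/
structure Strategy (G : AsyncGame.{u}) where
  plays : Set (List G.Trans)
  isPlay : ∀ s ∈ plays, G.IsPlay s
  prefix_closed : ∀ s t, s ++ t ∈ plays → s ∈ plays

namespace Strategy

variable {G : AsyncGame.{u}}

/-- `σ` is included in `τ`. -/
instance : LE (Strategy G) := ⟨fun σ τ => σ.plays ⊆ τ.plays⟩

/-- Courtesy, expressed on plays: for every tile `m · p ◇ n · q` such that `m` is a Proponent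
transition or `p` is an Opponent transition, `m · p` may be replaced by `n · q` in the plays
of the strategy. -/
def Courteous (σ : Strategy G) : Prop :=
  ∀ s t m p n q, G.tile m p n q → (G.pol m = .P ∨ G.pol p = .O) →
    s ++ m :: p :: t ∈ σ.plays → s ++ n :: q :: t ∈ σ.plays

/-- The smallest courteous strategy containing `σ`. -/
def deseq (σ : Strategy G) : Strategy G where
  plays := {s | G.IsPlay s ∧ ∀ τ : Strategy G, τ.Courteous → σ ≤ τ → s ∈ τ.plays}
  isPlay _ h := h.1
  prefix_closed _ _ h := ⟨h.1.prefix, fun τ hτ hσ => τ.prefix_closed _ _ (h.2 τ hτ hσ)⟩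

theorem le_deseq (σ : Strategy G) : σ ≤ σ.deseq :=
  fun s hs => ⟨σ.isPlay s hs, fun _ _ h => h hs⟩

theorem deseq_le {σ τ : Strategy G} (hτ : τ.Courteous) (h : σ ≤ τ) : σ.deseq ≤ τ :=
  fun _ hs => hs.2 τ hτ h

theorem deseq_courteous (σ : Strategy G) : σ.deseq.Courteous := by
  intro s t m p n q htile hpol hs
  refine ⟨?_, fun τ hτ h => hτ s t m p n q htile hpol (hs.2 τ hτ h)⟩
  obtain ⟨y, hy⟩ := hs.1
  obtain ⟨z, hz, hm, hp, ht⟩ := G.isPath_append.1 hy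
  refine ⟨y, G.isPath_append.2 ⟨z, hz, ?_, G.tile_right htile, ?_⟩⟩
  · rw [← G.tile_src htile, hm]
  · rw [← G.tile_tgt htile]; exact ht

end Strategy

/-! ### Constructions on games -/

namespace AsyncGame

/-- The game with polarities inverted. -/
abbrev dual (G : AsyncGame.{u}) : AsyncGame.{u} where
  toAsyncGraph := G.toAsyncGraph
  init := G.init
  pol m := (G.pol m).dual
  pol_residual h := congrArg _ (G.pol_residual h)
  reachable := G.reachable

/-- Tiles of the asynchronous product of two games. -/
inductive ProdTile (G H : AsyncGame.{u}) :
    (G.Trans × H.Pos ⊕ G.Pos × H.Trans) → (G.Trans × H.Pos ⊕ G.Pos × H.Trans) →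
    (G.Trans × H.Pos ⊕ G.Pos × H.Trans) → (G.Trans × H.Pos ⊕ G.Pos × H.Trans) → Prop
  | left {m p n q} (y : H.Pos) : G.tile m p n q →
      ProdTile G H (.inl (m, y)) (.inl (p, y)) (.inl (n, y)) (.inl (q, y))
  | right {m p n q} (x : G.Pos) : H.tile m p n q →
      ProdTile G H (.inr (x, m)) (.inr (x, p)) (.inr (x, n)) (.inr (x, q))
  | leftRight {m x x' n y y'} : G.src m = x → G.tgt m = x' → H.src n = y → H.tgt n = y' →
      ProdTile G H (.inl (m, y)) (.inr (x', n)) (.inr (x, n)) (.inl (m, y'))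
  | rightLeft {m x x' n y y'} : G.src m = x → G.tgt m = x' → H.src n = y → H.tgt n = y' →
      ProdTile G H (.inr (x, n)) (.inl (m, y')) (.inl (m, y)) (.inr (x', n))

/-- The asynchronous product `G ‖ H`. -/
abbrev prod (G H : AsyncGame.{u}) : AsyncGame.{u} where
  Pos := G.Pos × H.Pos
  Trans := G.Trans × H.Pos ⊕ G.Pos × H.Trans
  src
    | .inl (m, y) => (G.src m, y)
    | .inr (x, n) => (x, H.src n)
  tgt
    | .inl (m, y) => (G.tgt m, y)
    | .inr (x, n) => (x, H.tgt n)
  tile := ProdTile G H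
  tile_src h := by
    cases h with
    | left y h => simp [G.tile_src h]
    | right x h => simp [H.tile_src h]
    | _ => simp_all
  tile_left h := by
    cases h with
    | left y h => simp [G.tile_left h]
    | right x h => simp [H.tile_left h]
    | _ => simp_all
  tile_right h := by
    cases h with
    | left y h => simp [G.tile_right h]
    | right x h => simp [H.tile_right h]
    | _ => simp_all
  tile_tgt h := by
    cases h with
    | left y h => simp [G.tile_tgt h]
    | right x h => simp [H.tile_tgt h]
    | _ => simp_all
  tile_symm h := by
    cases h with
    | left y h => exact .left y (G.tile_symm h)
    | right x h => exact .right x (H.tile_symm h)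
    | leftRight h1 h2 h3 h4 => exact .rightLeft h1 h2 h3 h4
    | rightLeft h1 h2 h3 h4 => exact .leftRight h1 h2 h3 h4
  tile_unique h h' := by
    cases h with
    | left y h =>
      cases h' with
      | left _ h' => simpa using G.tile_unique h h'
    | right x h =>
      cases h' with
      | right _ h' => simpa using H.tile_unique h h'
    | leftRight h1 h2 h3 h4 => cases h' with | leftRight => simp_all
    | rightLeft h1 h2 h3 h4 => cases h' with | rightLeft => simp_all
  residual_unique h h' := by
    cases h with
    | left y h =>
      cases h' with
      | left _ h' => simpa using G.residual_unique h h'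
    | right x h =>
      cases h' with
      | right _ h' => simpa using H.residual_unique h h'
    | leftRight h1 h2 h3 h4 => cases h' with | leftRight => simp_all
    | rightLeft h1 h2 h3 h4 => cases h' with | rightLeft => simp_all
  init := (G.init, H.init)
  pol
    | .inl (m, _) => G.pol m
    | .inr (_, n) => H.pol n
  pol_residual h := by
    cases h with
    | left y h => exact G.pol_residual h
    | right x h => exact H.pol_residual h
    | _ => rfl
  reachable := by
    rintro ⟨x, y⟩
    refine Relation.ReflTransGen.trans
      (Relation.ReflTransGen.lift (fun a => (a, H.init)) ?_ _ _ (G.reachable x))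
      (Relation.ReflTransGen.lift (fun b => (x, b)) ?_ _ _ (H.reachable y))
    · rintro _ _ ⟨m, rfl, rfl⟩
      exact ⟨.inl (m, H.init), rfl, rfl⟩
    · rintro _ _ ⟨n, rfl, rfl⟩
      exact ⟨.inr (x, n), rfl, rfl⟩

/-- Tiles of the game below: the tiles of `G`. -/
inductive LiftTile (G : AsyncGame.{u}) :
    Option G.Trans → Option G.Trans → Option G.Trans → Option G.Trans → Prop
  | mk {m p n q} : G.tile m p n q → LiftTile G (some m) (some p) (some n) (some q)

/-- The game `G` with a new initial position `†` (here `none`) and a transition (also `none`)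
of polarity `ε` from `†` to the initial position of `G`. -/
abbrev lift (ε : Polarity) (G : AsyncGame.{u}) : AsyncGame.{u} where
  Pos := Option G.Pos
  Trans := Option G.Trans
  src
    | none => none
    | some m => some (G.src m)
  tgt
    | none => some G.init
    | some m => some (G.tgt m)
  tile := LiftTile G
  tile_src := by rintro _ _ _ _ ⟨h⟩; simp [G.tile_src h]
  tile_left := by rintro _ _ _ _ ⟨h⟩; simp [G.tile_left h]
  tile_right := by rintro _ _ _ _ ⟨h⟩; simp [G.tile_right h]
  tile_tgt := by rintro _ _ _ _ ⟨h⟩; simp [G.tile_tgt h]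
  tile_symm := by rintro _ _ _ _ ⟨h⟩; exact ⟨G.tile_symm h⟩
  tile_unique := by rintro _ _ _ _ _ _ ⟨h⟩ ⟨h'⟩; simpa using G.tile_unique h h'
  residual_unique := by rintro _ _ _ _ _ _ ⟨h⟩ ⟨h'⟩; simpa using G.residual_unique h h'
  init := none
  pol
    | none => ε
    | some m => G.pol m
  pol_residual := by rintro _ _ _ _ ⟨h⟩; exact G.pol_residual h
  reachable := by
    rintro (_ | x)
    · exact .refl
    · refine .head ⟨none, rfl, rfl⟩ (Relation.ReflTransGen.lift some ?_ _ _ (G.reachable x))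
      rintro _ _ ⟨m, rfl, rfl⟩
      exact ⟨some m, rfl, rfl⟩

/-- The game of a multiplicative connective of polarity `ε` (`⅋` for `O`, `⊗` for `P`). -/
abbrev mul (ε : Polarity) (G H : AsyncGame.{u}) : AsyncGame.{u} := lift ε (prod G H)

/-- Transitions of an additive game: the two initial ones, and those of the components. -/
inductive AddTrans (G H : AsyncGame.{u}) : Type u
  | chooseL
  | chooseR
  | inL (m : G.Trans)
  | inR (n : H.Trans)

/-- Tiles of an additive game: those of the components. -/
inductive AddTile (G H : AsyncGame.{u}) :
    AddTrans G H → AddTrans G H → AddTrans G H → AddTrans G H → Prop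
  | left {m p n q} : G.tile m p n q → AddTile G H (.inL m) (.inL p) (.inL n) (.inL q)
  | right {m p n q} : H.tile m p n q → AddTile G H (.inR m) (.inR p) (.inR n) (.inR q)

/-- The game of an additive connective of polarity `ε` (`&` for `O`, `⊕` for `P`): the disjoint
union of `G` and `H`, with a new initial position `†` (here `none`) and two transitions of
polarity `ε` from `†` to the initial positions of `G` and `H`. -/
abbrev add (ε : Polarity) (G H : AsyncGame.{u}) : AsyncGame.{u} where
  Pos := Option (G.Pos ⊕ H.Pos)
  Trans := AddTrans G H
  src
    | .chooseL => none
    | .chooseR => none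
    | .inL m => some (.inl (G.src m))
    | .inR n => some (.inr (H.src n))
  tgt
    | .chooseL => some (.inl G.init)
    | .chooseR => some (.inr H.init)
    | .inL m => some (.inl (G.tgt m))
    | .inR n => some (.inr (H.tgt n))
  tile := AddTile G H
  tile_src := by
    rintro _ _ _ _ (h | h)
    · simp [G.tile_src h]
    · simp [H.tile_src h]
  tile_left := by
    rintro _ _ _ _ (h | h)
    · simp [G.tile_left h]
    · simp [H.tile_left h]
  tile_right := by
    rintro _ _ _ _ (h | h)
    · simp [G.tile_right h]
    · simp [H.tile_right h]
  tile_tgt := by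
    rintro _ _ _ _ (h | h)
    · simp [G.tile_tgt h]
    · simp [H.tile_tgt h]
  tile_symm := by
    rintro _ _ _ _ (h | h)
    · exact .left (G.tile_symm h)
    · exact .right (H.tile_symm h)
  tile_unique := by
    rintro _ _ _ _ _ _ (h | h) (h' | h')
    · simpa using G.tile_unique h h'
    · simpa using H.tile_unique h h'
  residual_unique := by
    rintro _ _ _ _ _ _ (h | h) (h' | h')
    · simpa using G.residual_unique h h'
    · simpa using H.residual_unique h h'
  init := none
  pol
    | .chooseL => ε
    | .chooseR => ε
    | .inL m => G.pol m
    | .inR n => H.pol n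
  pol_residual := by
    rintro _ _ _ _ (h | h)
    · exact G.pol_residual h
    · exact H.pol_residual h
  reachable := by
    rintro (_ | x | x)
    · exact .refl
    · refine .head ⟨.chooseL, rfl, rfl⟩
        (Relation.ReflTransGen.lift (fun y => some (Sum.inl y)) ?_ _ _ (G.reachable x))
      rintro _ _ ⟨m, rfl, rfl⟩
      exact ⟨.inL m, rfl, rfl⟩
    · refine .head ⟨.chooseR, rfl, rfl⟩
        (Relation.ReflTransGen.lift (fun y => some (Sum.inr y)) ?_ _ _ (H.reachable x))
      rintro _ _ ⟨m, rfl, rfl⟩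
      exact ⟨.inR m, rfl, rfl⟩

/-- A transition of the asynchronous product of a family of games: a transition `move` of the
component `idx`, together with the position `pos` from which it is played (whose component
`idx` is the source of `move`). -/
structure PiTrans {ι : Type} (G : ι → AsyncGame.{u}) : Type u where
  pos : ∀ i, (G i).Pos
  idx : ι
  move : (G idx).Trans
  src_eq : (G idx).src move = pos idx

namespace PiTrans

variable {ι : Type} {G : ι → AsyncGame.{u}}

open Classical in
/-- The position reached by a transition. -/
noncomputable def tgt (t : PiTrans G) : ∀ i, (G i).Pos :=
  Function.update t.pos t.idx ((G t.idx).tgt t.move)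

theorem tgt_self (x : ∀ i, (G i).Pos) (i : ι) (m : (G i).Trans) (h : (G i).src m = x i) :
    (PiTrans.mk x i m h).tgt i = (G i).tgt m := by
  classical exact Function.update_self _ _ _

theorem tgt_of_ne (x : ∀ i, (G i).Pos) (i : ι) (m : (G i).Trans) (h : (G i).src m = x i) {j : ι}
    (hj : j ≠ i) : (PiTrans.mk x i m h).tgt j = x j := by
  classical exact Function.update_of_ne hj _ _

/-- The component of a transition and its instance in this component. -/
def lab (t : PiTrans G) : Σ i, (G i).Trans := ⟨t.idx, t.move⟩

theorem ext_lab {t t' : PiTrans G} (h : t.pos = t'.pos) (h' : t.lab = t'.lab) : t = t' := by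
  obtain ⟨p, i, m, e⟩ := t
  obtain ⟨p', i', m', e'⟩ := t'
  simp only [lab, Sigma.mk.injEq] at h h'
  obtain ⟨rfl, h'⟩ := h'
  obtain rfl := eq_of_heq h'
  subst h
  rfl

open Classical in
/-- The part of a transition which is in the component `i`. -/
noncomputable def proj (i : ι) (t : PiTrans G) : Option (G i).Trans :=
  if h : t.idx = i then some (h ▸ t.move) else none

/-- Tiles of the asynchronous product of a family of games: either the four transitions are in
the same component and form a tile there, or two of them are instances of a transition in a
component and the two others are instances of a transition in another component. -/
def Tile (m p n q : PiTrans G) : Prop :=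
  m.pos = n.pos ∧ p.pos = m.tgt ∧ q.pos = n.tgt ∧
    ((∃ i a b c d, (G i).tile a b c d ∧
        m.lab = ⟨i, a⟩ ∧ p.lab = ⟨i, b⟩ ∧ n.lab = ⟨i, c⟩ ∧ q.lab = ⟨i, d⟩) ∨
      (m.idx ≠ n.idx ∧ p.lab = n.lab ∧ q.lab = m.lab))

end PiTrans

/-- The asynchronous product of a finite family of games. -/
noncomputable abbrev pi {ι : Type} [Finite ι] (G : ι → AsyncGame.{u}) : AsyncGame.{u} where
  Pos := ∀ i, (G i).Pos
  Trans := PiTrans G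
  src t := t.pos
  tgt := PiTrans.tgt
  tile := PiTrans.Tile
  tile_src h := h.1
  tile_left h := h.2.1
  tile_right h := h.2.2.1
  tile_tgt := by
    rintro ⟨x, i, m, hm⟩ ⟨y, j, p, hp⟩ ⟨z, k, n, hn⟩ ⟨w, l, q, hq⟩ ⟨h1, h2, h3, h4⟩
    simp only [PiTrans.tgt] at h1 h2 h3
    subst h1 h2 h3
    rcases h4 with ⟨i', a, b, c, d, ht, e1, e2, e3, e4⟩ | ⟨hne, e1, e2⟩
    · simp only [PiTrans.lab] at e1 e2 e3 e4
      cases e1; cases e2; cases e3; cases e4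
      simp [PiTrans.tgt, (G i).tile_tgt ht]
    · simp only [PiTrans.lab] at e1 e2
      cases e1; cases e2
      simp only [PiTrans.tgt]
      classical exact Function.update_comm hne _ _ _
  tile_symm := by
    rintro m p n q ⟨h1, h2, h3, ⟨i, a, b, c, d, ht, e1, e2, e3, e4⟩ | ⟨hne, e1, e2⟩⟩
    · exact ⟨h1.symm, h3, h2, .inl ⟨i, c, d, a, b, (G i).tile_symm ht, e3, e4, e1, e2⟩⟩
    · exact ⟨h1.symm, h3, h2, .inr ⟨hne.symm, e2, e1⟩⟩
  tile_unique := by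
    rintro m p n q n' q' ⟨h1, h2, h3, h4⟩ ⟨h1', h2', h3', h4'⟩
    have key : n.lab = n'.lab ∧ q.lab = q'.lab := by
      rcases h4 with ⟨i, a, b, c, d, ht, e1, e2, e3, e4⟩ | ⟨hne, e1, e2⟩ <;>
      rcases h4' with ⟨i', a', b', c', d', ht', e1', e2', e3', e4'⟩ | ⟨hne', e1', e2'⟩
      · rw [e1] at e1'; rw [e2] at e2'
        cases e1'; cases e2'
        obtain ⟨rfl, rfl⟩ := (G i).tile_unique ht ht'
        exact ⟨e3.trans e3'.symm, e4.trans e4'.symm⟩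
      · exact absurd ((congrArg Sigma.fst e1).trans
          ((congrArg Sigma.fst e2).symm.trans (congrArg Sigma.fst e1'))) hne'
      · exact absurd ((congrArg Sigma.fst e1').trans
          ((congrArg Sigma.fst e2').symm.trans (congrArg Sigma.fst e1))) hne
      · exact ⟨e1.symm.trans e1', e2.trans e2'.symm⟩
    have hn : n = n' := PiTrans.ext_lab (h1.symm.trans h1') key.1
    subst hn
    exact ⟨rfl, PiTrans.ext_lab (h3.trans h3'.symm) key.2⟩
  residual_unique := by
    rintro m p n q p' q' ⟨h1, h2, h3, h4⟩ ⟨h1', h2', h3', h4'⟩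
    refine PiTrans.ext_lab (h3.trans h3'.symm) ?_
    rcases h4 with ⟨i, a, b, c, d, ht, e1, e2, e3, e4⟩ | ⟨hne, e1, e2⟩ <;>
    rcases h4' with ⟨i', a', b', c', d', ht', e1', e2', e3', e4'⟩ | ⟨hne', e1', e2'⟩
    · rw [e1] at e1'; rw [e3] at e3'
      cases e1'; cases e3'
      rw [e4, e4', (G i).residual_unique ht ht']
    · exact absurd ((congrArg Sigma.fst e1).trans (congrArg Sigma.fst e3).symm) hne'
    · exact absurd ((congrArg Sigma.fst e1').trans (congrArg Sigma.fst e3').symm) hne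
    · exact e2.trans e2'.symm
  init i := (G i).init
  pol t := (G t.idx).pol t.move
  pol_residual := by
    rintro m p n q ⟨h1, h2, h3, ⟨i, a, b, c, d, ht, e1, e2, e3, e4⟩ | ⟨hne, e1, e2⟩⟩
    · have h5 := congrArg (fun l : Σ i, (G i).Trans => (G l.1).pol l.2) e1
      have h6 := congrArg (fun l : Σ i, (G i).Trans => (G l.1).pol l.2) e4
      exact h6.trans (((G i).pol_residual ht).trans h5.symm)
    · exact congrArg (fun l : Σ i, (G i).Trans => (G l.1).pol l.2) e2
  reachable := by
    classical
    intro x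
    have := Fintype.ofFinite ι
    have key : ∀ S : Finset ι, Relation.ReflTransGen
        (fun y z : ∀ i, (G i).Pos => ∃ m : PiTrans G, m.pos = y ∧ m.tgt = z)
        (fun i => (G i).init) (S.piecewise x fun i => (G i).init) := by
      intro S
      induction S using Finset.induction_on with
      | empty => simpa using Relation.ReflTransGen.refl
      | insert i S hi ih =>
        refine ih.trans ?_
        have h := Relation.ReflTransGen.lift (p := fun y z : ∀ i, (G i).Pos =>
            ∃ m : PiTrans G, m.pos = y ∧ m.tgt = z)
          (Function.update (S.piecewise x fun i => (G i).init) i) ?_ _ _ ((G i).reachable (x i))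
        · rw [Finset.piecewise_insert]
          convert h using 1
          simp [hi]
        · rintro _ _ ⟨m, rfl, rfl⟩
          refine ⟨⟨Function.update (S.piecewise x fun i => (G i).init) i ((G i).src m), i, m,
            by rw [Function.update_self]⟩, rfl, ?_⟩
          funext j
          by_cases hj : j = i
          · subst hj
            rw [PiTrans.tgt_self, Function.update_self]
          · rw [PiTrans.tgt_of_ne _ _ _ _ hj, Function.update_of_ne hj, Function.update_of_ne hj]
    simpa using key Finset.univ

/-- A morphism between the underlying graphs. -/
structure Hom (G H : AsyncGame.{u}) where
  pos : G.Pos → H.Pos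
  trans : G.Trans → H.Trans
  src_trans : ∀ m, H.src (trans m) = pos (G.src m)
  tgt_trans : ∀ m, H.tgt (trans m) = pos (G.tgt m)

theorem Hom.isPath {G H : AsyncGame.{u}} (f : Hom G H) {x y : G.Pos} {s : List G.Trans}
    (h : G.IsPath x s y) : H.IsPath (f.pos x) (s.map f.trans) (f.pos y) := by
  induction s generalizing x with
  | nil => exact congrArg f.pos h
  | cons m s ih =>
    refine ⟨(f.src_trans m).trans (congrArg f.pos h.1), ?_⟩
    rw [f.tgt_trans]
    exact ih h.2

end AsyncGame

namespace Strategy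

variable {G H : AsyncGame.{u}}

/-- The plays which are either empty or a given transition `r` followed by the image of a play
of `σ`. -/
def guard (σ : Strategy G) (f : AsyncGame.Hom G H) (r : H.Trans) (hr : H.src r = H.init)
    (hr' : H.tgt r = f.pos G.init) : Strategy H where
  plays := {s | s = [] ∨ ∃ t ∈ σ.plays, s = r :: t.map f.trans}
  isPlay := by
    rintro _ (rfl | ⟨t, ht, rfl⟩)
    · exact ⟨_, rfl⟩
    · obtain ⟨y, hy⟩ := σ.isPlay t ht
      exact ⟨f.pos y, hr, hr' ▸ f.isPath hy⟩
  prefix_closed := by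
    rintro (_ | ⟨m, s⟩) t h
    · exact .inl rfl
    · obtain h | ⟨w, hw, h⟩ := h
      · simp at h
      · rw [List.cons_append, List.cons.injEq] at h
        obtain ⟨rfl, h⟩ := h
        obtain ⟨a, b, rfl, rfl, rfl⟩ := List.map_eq_append_iff.1 h.symm
        exact .inr ⟨a, σ.prefix_closed _ _ hw, rfl⟩

/-- The image of a strategy under a morphism preserving the initial position. -/
def image (σ : Strategy G) (f : AsyncGame.Hom G H) (hf : f.pos G.init = H.init) :
    Strategy H where
  plays := {s | ∃ t ∈ σ.plays, s = t.map f.trans}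
  isPlay := by
    rintro _ ⟨t, ht, rfl⟩
    obtain ⟨y, hy⟩ := σ.isPlay t ht
    exact ⟨f.pos y, hf ▸ f.isPath hy⟩
  prefix_closed := by
    rintro s t ⟨w, hw, h⟩
    obtain ⟨a, b, rfl, rfl, rfl⟩ := List.map_eq_append_iff.1 h.symm
    exact ⟨a, σ.prefix_closed _ _ hw, rfl⟩

/-- The union of two strategies. -/
def union (σ τ : Strategy G) : Strategy G where
  plays := σ.plays ∪ τ.plays
  isPlay s h := h.elim (σ.isPlay s) (τ.isPlay s)
  prefix_closed s t h := h.imp (σ.prefix_closed s t) (τ.prefix_closed s t)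

/-- The strategy playing `σ` and `τ` in parallel on `G ‖ H`: its plays are those whose projections
on `G` and `H` are in `σ` and `τ`. -/
def prod (σ : Strategy G) (τ : Strategy H) : Strategy (G.prod H) where
  plays := {s | (G.prod H).IsPlay s ∧
    s.filterMap (Sum.elim (fun a => some a.1) fun _ => none) ∈ σ.plays ∧
    s.filterMap (Sum.elim (fun _ => none) fun b => some b.2) ∈ τ.plays}
  isPlay s h := h.1
  prefix_closed s t h := by
    obtain ⟨h1, h2, h3⟩ := h
    rw [List.filterMap_append] at h2 h3
    exact ⟨h1.prefix, σ.prefix_closed _ _ h2, τ.prefix_closed _ _ h3⟩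

end Strategy

/-! ### Formulas, sequents and proofs -/

/-- Formulas of MALL without units; `covar X` is the dual of the variable `X`. -/
inductive Formula (Var : Type v) : Type v
  | var (X : Var)
  | covar (X : Var)
  | par (A B : Formula Var)
  | tens (A B : Formula Var)
  | with (A B : Formula Var)
  | plus (A B : Formula Var)

namespace Formula

variable {Var : Type v}

/-- The de Morgan dual. -/
def neg : Formula Var → Formula Var
  | var X => covar X
  | covar X => var X
  | par A B => tens A.neg B.neg
  | tens A B => par A.neg B.neg
  | .with A B => plus A.neg B.neg
  | plus A B => .with A.neg B.neg

/-- Positive formulas; as in Andreoli's calculus, variables are positive. -/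
def IsPositive : Formula Var → Prop
  | var _ | tens _ _ | plus _ _ => True
  | covar _ | par _ _ | .with _ _ => False

/-- Negative formulas; as in Andreoli's calculus, duals of variables are negative. -/
def IsNegative (A : Formula Var) : Prop := ¬ A.IsPositive

/-- Formulas with a negative connective at their root, i.e. the negative formulas which can be
decomposed. -/
def IsAsync : Formula Var → Prop
  | par _ _ | .with _ _ => True
  | var _ | covar _ | tens _ _ | plus _ _ => False

end Formula

/-- A (one-sided) sequent: a finite family of formulas. -/
structure Sequent (Var : Type v) : Type (max v 1) where
  ι : Type
  fin : Finite ι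
  fml : ι → Formula Var

attribute [instance] Sequent.fin

namespace Sequent

variable {Var : Type v}

/-- The empty sequent. -/
abbrev nil : Sequent Var := ⟨Empty, inferInstance, fun i => nomatch i⟩

/-- The sequent `Γ, A`. -/
abbrev cons (Γ : Sequent Var) (A : Formula Var) : Sequent Var :=
  ⟨Option Γ.ι, inferInstance, fun
    | none => A
    | some i => Γ.fml i⟩

/-- The sequent `Γ, Δ`. -/
abbrev append (Γ Δ : Sequent Var) : Sequent Var :=
  ⟨Γ.ι ⊕ Δ.ι, inferInstance, Sum.elim Γ.fml Δ.fml⟩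

end Sequent

open Sequent in
/-- Cut-free proofs of MALL. The exchange rule replaces a sequent by one with the same formulas,
numbered differently. -/
inductive Proof {Var : Type v} : Sequent Var → Type (max v 1)
  | ax (A : Formula Var) : Proof ((nil.cons A).cons A.neg)
  | par {Γ : Sequent Var} {A B : Formula Var} (π : Proof ((Γ.cons A).cons B)) :
      Proof (Γ.cons (.par A B))
  | tens {Γ Δ : Sequent Var} {A B : Formula Var} (π₁ : Proof (Γ.cons A))
      (π₂ : Proof (Δ.cons B)) : Proof ((Γ.append Δ).cons (.tens A B))
  | with {Γ : Sequent Var} {A B : Formula Var} (π₁ : Proof (Γ.cons A)) (π₂ : Proof (Γ.cons B)) :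
      Proof (Γ.cons (.with A B))
  | plusL {Γ : Sequent Var} {A B : Formula Var} (π : Proof (Γ.cons A)) :
      Proof (Γ.cons (.plus A B))
  | plusR {Γ : Sequent Var} {A B : Formula Var} (π : Proof (Γ.cons B)) :
      Proof (Γ.cons (.plus A B))
  | exch {Γ Δ : Sequent Var} (e : Γ.ι ≃ Δ.ι) (h : ∀ i, Γ.fml i = Δ.fml (e i)) (π : Proof Γ) :
      Proof Δ

mutual

/-- Focusing proofs. As long as there is a formula with a negative connective at its root, such
a formula has to be decomposed (negative phase); otherwise a positive formula is chosen, on which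
the proof has to focus. -/
inductive Proof.IsFocusing {Var : Type v} : ∀ {Γ : Sequent Var}, Proof Γ → Prop
  | par {Γ : Sequent Var} {A B : Formula Var} {π : Proof ((Γ.cons A).cons B)} :
      Proof.IsFocusing π → Proof.IsFocusing (.par π)
  | with {Γ : Sequent Var} {A B : Formula Var} {π₁ : Proof (Γ.cons A)} {π₂ : Proof (Γ.cons B)} :
      Proof.IsFocusing π₁ → Proof.IsFocusing π₂ → Proof.IsFocusing (.with π₁ π₂)
  | exch {Γ Δ : Sequent Var} (e : Γ.ι ≃ Δ.ι) (h : ∀ i, Γ.fml i = Δ.fml (e i)) {π : Proof Γ} :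
      Proof.IsFocusing π → Proof.IsFocusing (.exch e h π)
  | focus {Γ : Sequent Var} {π : Proof Γ} (i : Γ.ι) : (∀ j, ¬ (Γ.fml j).IsAsync) →
      (Γ.fml i).IsPositive → Proof.IsFocusedOn π i → Proof.IsFocusing π

/-- Proofs in a positive phase focused on the formula numbered `i`: this formula is decomposed
repeatedly, until negative formulas are reached (and the phase ends) or an axiom is applied to
a variable. -/
inductive Proof.IsFocusedOn {Var : Type v} : ∀ {Γ : Sequent Var}, Proof Γ → Γ.ι → Prop
  | axVar (X : Var) : Proof.IsFocusedOn (.ax (.var X)) (some none)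
  | axCovar (X : Var) : Proof.IsFocusedOn (.ax (.covar X)) none
  | tens {Γ Δ : Sequent Var} {A B : Formula Var} {π₁ : Proof (Γ.cons A)}
      {π₂ : Proof (Δ.cons B)} : Proof.IsFocusedOn π₁ none → Proof.IsFocusedOn π₂ none →
      Proof.IsFocusedOn (.tens π₁ π₂) none
  | plusL {Γ : Sequent Var} {A B : Formula Var} {π : Proof (Γ.cons A)} :
      Proof.IsFocusedOn π none → Proof.IsFocusedOn (.plusL (B := B) π) none
  | plusR {Γ : Sequent Var} {A B : Formula Var} {π : Proof (Γ.cons B)} :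
      Proof.IsFocusedOn π none → Proof.IsFocusedOn (.plusR (A := A) π) none
  | exch {Γ Δ : Sequent Var} (e : Γ.ι ≃ Δ.ι) (h : ∀ i, Γ.fml i = Δ.fml (e i)) {π : Proof Γ}
      {i : Γ.ι} : Proof.IsFocusedOn π i → Proof.IsFocusedOn (.exch e h π) (e i)
  | release {Γ : Sequent Var} {π : Proof Γ} (i : Γ.ι) : (Γ.fml i).IsNegative →
      Proof.IsFocusing π → Proof.IsFocusedOn π i

end

/-! ### Interpretation -/

section Interpretation

open AsyncGame (PiTrans)

variable {Var : Type v} (ρ : Var → AsyncGame.{u})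

/-- The game interpreting a formula, given the interpretation `ρ` of the variables. -/
def Formula.game : Formula Var → AsyncGame.{u}
  | .var X => ρ X
  | .covar X => (ρ X).dual
  | .par A B => .mul .O A.game B.game
  | .tens A B => .mul .P A.game B.game
  | .with A B => .add .O A.game B.game
  | .plus A B => .add .P A.game B.game

/-- The position of the game of `A*` corresponding to a position of the game of `A`. -/
def Formula.dualPos : ∀ A : Formula Var, (A.game ρ).Pos → (A.neg.game ρ).Pos
  | .var _ => fun x => x
  | .covar _ => fun x => x
  | .par A B => Option.map (Prod.map (A.dualPos) (B.dualPos))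
  | .tens A B => Option.map (Prod.map (A.dualPos) (B.dualPos))
  | .with A B => Option.map (Sum.map (A.dualPos) (B.dualPos))
  | .plus A B => Option.map (Sum.map (A.dualPos) (B.dualPos))

/-- The transitions of an additive game corresponding to those of another one. -/
def AsyncGame.AddTrans.map {G H G' H' : AsyncGame.{u}} (f : G.Trans → G'.Trans)
    (g : H.Trans → H'.Trans) : AddTrans G H → AddTrans G' H'
  | .chooseL => .chooseL
  | .chooseR => .chooseR
  | .inL m => .inL (f m)
  | .inR n => .inR (g n)

/-- The transition of the game of `A*` corresponding to a transition of the game of `A`. -/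
def Formula.dualTrans : ∀ A : Formula Var, (A.game ρ).Trans → (A.neg.game ρ).Trans
  | .var _ => fun m => m
  | .covar _ => fun m => m
  | .par A B => Option.map (Sum.map (Prod.map A.dualTrans (B.dualPos ρ))
      (Prod.map (A.dualPos ρ) B.dualTrans))
  | .tens A B => Option.map (Sum.map (Prod.map A.dualTrans (B.dualPos ρ))
      (Prod.map (A.dualPos ρ) B.dualTrans))
  | .with A B => AsyncGame.AddTrans.map A.dualTrans B.dualTrans
  | .plus A B => AsyncGame.AddTrans.map A.dualTrans B.dualTrans

/-- The game interpreting a sequent: the asynchronous product of those of its formulas. -/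
noncomputable abbrev Sequent.game (Γ : Sequent Var) : AsyncGame.{u} :=
  .pi fun i => (Γ.fml i).game ρ

/-- The copy-cat strategy on `A, A*`. At each point of a play, the parts of the play in `A` and
in `A*` consist, up to homotopy, of a common path `w` followed by moves of Opponent only (`u` in
`A`, `v` in `A*`), i.e. Proponent only plays copies of moves already played by Opponent in the
other component. (Opponent moves of `A*` are Proponent moves of `A`.) -/
def copycat (A : Formula Var) : Strategy (((Sequent.nil.cons A).cons A.neg).game ρ) where
  plays := {s | (((Sequent.nil.cons A).cons A.neg).game ρ).IsPlay s ∧ ∀ t, t <+: s →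
    ∃ w u v : List (A.game ρ).Trans,
      (A.game ρ).Homotopic (t.filterMap (PiTrans.proj (some none))) (w ++ u) ∧
      (A.neg.game ρ).Homotopic (t.filterMap (PiTrans.proj none))
        ((w ++ v).map (A.dualTrans ρ)) ∧
      (∀ m ∈ u, (A.game ρ).pol m = .O) ∧ (∀ m ∈ v, (A.game ρ).pol m = .P)}
  isPlay _ h := h.1
  prefix_closed s t h := ⟨h.1.prefix, fun r hr => h.2 r (hr.trans (List.prefix_append s t))⟩

/-- The position `(γ, x, y)` of `Γ, A, B` seen as the position `(γ, x ⅋ y)` of `Γ, A ⅋ B`. -/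
def parPos (Γ : Sequent Var) (A B : Formula Var)
    (x : ∀ i, ((((Γ.cons A).cons B).fml i).game ρ).Pos) :
    ∀ i, (((Γ.cons (.par A B)).fml i).game ρ).Pos
  | none => some (x (some none), x none)
  | some i => x (some (some i))

/-- The inclusion of the game of `Γ, A, B` into that of `Γ, A ⅋ B`. -/
def parHom (Γ : Sequent Var) (A B : Formula Var) :
    AsyncGame.Hom (((Γ.cons A).cons B).game ρ) ((Γ.cons (.par A B)).game ρ) where
  pos := parPos ρ Γ A B
  trans
    | ⟨x, none, n, h⟩ => ⟨parPos ρ Γ A B x, none, some (.inr (x (some none), n)),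
        congrArg (fun y => some (x (some none), y)) h⟩
    | ⟨x, some none, m, h⟩ => ⟨parPos ρ Γ A B x, none, some (.inl (m, x none)),
        congrArg (fun y => some (y, x none)) h⟩
    | ⟨x, some (some i), m, h⟩ => ⟨parPos ρ Γ A B x, some i, m, h⟩
  src_trans := by rintro ⟨x, _ | _ | i, m, h⟩ <;> rfl
  tgt_trans := by
    rintro ⟨x, _ | _ | i, m, h⟩ <;> funext j <;> rcases j with _ | j
    · refine (PiTrans.tgt_self _ _ _ _).trans ?_
      exact congrArg some (Prod.ext (PiTrans.tgt_of_ne x _ m h (by simp)).symm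
        (PiTrans.tgt_self x _ m h).symm)
    · exact (PiTrans.tgt_of_ne _ _ _ _ (by simp)).trans (PiTrans.tgt_of_ne x _ m h (by simp)).symm
    · refine (PiTrans.tgt_self _ _ _ _).trans ?_
      exact congrArg some (Prod.ext (PiTrans.tgt_self x _ m h).symm
        (PiTrans.tgt_of_ne x _ m h (by simp)).symm)
    · exact (PiTrans.tgt_of_ne _ _ _ _ (by simp)).trans (PiTrans.tgt_of_ne x _ m h (by simp)).symm
    · refine (PiTrans.tgt_of_ne _ _ _ _ (by simp)).trans ?_
      exact congrArg some (Prod.ext (PiTrans.tgt_of_ne x _ m h (by simp)).symm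
        (PiTrans.tgt_of_ne x _ m h (by simp)).symm)
    · by_cases hj : j = i
      · subst hj
        exact (PiTrans.tgt_self _ _ _ _).trans (PiTrans.tgt_self x _ m h).symm
      · exact (PiTrans.tgt_of_ne _ _ _ _ (by simpa using hj)).trans
          (PiTrans.tgt_of_ne x _ m h (by simpa using hj)).symm

/-- The position `((γ, x), (δ, y))` of `(Γ, A) ‖ (Δ, B)` seen as the position `(γ, δ, x ⊗ y)` of
`Γ, Δ, A ⊗ B`. -/
def tensPos (Γ Δ : Sequent Var) (A B : Formula Var)
    (x : ∀ i, (((Γ.cons A).fml i).game ρ).Pos) (y : ∀ i, (((Δ.cons B).fml i).game ρ).Pos) :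
    ∀ i, ((((Γ.append Δ).cons (.tens A B)).fml i).game ρ).Pos
  | none => some (x none, y none)
  | some (.inl i) => x (some i)
  | some (.inr j) => y (some j)

/-- The inclusion of the product of the games of `Γ, A` and `Δ, B` into that of
`Γ, Δ, A ⊗ B`. -/
def tensHom (Γ Δ : Sequent Var) (A B : Formula Var) :
    AsyncGame.Hom (.prod ((Γ.cons A).game ρ) ((Δ.cons B).game ρ))
      (((Γ.append Δ).cons (.tens A B)).game ρ) where
  pos x := tensPos ρ Γ Δ A B x.1 x.2
  trans
    | .inl (⟨x, none, m, h⟩, y) => ⟨tensPos ρ Γ Δ A B x y, none, some (.inl (m, y none)),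
        congrArg (fun z => some (z, y none)) h⟩
    | .inl (⟨x, some i, m, h⟩, y) => ⟨tensPos ρ Γ Δ A B x y, some (.inl i), m, h⟩
    | .inr (x, ⟨y, none, n, h⟩) => ⟨tensPos ρ Γ Δ A B x y, none, some (.inr (x none, n)),
        congrArg (fun z => some (x none, z)) h⟩
    | .inr (x, ⟨y, some j, n, h⟩) => ⟨tensPos ρ Γ Δ A B x y, some (.inr j), n, h⟩
  src_trans := by rintro (⟨⟨x, _ | i, m, h⟩, y⟩ | ⟨x, ⟨y, _ | i, n, h⟩⟩) <;> rfl
  tgt_trans := by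
    rintro (⟨⟨x, _ | i, m, h⟩, y⟩ | ⟨x, ⟨y, _ | i, m, h⟩⟩) <;> funext j <;> rcases j with _ | j | j
    · refine (PiTrans.tgt_self _ _ _ _).trans ?_
      exact congrArg some (Prod.ext (PiTrans.tgt_self x _ m h).symm rfl)
    · exact (PiTrans.tgt_of_ne _ _ _ _ (by simp)).trans (PiTrans.tgt_of_ne x _ m h (by simp)).symm
    · exact PiTrans.tgt_of_ne _ _ _ _ (by simp)
    · refine (PiTrans.tgt_of_ne _ _ _ _ (by simp)).trans ?_
      exact congrArg some (Prod.ext (PiTrans.tgt_of_ne x _ m h (by simp)).symm rfl)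
    · by_cases hj : j = i
      · subst hj
        exact (PiTrans.tgt_self _ _ _ _).trans (PiTrans.tgt_self x _ m h).symm
      · exact (PiTrans.tgt_of_ne _ _ _ _ (by simpa using hj)).trans
          (PiTrans.tgt_of_ne x _ m h (by simpa using hj)).symm
    · exact PiTrans.tgt_of_ne _ _ _ _ (by simp)
    · refine (PiTrans.tgt_self _ _ _ _).trans ?_
      exact congrArg some (Prod.ext rfl (PiTrans.tgt_self y _ m h).symm)
    · exact PiTrans.tgt_of_ne _ _ _ _ (by simp)
    · exact (PiTrans.tgt_of_ne _ _ _ _ (by simp)).trans (PiTrans.tgt_of_ne y _ m h (by simp)).symm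
    · refine (PiTrans.tgt_of_ne _ _ _ _ (by simp)).trans ?_
      exact congrArg some (Prod.ext rfl (PiTrans.tgt_of_ne y _ m h (by simp)).symm)
    · exact PiTrans.tgt_of_ne _ _ _ _ (by simp)
    · by_cases hj : j = i
      · subst hj
        exact (PiTrans.tgt_self _ _ _ _).trans (PiTrans.tgt_self y _ m h).symm
      · exact (PiTrans.tgt_of_ne _ _ _ _ (by simpa using hj)).trans
          (PiTrans.tgt_of_ne y _ m h (by simpa using hj)).symm

/-- The inclusion of a game into an additive game, on the left. -/
def addHomL (ε : Polarity) (G H : AsyncGame.{u}) : AsyncGame.Hom G (.add ε G H) where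
  pos x := some (.inl x)
  trans m := .inL m
  src_trans _ := rfl
  tgt_trans _ := rfl

/-- The inclusion of a game into an additive game, on the right. -/
def addHomR (ε : Polarity) (G H : AsyncGame.{u}) : AsyncGame.Hom H (.add ε G H) where
  pos x := some (.inr x)
  trans m := .inR m
  src_trans _ := rfl
  tgt_trans _ := rfl

/-- The image of a position of `Γ, A` under a map acting on `A`. -/
def consPos (Γ : Sequent Var) {A C : Formula Var} (f : (A.game ρ).Pos → (C.game ρ).Pos)
    (x : ∀ i, (((Γ.cons A).fml i).game ρ).Pos) : ∀ i, (((Γ.cons C).fml i).game ρ).Pos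
  | none => f (x none)
  | some i => x (some i)

/-- The morphism from the game of `Γ, A` to that of `Γ, C` induced by a morphism from the game of
`A` to that of `C`. -/
def consHom (Γ : Sequent Var) {A C : Formula Var} (f : AsyncGame.Hom (A.game ρ) (C.game ρ)) :
    AsyncGame.Hom ((Γ.cons A).game ρ) ((Γ.cons C).game ρ) where
  pos := consPos ρ Γ f.pos
  trans
    | ⟨x, none, m, h⟩ => ⟨consPos ρ Γ f.pos x, none, f.trans m,
        (f.src_trans m).trans (congrArg f.pos h)⟩
    | ⟨x, some i, m, h⟩ => ⟨consPos ρ Γ f.pos x, some i, m, h⟩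
  src_trans := by rintro ⟨x, _ | i, m, h⟩ <;> rfl
  tgt_trans := by
    rintro ⟨x, _ | i, m, h⟩ <;> funext j <;> rcases j with _ | j
    · refine (PiTrans.tgt_self _ _ _ _).trans ((f.tgt_trans m).trans ?_)
      exact congrArg f.pos (PiTrans.tgt_self x _ m h).symm
    · exact (PiTrans.tgt_of_ne _ _ _ _ (by simp)).trans (PiTrans.tgt_of_ne x _ m h (by simp)).symm
    · refine (PiTrans.tgt_of_ne _ _ _ _ (by simp)).trans ?_
      exact congrArg f.pos (PiTrans.tgt_of_ne x _ m h (by simp)).symm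
    · by_cases hj : j = i
      · subst hj
        exact (PiTrans.tgt_self _ _ _ _).trans (PiTrans.tgt_self x _ m h).symm
      · exact (PiTrans.tgt_of_ne _ _ _ _ (by simpa using hj)).trans
          (PiTrans.tgt_of_ne x _ m h (by simpa using hj)).symm

/-- The transition of the game of `Γ, C` which plays, from the initial position, an initial
transition `r` of `C`. -/
def rootTrans (Γ : Sequent Var) (C : Formula Var) (r : (C.game ρ).Trans)
    (hr : (C.game ρ).src r = (C.game ρ).init) : ((Γ.cons C).game ρ).Trans :=
  ⟨fun i => (((Γ.cons C).fml i).game ρ).init, none, r, hr⟩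

theorem rootTrans_tgt {Γ : Sequent Var} {C : Formula Var} {r : (C.game ρ).Trans}
    {hr : (C.game ρ).src r = (C.game ρ).init} {x : ((Γ.cons C).game ρ).Pos}
    (h : (C.game ρ).tgt r = x none)
    (h' : ∀ i, ((Γ.fml i).game ρ).init = x (some i)) :
    ((Γ.cons C).game ρ).tgt (rootTrans ρ Γ C r hr) = x := by
  funext i
  rcases i with _ | i
  · exact (PiTrans.tgt_self _ _ _ _).trans h
  · exact (PiTrans.tgt_of_ne _ _ _ _ (by simp)).trans (h' i)

/-- Positions of equal formulas. -/
def castPos {A B : Formula Var} (h : A = B) (x : (A.game ρ).Pos) : (B.game ρ).Pos := h ▸ x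

/-- Transitions of equal formulas. -/
def castTrans {A B : Formula Var} (h : A = B) (m : (A.game ρ).Trans) : (B.game ρ).Trans := h ▸ m

theorem src_castTrans {A B : Formula Var} (h : A = B) (m : (A.game ρ).Trans) :
    (B.game ρ).src (castTrans ρ h m) = castPos ρ h ((A.game ρ).src m) := by subst h; rfl

theorem tgt_castTrans {A B : Formula Var} (h : A = B) (m : (A.game ρ).Trans) :
    (B.game ρ).tgt (castTrans ρ h m) = castPos ρ h ((A.game ρ).tgt m) := by subst h; rfl

theorem castPos_init {A B : Formula Var} (h : A = B) :
    castPos ρ h (A.game ρ).init = (B.game ρ).init := by subst h; rfl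

/-- The position of `Δ` obtained by renumbering the components of a position of `Γ`. -/
def exchPos {Γ Δ : Sequent Var} (e : Γ.ι ≃ Δ.ι) (h : ∀ i, Γ.fml i = Δ.fml (e i))
    (x : ∀ i, ((Γ.fml i).game ρ).Pos) (j : Δ.ι) : ((Δ.fml j).game ρ).Pos :=
  castPos ρ ((h (e.symm j)).trans (congrArg Δ.fml (e.apply_symm_apply j))) (x (e.symm j))

theorem exchPos_apply {Γ Δ : Sequent Var} (e : Γ.ι ≃ Δ.ι) (h : ∀ i, Γ.fml i = Δ.fml (e i))
    (x : ∀ i, ((Γ.fml i).game ρ).Pos) (i : Γ.ι) :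
    exchPos ρ e h x (e i) = castPos ρ (h i) (x i) := by
  have key : ∀ k (hk : k = i) (hk' : Γ.fml k = Δ.fml (e i)),
      castPos ρ hk' (x k) = castPos ρ (h i) (x i) := by rintro k rfl hk'; rfl
  exact key _ (e.symm_apply_apply i) _

/-- The renumbering of the components of the game of a sequent. -/
def exchHom {Γ Δ : Sequent Var} (e : Γ.ι ≃ Δ.ι) (h : ∀ i, Γ.fml i = Δ.fml (e i)) :
    AsyncGame.Hom (Γ.game ρ) (Δ.game ρ) where
  pos := exchPos ρ e h
  trans t := ⟨exchPos ρ e h t.pos, e t.idx, castTrans ρ (h t.idx) t.move, by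
    rw [src_castTrans, exchPos_apply, t.src_eq]⟩
  src_trans _ := rfl
  tgt_trans := by
    rintro ⟨x, i, m, hm⟩
    funext j
    obtain ⟨k, rfl⟩ := e.surjective j
    refine Eq.trans ?_ (exchPos_apply ρ e h _ k).symm
    by_cases hk : k = i
    · subst hk
      refine (PiTrans.tgt_self _ _ _ _).trans ((tgt_castTrans ρ (h k) m).trans ?_)
      exact congrArg (castPos ρ (h k)) (PiTrans.tgt_self x k m hm).symm
    · refine (PiTrans.tgt_of_ne _ _ _ _ (by simpa using hk)).trans
        ((exchPos_apply ρ e h x k).trans ?_)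
      exact congrArg (castPos ρ (h k)) (PiTrans.tgt_of_ne x i m hm hk).symm

/-- The strategy interpreting a proof. -/
noncomputable def Proof.interp : ∀ {Γ : Sequent Var}, Proof Γ → Strategy (Γ.game ρ)
  | _, .ax A => copycat ρ A
  | _, .par (Γ := Γ) (A := A) (B := B) π =>
      π.interp.guard (parHom ρ Γ A B) (rootTrans ρ Γ (.par A B) none rfl) rfl
        (rootTrans_tgt ρ rfl fun _ => rfl)
  | _, .tens (Γ := Γ) (Δ := Δ) (A := A) (B := B) π₁ π₂ =>
      (π₁.interp.prod π₂.interp).guard (tensHom ρ Γ Δ A B)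
        (rootTrans ρ (Γ.append Δ) (.tens A B) none rfl) rfl
        (rootTrans_tgt ρ rfl (by rintro (_ | _) <;> rfl))
  | _, .with (Γ := Γ) (A := A) (B := B) π₁ π₂ =>
      .union
        (π₁.interp.guard (consHom ρ Γ (C := .with A B) (addHomL .O (A.game ρ) (B.game ρ)))
          (rootTrans ρ Γ (.with A B) .chooseL rfl) rfl (rootTrans_tgt ρ rfl fun _ => rfl))
        (π₂.interp.guard (consHom ρ Γ (C := .with A B) (addHomR .O (A.game ρ) (B.game ρ)))
          (rootTrans ρ Γ (.with A B) .chooseR rfl) rfl (rootTrans_tgt ρ rfl fun _ => rfl))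
  | _, .plusL (Γ := Γ) (A := A) (B := B) π =>
      π.interp.guard (consHom ρ Γ (C := .plus A B) (addHomL .P (A.game ρ) (B.game ρ)))
        (rootTrans ρ Γ (.plus A B) .chooseL rfl) rfl (rootTrans_tgt ρ rfl fun _ => rfl)
  | _, .plusR (Γ := Γ) (A := A) (B := B) π =>
      π.interp.guard (consHom ρ Γ (C := .plus A B) (addHomR .P (A.game ρ) (B.game ρ)))
        (rootTrans ρ Γ (.plus A B) .chooseR rfl) rfl (rootTrans_tgt ρ rfl fun _ => rfl)
  | _, .exch e h π =>
      π.interp.image (exchHom ρ e h) (by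
        funext j
        obtain ⟨k, rfl⟩ := e.surjective j
        exact (exchPos_apply ρ e h _ k).trans (castPos_init ρ (h k)))

/-- The asynchronous strategy interpreting a proof: the smallest courteous strategy containing
the strategy which follows the order of the rules of the proof. -/
noncomputable def Proof.asyncInterp {Γ : Sequent Var} (π : Proof Γ) : Strategy (Γ.game ρ) :=
  (π.interp ρ).deseq

end Interpretation

end MALL

-- Paths, tile-preserving morphisms and parallel composition.

namespace MALL

namespace AsyncGraph

variable {G : AsyncGraph.{u}}

-- Write σ ≤ τ when σ is included in the smallest courteous strategy containing τ. The aim is to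
-- find, below the strategy of any proof, that of a focusing proof. The relation is taken for all
-- interpretations ρ at once (`Strat`), so that one focusing proof serves every ρ.
--
-- The relation is a preorder, and every operation by which proofs build strategies is monotone for
-- it. For renumberings and for an initial transition followed by a play, this is because the maps
-- involved preserve tiles and polarities (`image_deseq_le`, `guard_deseq_le`). For parallel
-- composition it is a genuine commutation of courtesy with interleaving (`deseq_prod_le`). A proof
-- may thus be rewritten locally, inside any context.
--
-- The rewritings are permutations of rules. Two rules on independent formulas open with two
-- transitions that form two sides of a tile, and courtesy exchanges them as soon as the one played
-- first is Proponent's or the second is Opponent's. Hence a rule may be moved below another if the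
-- former is negative or the latter positive (`op_op_le`). A tensor rule is the juxtaposition
-- (`mix`) with its other premise followed by a unary rule on the two active formulas. It therefore
-- becomes a unary operation with a fixed parameter, and its permutations follow from those of the
-- two constituents.
--
-- Andreoli's argument is then carried out on strategies. The predicates `NF` and `FO` mirror
-- focusing and focused proofs and are closed upwards for ≤. Negative connectives are invertible
-- (`NF.invert`). A positive rule T preserves `NF`, by induction on the size of the context of its
-- premises. If the context contains a decomposable negative formula, the rule of that formula is
-- moved below T (`NF.app_of_isAsync`). Otherwise each premise is focused. When the focus is on the
-- formula used by T, T prolongs the focus. When it is on another formula, the whole positive phase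
-- is moved below T, which reappears only where the phase ends, over a smaller context (`FO.under`,
-- `NF.focus_or_app`).
--
-- Axioms on compound formulas are η-expanded: the plays of the expansion are copy-cat plays,
-- because homotopic projections determine a path of a product up to homotopy (`Copies.prod`), so
-- copy-cat strategies are in `NF` (`NF.copycat`). Hence so is the strategy of every proof
-- (`Proof.strat_nf`), and a derivation of `NF` reads back as a focusing proof (`NF.exists_proof`).

theorem IsPath.unique {x y z : G.Pos} {s : List G.Trans} (h : G.IsPath x s y)
    (h' : G.IsPath x s z) : y = z := by
  induction s generalizing x with
  | nil => exact h.symm.trans h'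
  | cons m s ih => exact ih h.2 h'.2

theorem IsPath.append {x y z : G.Pos} {s t : List G.Trans} (h : G.IsPath x s y)
    (h' : G.IsPath y t z) : G.IsPath x (s ++ t) z :=
  G.isPath_append.2 ⟨y, h, h'⟩

theorem IsPath.exchange {x y : G.Pos} {a b : List G.Trans} {m p n q : G.Trans}
    (h : G.tile m p n q) (hs : G.IsPath x (a ++ m :: p :: b) y) :
    G.IsPath x (a ++ n :: q :: b) y := by
  obtain ⟨z, hz, hm, -, ht⟩ := G.isPath_append.1 hs
  refine hz.append ⟨(G.tile_src h).symm.trans hm, G.tile_right h, ?_⟩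
  rw [← G.tile_tgt h]
  exact ht

end AsyncGraph

open AsyncGame (Hom)

namespace AsyncGame

variable {G G' H K : AsyncGame.{u}}

/-- Composition of graph morphisms. -/
def Hom.comp (g : Hom H K) (f : Hom G H) : Hom G K where
  pos x := g.pos (f.pos x)
  trans m := g.trans (f.trans m)
  src_trans m := (g.src_trans _).trans (congrArg g.pos (f.src_trans m))
  tgt_trans m := (g.tgt_trans _).trans (congrArg g.pos (f.tgt_trans m))

/-- A graph morphism preserving tiles and polarities. -/
structure Hom.IsTiled (f : Hom G H) : Prop where
  tile : ∀ {m p n q}, G.tile m p n q →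
    H.tile (f.trans m) (f.trans p) (f.trans n) (f.trans q)
  pol : ∀ m, H.pol (f.trans m) = G.pol m

/-- The morphism `f ‖ H`. -/
def Hom.prodLeft (f : Hom G G') (H : AsyncGame.{u}) : Hom (G.prod H) (G'.prod H) where
  pos x := (f.pos x.1, x.2)
  trans
    | .inl (m, y) => .inl (f.trans m, y)
    | .inr (x, n) => .inr (f.pos x, n)
  src_trans := by rintro (⟨m, y⟩ | ⟨x, n⟩) <;> simp [f.src_trans]
  tgt_trans := by rintro (⟨m, y⟩ | ⟨x, n⟩) <;> simp [f.tgt_trans]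

/-- The symmetry of the asynchronous product. -/
def prodSwap (G H : AsyncGame.{u}) : Hom (G.prod H) (H.prod G) where
  pos := Prod.swap
  trans
    | .inl (m, y) => .inr (y, m)
    | .inr (x, n) => .inl (n, x)
  src_trans := by rintro (⟨m, y⟩ | ⟨x, n⟩) <;> rfl
  tgt_trans := by rintro (⟨m, y⟩ | ⟨x, n⟩) <;> rfl

theorem prodSwap_isTiled : (prodSwap G H).IsTiled where
  tile h := by
    cases h with
    | left y h => exact .right y h
    | right x h => exact .left x h
    | leftRight h1 h2 h3 h4 => exact .rightLeft h3 h4 h1 h2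
    | rightLeft h1 h2 h3 h4 => exact .leftRight h3 h4 h1 h2
  pol := by rintro (⟨m, y⟩ | ⟨x, n⟩) <;> rfl

-- Projections of interleaved paths.

section Projections

variable {M N X Y : Type*}

/-- The projection of a path of a product on the first component. -/
def projL (s : List (M × Y ⊕ X × N)) : List M :=
  s.filterMap (Sum.elim (fun a => some a.1) fun _ => none)

/-- The projection of a path of a product on the second component. -/
def projR (s : List (M × Y ⊕ X × N)) : List N :=
  s.filterMap (Sum.elim (fun _ => none) fun b => some b.2)

/-- A path of `G` seen in `G ‖ H`, at a position of `H`. -/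
def inLeft (y : Y) (s : List M) : List (M × Y ⊕ X × N) := s.map fun m => .inl (m, y)

/-- A path of `H` seen in `G ‖ H`, at a position of `G`. -/
def inRight (x : X) (s : List N) : List (M × Y ⊕ X × N) := s.map fun n => .inr (x, n)

@[simp] theorem projL_nil : projL ([] : List (M × Y ⊕ X × N)) = [] := rfl
@[simp] theorem projR_nil : projR ([] : List (M × Y ⊕ X × N)) = [] := rfl

@[simp] theorem projL_inl (a) (s : List (M × Y ⊕ X × N)) :
    projL (Sum.inl a :: s) = a.1 :: projL s := rfl
@[simp] theorem projL_inr (a) (s : List (M × Y ⊕ X × N)) :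
    projL (Sum.inr a :: s) = projL s := rfl
@[simp] theorem projR_inl (a) (s : List (M × Y ⊕ X × N)) :
    projR (Sum.inl a :: s) = projR s := rfl
@[simp] theorem projR_inr (a) (s : List (M × Y ⊕ X × N)) :
    projR (Sum.inr a :: s) = a.2 :: projR s := rfl

@[simp] theorem projL_append (s t : List (M × Y ⊕ X × N)) :
    projL (s ++ t) = projL s ++ projL t := List.filterMap_append
@[simp] theorem projR_append (s t : List (M × Y ⊕ X × N)) :
    projR (s ++ t) = projR s ++ projR t := List.filterMap_append

@[simp] theorem projL_inLeft (y : Y) (s : List M) :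
    projL (inLeft y s : List (M × Y ⊕ X × N)) = s := by
  induction s with
  | nil => rfl
  | cons m s ih => exact congrArg _ ih
@[simp] theorem projR_inLeft (y : Y) (s : List M) :
    projR (inLeft y s : List (M × Y ⊕ X × N)) = [] := by
  induction s with
  | nil => rfl
  | cons m s ih => exact ih
@[simp] theorem projL_inRight (x : X) (s : List N) :
    projL (inRight x s : List (M × Y ⊕ X × N)) = [] := by
  induction s with
  | nil => rfl
  | cons m s ih => exact ih
@[simp] theorem projR_inRight (x : X) (s : List N) :
    projR (inRight x s : List (M × Y ⊕ X × N)) = s := by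
  induction s with
  | nil => rfl
  | cons m s ih => exact congrArg _ ih

end Projections

theorem isPath_projL {x x' : G.Pos} {y y' : H.Pos} {s : List (G.Trans × H.Pos ⊕ G.Pos × H.Trans)}
    (h : (G.prod H).IsPath (x, y) s (x', y')) : G.IsPath x (projL s) x' := by
  induction s generalizing x y with
  | nil => exact congrArg Prod.fst h
  | cons m s ih =>
    obtain ⟨h1, h2⟩ := h
    rcases m with ⟨m, z⟩ | ⟨z, n⟩
    · rw [projL_inl]
      exact ⟨congrArg Prod.fst h1, ih h2⟩
    · rw [projL_inr]
      obtain rfl : z = x := congrArg Prod.fst h1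
      exact ih h2

theorem isPath_projR {x x' : G.Pos} {y y' : H.Pos} {s : List (G.Trans × H.Pos ⊕ G.Pos × H.Trans)}
    (h : (G.prod H).IsPath (x, y) s (x', y')) : H.IsPath y (projR s) y' := by
  induction s generalizing x y with
  | nil => exact congrArg Prod.snd h
  | cons m s ih =>
    obtain ⟨h1, h2⟩ := h
    rcases m with ⟨m, z⟩ | ⟨z, n⟩
    · rw [projR_inl]
      obtain rfl : z = y := congrArg Prod.snd h1
      exact ih h2
    · rw [projR_inr]
      exact ⟨congrArg Prod.snd h1, ih h2⟩

theorem isPath_inLeft {x x' : G.Pos} (y : H.Pos) {s : List G.Trans} (h : G.IsPath x s x') :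
    (G.prod H).IsPath (x, y) (inLeft y s) (x', y) := by
  induction s generalizing x with
  | nil => exact congrArg (·, y) h
  | cons m s ih => exact ⟨congrArg (·, y) h.1, ih h.2⟩

theorem isPath_inRight (x : G.Pos) {y y' : H.Pos} {s : List H.Trans} (h : H.IsPath y s y') :
    (G.prod H).IsPath (x, y) (inRight x s) (x, y') := by
  induction s generalizing y with
  | nil => exact congrArg (x, ·) h
  | cons m s ih => exact ⟨congrArg (x, ·) h.1, ih h.2⟩

/-- A path with an empty projection on the first component is in the second one. -/
theorem eq_inRight_of_projL_eq_nil {x x' : G.Pos} {y y' : H.Pos} {s : List (G.Trans × H.Pos ⊕ G.Pos × H.Trans)}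
    (h : (G.prod H).IsPath (x, y) s (x', y')) (hs : projL s = []) :
    x = x' ∧ s = inRight x (projR s) := by
  induction s generalizing x y with
  | nil => exact ⟨congrArg Prod.fst h, rfl⟩
  | cons m s ih =>
    obtain ⟨h1, h2⟩ := h
    rcases m with ⟨m, z⟩ | ⟨z, n⟩
    · simp at hs
    · rw [projL_inr] at hs
      obtain rfl : z = x := congrArg Prod.fst h1
      obtain ⟨e, h3⟩ := ih h2 hs
      refine ⟨e, ?_⟩
      rw [projR_inr, inRight, List.map_cons]
      exact congrArg _ h3

/-- A path whose projection on the first component is not empty starts with a path in the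
second component, followed by the first transition of this projection. -/
theorem exists_of_projL_eq_cons {x x' : G.Pos} {y y' : H.Pos} {s : List (G.Trans × H.Pos ⊕ G.Pos × H.Trans)}
    {m : G.Trans} {w : List G.Trans} (h : (G.prod H).IsPath (x, y) s (x', y'))
    (hs : projL s = m :: w) : ∃ b z t, s = inRight x b ++ Sum.inl (m, z) :: t ∧ projL t = w ∧
      H.IsPath y b z ∧ G.src m = x ∧ (G.prod H).IsPath (G.tgt m, z) t (x', y') := by
  induction s generalizing x y with
  | nil => simp at hs
  | cons k s ih =>
    obtain ⟨h1, h2⟩ := h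
    rcases k with ⟨k, z⟩ | ⟨z, n⟩
    · rw [projL_inl, List.cons.injEq] at hs
      obtain ⟨rfl, hs⟩ := hs
      obtain rfl : z = y := congrArg Prod.snd h1
      exact ⟨[], z, s, rfl, hs, rfl, congrArg Prod.fst h1, h2⟩
    · rw [projL_inr] at hs
      obtain rfl : z = x := congrArg Prod.fst h1
      obtain ⟨b, z', t, rfl, h3, h4, h5, h6⟩ := ih h2 hs
      exact ⟨n :: b, z', t, rfl, h3, ⟨congrArg Prod.snd h1, h4⟩, h5, h6⟩

theorem exists_of_projL_eq_append {x x' : G.Pos} {y y' : H.Pos} {s : List (G.Trans × H.Pos ⊕ G.Pos × H.Trans)}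
    {a w : List G.Trans} (h : (G.prod H).IsPath (x, y) s (x', y'))
    (hs : projL s = a ++ w) : ∃ s₀ s₁ x₁ y₁, s = s₀ ++ s₁ ∧ projL s₀ = a ∧ projL s₁ = w ∧
      (G.prod H).IsPath (x, y) s₀ (x₁, y₁) ∧ (G.prod H).IsPath (x₁, y₁) s₁ (x', y') := by
  obtain ⟨s₀, s₁, rfl, h1, h2⟩ := List.filterMap_eq_append_iff.1 hs
  obtain ⟨⟨x₁, y₁⟩, h3, h4⟩ := (G.prod H).isPath_append.1 h
  exact ⟨s₀, s₁, x₁, y₁, rfl, h1, h2, h3, h4⟩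

end AsyncGame

-- Courtesy closure commutes with the constructions on strategies.

namespace Strategy

open AsyncGame

variable {G G' H K : AsyncGame.{u}}

theorem ext_plays {σ τ : Strategy G} (h : σ.plays = τ.plays) : σ = τ := by
  cases σ; cases τ; cases h; rfl

theorem le_trans' {σ τ υ : Strategy G} (h : σ ≤ τ) (h' : τ ≤ υ) : σ ≤ υ :=
  fun _ hs => h' (h hs)

theorem deseq_mono {σ τ : Strategy G} (h : σ ≤ τ.deseq) : σ.deseq ≤ τ.deseq :=
  deseq_le τ.deseq_courteous h

/-- The plays of `G` whose image lies in a given courteous strategy of `H` form a courteous strategy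
of `G`, since `f` preserves tiles and polarities. Minimality of `σ.deseq` applied to this preimage
`ν` gives the inclusion. -/
theorem image_deseq_le {f : Hom G H} (hf : f.IsTiled) (hf' : f.pos G.init = H.init)
    (σ : Strategy G) : σ.deseq.image f hf' ≤ (σ.image f hf').deseq := by
  rintro _ ⟨t, ht, rfl⟩
  let ν : Strategy G :=
    { plays := {t | G.IsPlay t ∧ t.map f.trans ∈ (σ.image f hf').deseq.plays}
      isPlay := fun _ h => h.1
      prefix_closed := fun s t h => ⟨h.1.prefix,
        (σ.image f hf').deseq.prefix_closed _ (t.map f.trans) (by simpa using h.2)⟩ }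
  refine (ht.2 ν ?_ fun s hs => ⟨σ.isPlay s hs, le_deseq _ ⟨s, hs, rfl⟩⟩).2
  rintro s t m p n q ht hp ⟨⟨y, hy⟩, h⟩
  refine ⟨⟨y, hy.exchange ht⟩, ?_⟩
  simp only [List.map_append, List.map_cons] at h ⊢
  exact deseq_courteous _ _ _ _ _ _ _ (hf.tile ht) (by simpa only [hf.pol] using hp) h

/-- The same preimage argument as for `image_deseq_le`: exchanges made after the initial transition
`r` are exchanges in the whole play. -/
theorem guard_deseq_le {f : Hom G H} (hf : f.IsTiled) {r : H.Trans} (hr : H.src r = H.init)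
    (hr' : H.tgt r = f.pos G.init) (σ : Strategy G) :
    σ.deseq.guard f r hr hr' ≤ (σ.guard f r hr hr').deseq := by
  rintro _ (rfl | ⟨t, ht, rfl⟩)
  · exact le_deseq _ (.inl rfl)
  let ν : Strategy G :=
    { plays := {t | G.IsPlay t ∧ r :: t.map f.trans ∈ (σ.guard f r hr hr').deseq.plays}
      isPlay := fun _ h => h.1
      prefix_closed := fun s t h => ⟨h.1.prefix,
        (σ.guard f r hr hr').deseq.prefix_closed _ (t.map f.trans) (by simpa using h.2)⟩ }
  refine (ht.2 ν ?_ fun s hs => ⟨σ.isPlay s hs, le_deseq _ (.inr ⟨s, hs, rfl⟩)⟩).2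
  rintro s t m p n q ht hp ⟨⟨y, hy⟩, h⟩
  refine ⟨⟨y, hy.exchange ht⟩, ?_⟩
  simp only [List.map_append, List.map_cons] at h ⊢
  exact deseq_courteous _ (r :: s.map f.trans) _ _ _ _ _ (hf.tile ht)
    (by simpa only [hf.pol] using hp) h

theorem image_mono {f : Hom G H} {hf' : f.pos G.init = H.init} {σ τ : Strategy G} (h : σ ≤ τ) :
    σ.image f hf' ≤ τ.image f hf' := by
  rintro _ ⟨t, ht, rfl⟩
  exact ⟨t, h ht, rfl⟩

theorem guard_mono {f : Hom G H} {r : H.Trans} {hr : H.src r = H.init}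
    {hr' : H.tgt r = f.pos G.init} {σ τ : Strategy G} (h : σ ≤ τ) :
    σ.guard f r hr hr' ≤ τ.guard f r hr hr' := by
  rintro _ (rfl | ⟨t, ht, rfl⟩)
  · exact .inl rfl
  · exact .inr ⟨t, h ht, rfl⟩

theorem prod_mono {σ σ' : Strategy G} {τ τ' : Strategy H} (hσ : σ ≤ σ') (hτ : τ ≤ τ') :
    σ.prod τ ≤ σ'.prod τ' := fun _ hs => ⟨hs.1, hσ hs.2.1, hτ hs.2.2⟩

/-- A Proponent transition of the first component may be delayed after a path of the second. -/
theorem Courteous.delay {σ : Strategy (G.prod H)} (hσ : σ.Courteous) {q : G.Trans}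
    (hq : G.pol q = .P) {y y' : H.Pos} {b : List H.Trans} (hb : H.IsPath y b y')
    {a c : List (G.Trans × H.Pos ⊕ G.Pos × H.Trans)}
    (h : a ++ Sum.inl (q, y) :: (inRight (G.tgt q) b ++ c) ∈ σ.plays) :
    a ++ (inRight (G.src q) b ++ Sum.inl (q, y') :: c) ∈ σ.plays := by
  induction b generalizing a y with
  | nil => obtain rfl : y = y' := hb; exact h
  | cons n b ih =>
    obtain ⟨rfl, hb⟩ := hb
    have := hσ a (inRight (G.tgt q) b ++ c) _ _ _ _
      (ProdTile.leftRight (n := n) (m := q) rfl rfl rfl rfl) (.inl hq) (by exact h)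
    have := ih hb (a := a ++ [Sum.inr (G.src q, n)]) (by simpa using this)
    simpa [inRight] using this

/-- An Opponent transition of the first component may be played before a path of the second. -/
theorem Courteous.advance {σ : Strategy (G.prod H)} (hσ : σ.Courteous) {q : G.Trans}
    (hq : G.pol q = .O) {y y' : H.Pos} {b : List H.Trans} (hb : H.IsPath y b y')
    {a c : List (G.Trans × H.Pos ⊕ G.Pos × H.Trans)}
    (h : a ++ (inRight (G.src q) b ++ Sum.inl (q, y') :: c) ∈ σ.plays) :
    a ++ Sum.inl (q, y) :: (inRight (G.tgt q) b ++ c) ∈ σ.plays := by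
  induction b generalizing a y with
  | nil => obtain rfl : y = y' := hb; exact h
  | cons n b ih =>
    obtain ⟨rfl, hb⟩ := hb
    have := ih hb (a := a ++ [Sum.inr (G.src q, n)]) (by simpa [inRight] using h)
    have := hσ a (inRight (G.tgt q) b ++ c) _ _ _ _
      (ProdTile.rightLeft (n := n) (m := q) rfl rfl rfl rfl) (.inr hq) (by simpa using this)
    exact this

/-- An exchange in the projection on `G` concerns two transitions that may be separated, in the
interleaving, by a path of `H`. Courtesy of the product strategy makes these transitions adjacent: a
Proponent transition may be delayed past this path, an Opponent one advanced before it. -/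
theorem deseq_prod_le (σ : Strategy G) (τ : Strategy H) :
    σ.deseq.prod τ ≤ (σ.prod τ).deseq := by
  rintro s ⟨hs, hσ, hτ⟩
  -- Quantifying over all interleavings `s` of `a` with plays of `τ` is what makes `ν` courteous:
  -- the interleaving can be chosen to suit the tile.
  let ν : Strategy G :=
    { plays := {a | G.IsPlay a ∧ ∀ s, (G.prod H).IsPlay s → projL s = a → projR s ∈ τ.plays →
        s ∈ (σ.prod τ).deseq.plays}
      isPlay := fun _ h => h.1
      prefix_closed := by
        rintro a b ⟨⟨z, hz⟩, h⟩
        refine ⟨⟨z, hz⟩ |> AsyncGame.IsPlay.prefix, ?_⟩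
        rintro s ⟨⟨x, y⟩, hs⟩ rfl hs'
        obtain ⟨x', h1, h2⟩ := G.isPath_append.1 hz
        obtain rfl := (isPath_projL hs).unique h1
        -- The rest `b` of the play of `G` is appended after the whole interleaving.
        refine (σ.prod τ).deseq.prefix_closed s (inLeft y b) (h _ ?_ ?_ ?_)
        · exact ⟨_, hs.append (isPath_inLeft y h2)⟩
        · simp
        · simpa using hs' }
  refine (hσ.2 ν ?_ fun a ha => ⟨σ.isPlay a ha, ?_⟩).2 s hs rfl hτ
  · rintro a b m p n q ht hp ⟨⟨z, hz⟩, h⟩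
    refine ⟨⟨z, hz.exchange ht⟩, ?_⟩
    rintro s ⟨⟨x', y'⟩, hs⟩ hsL hsR
    obtain ⟨s₀, s₁, x₁, y₁, rfl, rfl, h1, h2, h3⟩ := exists_of_projL_eq_append hs hsL
    obtain ⟨b₀, y₂, s₂, rfl, h4, h5, h6, h7⟩ := exists_of_projL_eq_cons h3 h1
    obtain ⟨b₁, y₃, s₃, rfl, h8, h9, h10, h11⟩ := exists_of_projL_eq_cons h7 h4
    have hC := deseq_courteous (σ.prod τ)
    subst h6
    have hmn := G.tile_src ht
    have hpm := G.tile_left ht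
    have hpq := G.tile_tgt ht
    -- The given play is `s₀ · b₀ · n · b₁ · q · s₃`. If `m` is Proponent's, so is its residual `q`:
    -- start from `b₀ · m · p · b₁`, exchange to `b₀ · n · q · b₁`, and delay `q` past `b₁`. If `p`
    -- is Opponent's, so is `n`: start from `b₀ · b₁ · m · p`, exchange to `b₀ · b₁ · n · q`, and
    -- advance `n` before `b₁`.
    cases hm : G.pol m with
    | P =>
      have hq : G.pol q = .P := (G.pol_residual ht).trans hm
      have key := h (s₀ ++ (inRight (G.src n) b₀ ++ Sum.inl (m, y₂) :: Sum.inl (p, y₂) ::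
        (inRight (G.tgt p) b₁ ++ s₃))) ⟨(x', y'), h2.append ((isPath_inRight _ h5).append
          ⟨congrArg (·, y₂) hmn, congrArg (·, y₂) hpm, (isPath_inRight _ h9).append
            (show (G.prod H).IsPath (G.tgt p, y₃) _ _ by rw [hpq]; exact h11)⟩)⟩ (by simp [h8]) (by simpa using hsR)
      have key := hC (s₀ ++ inRight (G.src n) b₀) (inRight (G.tgt p) b₁ ++ s₃) _ _ _ _
        (ProdTile.left y₂ ht) (.inl hm) (by simpa using key)
      rw [hpq] at key
      have key := hC.delay hq h9 (a := s₀ ++ inRight (G.src n) b₀ ++ [Sum.inl (n, y₂)]) (c := s₃)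
        (by simpa using key)
      rw [h10] at key
      simpa using key
    | O =>
      have hp : G.pol p = .O := by simpa [hm] using hp
      have hn : G.pol n = .O := (G.pol_residual (G.tile_symm ht)).symm.trans hp
      have key := h (s₀ ++ (inRight (G.src n) b₀ ++ (inRight (G.src n) b₁ ++
        Sum.inl (m, y₃) :: Sum.inl (p, y₃) :: s₃))) ⟨(x', y'), h2.append
          ((isPath_inRight _ h5).append ((isPath_inRight _ h9).append
          ⟨congrArg (·, y₃) hmn, congrArg (·, y₃) hpm, show (G.prod H).IsPath (G.tgt p, y₃) _ _ by rw [hpq]; exact h11⟩))⟩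
          (by simp [h8]) (by simpa using hsR)
      have key := hC (s₀ ++ inRight (G.src n) b₀ ++ inRight (G.src n) b₁) s₃ _ _ _ _
        (ProdTile.left y₃ ht) (.inr hp) (by simpa using key)
      have key := hC.advance hn h9 (a := s₀ ++ inRight (G.src n) b₀)
        (c := Sum.inl (q, y₃) :: s₃) (by simpa using key)
      simpa using key
  · rintro s hs rfl hs'
    exact le_deseq _ ⟨hs, ha, hs'⟩

theorem projL_map_prodSwap (s : List (G.Trans × H.Pos ⊕ G.Pos × H.Trans)) :
    projL (s.map (prodSwap G H).trans) = projR s := by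
  induction s with
  | nil => rfl
  | cons m s ih =>
    rcases m with m | m
    · exact ih
    · exact congrArg (_ :: ·) ih

theorem projR_map_prodSwap (s : List (G.Trans × H.Pos ⊕ G.Pos × H.Trans)) :
    projR (s.map (prodSwap G H).trans) = projL s := by
  induction s with
  | nil => rfl
  | cons m s ih =>
    rcases m with m | m
    · exact congrArg (_ :: ·) ih
    · exact ih

theorem map_prodSwap_prodSwap (s : List (G.Trans × H.Pos ⊕ G.Pos × H.Trans)) :
    (s.map (prodSwap G H).trans).map (prodSwap H G).trans = s := by
  rw [List.map_map]
  convert List.map_id s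
  funext m
  rcases m with m | m <;> rfl

theorem image_prodSwap (σ : Strategy G) (τ : Strategy H) :
    (σ.prod τ).image (prodSwap G H) rfl = τ.prod σ := by
  apply ext_plays
  ext s
  constructor
  · rintro ⟨t, ht, rfl⟩
    refine ⟨((σ.prod τ).image (prodSwap G H) rfl).isPlay _ ⟨t, ht, rfl⟩, ?_, ?_⟩
    · exact (congrArg (· ∈ _) (projL_map_prodSwap t)).mpr ht.2.2
    · exact (congrArg (· ∈ _) (projR_map_prodSwap t)).mpr ht.2.1
  · intro h
    refine ⟨s.map (prodSwap H G).trans, ?_, (map_prodSwap_prodSwap s).symm⟩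
    obtain ⟨y, hy⟩ := h.1
    refine ⟨⟨_, (prodSwap H G).isPath hy⟩, ?_, ?_⟩
    · exact (congrArg (· ∈ _) (projL_map_prodSwap s)).mpr h.2.2
    · exact (congrArg (· ∈ _) (projR_map_prodSwap s)).mpr h.2.1

/-- Transported from `deseq_prod_le` by the symmetry of the product, which preserves tiles and
polarities. -/
theorem prod_deseq_le (σ : Strategy G) (τ : Strategy H) :
    σ.prod τ.deseq ≤ (σ.prod τ).deseq := by
  rw [← image_prodSwap τ.deseq, ← image_prodSwap τ]
  exact le_trans' (image_mono (deseq_prod_le τ σ)) (image_deseq_le prodSwap_isTiled _ _)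

theorem prod_le_deseq {σ σ' : Strategy G} {τ τ' : Strategy H} (h : σ ≤ σ'.deseq)
    (h' : τ ≤ τ'.deseq) : σ.prod τ ≤ (σ'.prod τ').deseq :=
  le_trans' (prod_mono h h') (le_trans' (deseq_prod_le _ _) (deseq_mono (prod_deseq_le _ _)))

theorem projL_map_prodLeft (f : Hom G G') (s : List (G.Trans × H.Pos ⊕ G.Pos × H.Trans)) :
    projL (s.map (f.prodLeft H).trans) = (projL s).map f.trans := by
  induction s with
  | nil => rfl
  | cons m s ih =>
    rcases m with m | m
    · exact congrArg (_ :: ·) ih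
    · exact ih

theorem projR_map_prodLeft (f : Hom G G') (s : List (G.Trans × H.Pos ⊕ G.Pos × H.Trans)) :
    projR (s.map (f.prodLeft H).trans) = projR s := by
  induction s with
  | nil => rfl
  | cons m s ih =>
    rcases m with m | m
    · exact ih
    · exact congrArg (_ :: ·) ih

/-- Playing `r` before everything else is one of the possible interleavings, so no condition on
polarity or courtesy is needed. -/
theorem guard_prod_le (σ : Strategy G) (τ : Strategy H) (f : Hom G G') (r : G'.Trans)
    (hr : G'.src r = G'.init) (hr' : G'.tgt r = f.pos G.init) (hσ : [] ∈ τ.plays) :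
    (σ.prod τ).guard (f.prodLeft H) (.inl (r, H.init)) (congrArg (·, H.init) hr)
      (congrArg (·, H.init) hr') ≤ (σ.guard f r hr hr').prod τ := by
  intro s hs
  refine ⟨isPlay _ _ hs, ?_⟩
  rcases hs with rfl | ⟨t, ht, rfl⟩
  · exact ⟨.inl rfl, hσ⟩
  · refine ⟨.inr ⟨projL t, ht.2.1, ?_⟩, ?_⟩
    · rw [← projL_map_prodLeft]; rfl
    · exact (congrArg (· ∈ _) (projR_map_prodLeft f t)).mpr ht.2.2

/-- Lifting along `f ‖ H` of a path whose first projection is the image of a path by `f`. -/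
theorem exists_map_prodLeft (f : Hom G G') {x x' : G.Pos} {y : H.Pos} {z : G'.Pos × H.Pos}
    {w : List G.Trans}
    (hw : G.IsPath x w x') {s : List (G'.Trans × H.Pos ⊕ G'.Pos × H.Trans)} (hs : projL s = w.map f.trans)
    (h : (G'.prod H).IsPath (f.pos x, y) s z) :
    ∃ t, s = t.map (f.prodLeft H).trans ∧ projL t = w ∧ ∃ z', (G.prod H).IsPath (x, y) t z' := by
  induction s generalizing x y w with
  | nil =>
    cases w with
    | nil => exact ⟨[], rfl, rfl, _, rfl⟩
    | cons => simp at hs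
  | cons m s ih =>
    obtain ⟨h1, h2⟩ := h
    rcases m with ⟨m, y'⟩ | ⟨x'', n⟩
    · rw [projL_inl] at hs
      cases w with
      | nil => simp at hs
      | cons k w =>
        rw [List.map_cons, List.cons.injEq] at hs
        obtain ⟨rfl, hs⟩ := hs
        obtain rfl : y' = y := congrArg Prod.snd h1
        change (G'.prod H).IsPath (G'.tgt _, y') s z at h2
        rw [f.tgt_trans] at h2
        obtain ⟨t, rfl, rfl, z', h3⟩ := ih hw.2 hs h2
        exact ⟨Sum.inl (k, y') :: t, rfl, projL_inl _ _, z', congrArg (·, y') hw.1, h3⟩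
    · rw [projL_inr] at hs
      obtain rfl : x'' = f.pos x := congrArg Prod.fst h1
      obtain ⟨t, rfl, rfl, z', h3⟩ := ih hw hs h2
      exact ⟨Sum.inr (x, n) :: t, rfl, projL_inr _ _, z',
        congrArg (x, ·) (congrArg Prod.snd h1), h3⟩

/-- In an interleaving, `r` may come after a path of `H`. The play with `r` moved to the front
belongs to the guarded strategy, and since `r` is Proponent's, courtesy delays it back to its place.
-/
theorem prod_guard_le (σ : Strategy G) (τ : Strategy H) (f : Hom G G') (r : G'.Trans)
    (hr : G'.src r = G'.init) (hr' : G'.tgt r = f.pos G.init) (hσ : [] ∈ σ.plays)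
    (hP : G'.pol r = .P) :
    (σ.guard f r hr hr').prod τ ≤
      ((σ.prod τ).guard (f.prodLeft H) (.inl (r, H.init)) (congrArg (·, H.init) hr)
      (congrArg (·, H.init) hr')).deseq := by
  set υ := (σ.prod τ).guard (f.prodLeft H) (.inl (r, H.init)) (congrArg (·, H.init) hr)
      (congrArg (·, H.init) hr')
  have key : ∀ s w, (G'.prod H).IsPlay s → w ∈ σ.plays → projL s = r :: w.map f.trans →
      projR s ∈ τ.plays → s ∈ υ.deseq.plays := by
    rintro s w ⟨⟨x, y⟩, hs⟩ hw h1 h2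
    obtain ⟨b, y₁, t, rfl, h3, h4, h5, h6⟩ := exists_of_projL_eq_cons hs h1
    rw [← h5]
    refine υ.deseq_courteous.delay (a := []) hP h4 (le_deseq _ ?_)
    obtain ⟨x', hx'⟩ := σ.isPlay w hw
    rw [hr']
    have h8 : (G'.prod H).IsPath (f.pos G.init, H.init) (inRight (f.pos G.init) b ++ t) (x, y) :=
      (isPath_inRight _ h4).append (hr' ▸ h6)
    obtain ⟨t', ht', rfl, z, hz⟩ := exists_map_prodLeft f hx' (by simpa using h3) h8
    refine .inr ⟨t', ⟨⟨z, hz⟩, hw, ?_⟩, by rw [ht']; rfl⟩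
    change projR t' ∈ _
    rw [← projR_map_prodLeft f, ← ht']
    simpa using h2
  rintro s ⟨hs, h1 | ⟨w, hw, h1⟩, h2⟩ <;> change projL s = _ at h1 <;>
    change projR s ∈ _ at h2
  -- The transition `r` has not been played: add it at the end, and take a prefix.
  · obtain ⟨⟨x, y⟩, hs⟩ := hs
    obtain ⟨rfl, -⟩ := eq_inRight_of_projL_eq_nil hs h1
    refine υ.deseq.prefix_closed s [Sum.inl (r, y)] (key _ [] ⟨(G'.tgt r, y), ?_⟩ hσ ?_ ?_)
    · exact hs.append ⟨congrArg (·, y) hr, rfl⟩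
    · simpa using h1
    · simpa using h2
  · exact key s w hs hw h1 h2

end Strategy

end MALL

-- Morphisms between the games of sequents.

namespace MALL

open AsyncGame (Hom PiTrans)

namespace AsyncGame

variable {ι : Type} [Finite ι] {G : ι → AsyncGame.{u}} {H : AsyncGame.{u}}

/-- A morphism from a product preserves tiles as soon as it preserves those in a component and
those between two components. -/
theorem Hom.isTiled_of_pi (f : Hom (AsyncGame.pi G) H)
    (pol : ∀ m, H.pol (f.trans m) = (AsyncGame.pi G).pol m)
    (same : ∀ i a b c d x y z ha hb hc hd, (G i).tile a b c d → y = PiTrans.tgt ⟨x, i, a, ha⟩ →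
      z = PiTrans.tgt ⟨x, i, c, hc⟩ → (AsyncGame.pi G).tile ⟨x, i, a, ha⟩ ⟨y, i, b, hb⟩
        ⟨x, i, c, hc⟩ ⟨z, i, d, hd⟩ → H.tile (f.trans ⟨x, i, a, ha⟩)
        (f.trans ⟨y, i, b, hb⟩) (f.trans ⟨x, i, c, hc⟩) (f.trans ⟨z, i, d, hd⟩))
    (diff : ∀ i j a c x y z ha hb hc hd, i ≠ j → y = PiTrans.tgt ⟨x, i, a, ha⟩ →
      z = PiTrans.tgt ⟨x, j, c, hc⟩ → (AsyncGame.pi G).tile ⟨x, i, a, ha⟩ ⟨y, j, c, hb⟩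
        ⟨x, j, c, hc⟩ ⟨z, i, a, hd⟩ → H.tile (f.trans ⟨x, i, a, ha⟩)
        (f.trans ⟨y, j, c, hb⟩) (f.trans ⟨x, j, c, hc⟩) (f.trans ⟨z, i, a, hd⟩)) :
    f.IsTiled := by
  refine ⟨?_, pol⟩
  rintro ⟨x, i, m, hm⟩ ⟨y, j, p, hp⟩ ⟨x', k, n, hn⟩ ⟨z, l, q, hq⟩ ht
  obtain ⟨h1, h2, h3, h4⟩ := id ht
  obtain rfl : x = x' := h1
  rcases h4 with ⟨i', a, b, c, d, ht', e1, e2, e3, e4⟩ | ⟨hne, e1, e2⟩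
  · simp only [PiTrans.lab] at e1 e2 e3 e4
    cases e1; cases e2; cases e3; cases e4
    exact same _ _ _ _ _ _ _ _ _ _ _ _ ht' h2 h3 ht
  · simp only [PiTrans.lab] at e1 e2
    cases e1; cases e2
    exact diff _ _ _ _ _ _ _ _ _ _ _ hne h2 h3 ht

/-- The images of a tile under a morphism to a product form a tile, if their labels do. -/
theorem Hom.pi_tile (f : Hom H (AsyncGame.pi G)) {m p n q : H.Trans} (ht : H.tile m p n q)
    (h : (∃ i a b c d, (G i).tile a b c d ∧
        (f.trans m).lab = ⟨i, a⟩ ∧ (f.trans p).lab = ⟨i, b⟩ ∧ (f.trans n).lab = ⟨i, c⟩ ∧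
        (f.trans q).lab = ⟨i, d⟩) ∨
      ((f.trans m).idx ≠ (f.trans n).idx ∧ (f.trans p).lab = (f.trans n).lab ∧
        (f.trans q).lab = (f.trans m).lab)) :
    (AsyncGame.pi G).tile (f.trans m) (f.trans p) (f.trans n) (f.trans q) := by
  refine ⟨?_, ?_, ?_, h⟩
  · exact (f.src_trans m).trans ((congrArg f.pos (H.tile_src ht)).trans (f.src_trans n).symm)
  · exact (f.src_trans p).trans ((congrArg f.pos (H.tile_left ht)).trans (f.tgt_trans m).symm)
  · exact (f.src_trans q).trans ((congrArg f.pos (H.tile_right ht)).trans (f.tgt_trans n).symm)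

end AsyncGame

namespace Strategy

open AsyncGame

variable {G G' H H' K : AsyncGame.{u}}

theorem image_image {f : Hom G H} {g : Hom H K} {h : Hom G K} {hf hg hh} (σ : Strategy G)
    (e : ∀ m, g.trans (f.trans m) = h.trans m) :
    (σ.image f hf).image g hg = σ.image h hh := by
  apply ext_plays
  ext s
  constructor
  · rintro ⟨_, ⟨t, ht, rfl⟩, rfl⟩
    exact ⟨t, ht, by simp [e]⟩
  · rintro ⟨t, ht, rfl⟩
    exact ⟨_, ⟨t, ht, rfl⟩, by simp [e]⟩

theorem image_id {f : Hom G G} {hf} (σ : Strategy G) (e : ∀ m, f.trans m = m) :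
    σ.image f hf = σ := by
  apply ext_plays
  ext s
  have : f.trans = id := funext e
  constructor
  · rintro ⟨t, ht, rfl⟩
    simpa [this] using ht
  · intro h
    exact ⟨s, h, by simp [this]⟩

/-- The commutation of `guard` and `image`. -/
theorem image_guard {f : Hom G H} {r : H.Trans} {hr hr'} {g : Hom H K} {hg} {f' : Hom G G'}
    {hf'} {g' : Hom G' K} {r' : K.Trans} {hr'' hr'''} (σ : Strategy G)
    (e : ∀ m, g.trans (f.trans m) = g'.trans (f'.trans m)) (er : g.trans r = r') :
    (σ.guard f r hr hr').image g hg = (σ.image f' hf').guard g' r' hr'' hr''' := by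
  apply ext_plays
  ext s
  constructor
  · rintro ⟨_, rfl | ⟨t, ht, rfl⟩, rfl⟩
    · exact .inl rfl
    · exact .inr ⟨_, ⟨t, ht, rfl⟩, by simp [e, er]⟩
  · rintro (rfl | ⟨_, ⟨t, ht, rfl⟩, rfl⟩)
    · exact ⟨[], .inl rfl, rfl⟩
    · exact ⟨_, .inr ⟨t, ht, rfl⟩, by simp [e, er]⟩

/-- An interleaving whose first projection is the image of a play by `f` lifts as a whole along `f ‖
H` (`exists_map_prodLeft`), so no courtesy closure is involved. -/
theorem image_prod (σ : Strategy G) (τ : Strategy H) (f : Hom G G') (hf) (hf') :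
    (σ.image f hf).prod τ = (σ.prod τ).image (f.prodLeft H) hf' := by
  apply ext_plays
  ext s
  constructor
  · rintro ⟨⟨z, hz⟩, ⟨w, hw, h1⟩, h2⟩
    obtain ⟨x', hx'⟩ := σ.isPlay w hw
    change (G'.prod H).IsPath (G'.init, H.init) s z at hz
    rw [← hf] at hz
    obtain ⟨t, rfl, h3, z', h4⟩ := exists_map_prodLeft f hx' h1 hz
    exact ⟨t, ⟨⟨z', h4⟩, (congrArg (· ∈ _) h3).mpr hw,
      (congrArg (· ∈ _) (projR_map_prodLeft f t)).mp h2⟩, rfl⟩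
  · rintro ⟨t, ht, rfl⟩
    exact ⟨((σ.prod τ).image (f.prodLeft H) hf').isPlay _ ⟨t, ht, rfl⟩,
      ⟨_, ht.2.1, projL_map_prodLeft f t⟩,
      (congrArg (· ∈ _) (projR_map_prodLeft f t)).mpr ht.2.2⟩

end Strategy

/-! ### Sequents up to renumbering -/

namespace Sequent

variable {Var : Type v}

/-- The sequent with one formula. -/
abbrev one (A : Formula Var) : Sequent Var := ⟨Unit, inferInstance, fun _ => A⟩

/-- A renumbering of the formulas of a sequent. -/
structure Iso (Γ Δ : Sequent Var) where
  e : Γ.ι ≃ Δ.ι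
  h : ∀ i, Γ.fml i = Δ.fml (e i)

namespace Iso

variable {Γ Γ' Δ Δ' Θ : Sequent Var}

theorem ext' {a b : Iso Γ Δ} (h : ∀ i, a.e i = b.e i) : a = b := by
  obtain ⟨a, ha⟩ := a
  obtain ⟨b, hb⟩ := b
  obtain rfl : a = b := Equiv.ext h
  rfl

@[refl] def refl (Γ : Sequent Var) : Iso Γ Γ := ⟨Equiv.refl _, fun _ => rfl⟩

def symm (a : Iso Γ Δ) : Iso Δ Γ :=
  ⟨a.e.symm, fun i => by rw [a.h, Equiv.apply_symm_apply]⟩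

def trans (a : Iso Γ Δ) (b : Iso Δ Θ) : Iso Γ Θ :=
  ⟨a.e.trans b.e, fun i => (a.h i).trans (b.h _)⟩

def append (a : Iso Γ Γ') (b : Iso Δ Δ') : Iso (Γ.append Δ) (Γ'.append Δ') :=
  ⟨Equiv.sumCongr a.e b.e, by rintro (i | i); exacts [a.h i, b.h i]⟩

/-- Renumbering of the context only. -/
def left (a : Iso Γ Γ') (Δ : Sequent Var) : Iso (Γ.append Δ) (Γ'.append Δ) := a.append (refl Δ)

/-- Renumbering of the second part only. -/
def right (Γ : Sequent Var) (b : Iso Δ Δ') : Iso (Γ.append Δ) (Γ.append Δ') :=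
  (refl Γ).append b

def assoc (Γ Δ Θ : Sequent Var) : Iso ((Γ.append Δ).append Θ) (Γ.append (Δ.append Θ)) :=
  ⟨Equiv.sumAssoc _ _ _, by rintro ((i | i) | i) <;> rfl⟩

def comm (Γ Δ : Sequent Var) : Iso (Γ.append Δ) (Δ.append Γ) :=
  ⟨Equiv.sumComm _ _, by rintro (i | i) <;> rfl⟩

/-- The exchange of the last two parts of a sequent. -/
def swap (Γ Δ Θ : Sequent Var) : Iso ((Γ.append Δ).append Θ) ((Γ.append Θ).append Δ) where
  e :=
    { toFun
        | .inl (.inl i) => .inl (.inl i)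
        | .inl (.inr j) => .inr j
        | .inr k => .inl (.inr k)
      invFun
        | .inl (.inl i) => .inl (.inl i)
        | .inl (.inr j) => .inr j
        | .inr k => .inl (.inr k)
      left_inv := by rintro ((i | i) | i) <;> rfl
      right_inv := by rintro ((i | i) | i) <;> rfl }
  h := by rintro ((i | i) | i) <;> rfl

end Iso

end Sequent

open Sequent

/-! ### The logical rules, acting on one formula -/

variable {Var : Type v}

/-- The introduction rules: `Rule Θ C` is a rule introducing the formula `C`, whose immediate
subformulas `Θ` are in the premise. For `&`, the two premises give rise to two rules, and for
`⊗` the two premises are considered as a single one. -/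
inductive Rule : Sequent Var → Formula Var → Type (max v 1)
  | par (A B : Formula Var) : Rule ((one A).append (one B)) (.par A B)
  | tens (A B : Formula Var) : Rule ((one A).append (one B)) (.tens A B)
  | withL (A B : Formula Var) : Rule (one A) (.with A B)
  | withR (A B : Formula Var) : Rule (one B) (.with A B)
  | plusL (A B : Formula Var) : Rule (one A) (.plus A B)
  | plusR (A B : Formula Var) : Rule (one B) (.plus A B)

section

variable (ρ : Var → AsyncGame.{u})

theorem Sequent.tgt_self {Γ : Sequent Var} (x : ∀ i, ((Γ.fml i).game ρ).Pos) (i : Γ.ι)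
    (m : ((Γ.fml i).game ρ).Trans) (h : ((Γ.fml i).game ρ).src m = x i) :
    (PiTrans.mk (G := fun i => (Γ.fml i).game ρ) x i m h).tgt i = ((Γ.fml i).game ρ).tgt m :=
  PiTrans.tgt_self (G := fun i => (Γ.fml i).game ρ) x i m h

theorem Sequent.tgt_of_ne {Γ : Sequent Var} (x : ∀ i, ((Γ.fml i).game ρ).Pos) (i : Γ.ι)
    (m : ((Γ.fml i).game ρ).Trans) (h : ((Γ.fml i).game ρ).src m = x i) {j : Γ.ι} (hj : j ≠ i) :
    (PiTrans.mk (G := fun i => (Γ.fml i).game ρ) x i m h).tgt j = x j :=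
  PiTrans.tgt_of_ne (G := fun i => (Γ.fml i).game ρ) x i m h hj

/-- The position of `A * B` for a multiplicative connective `*`. -/
def mulPos (A B : Formula Var) (x : ∀ i, ((((one A).append (one B)).fml i).game ρ).Pos) :
    Option ((A.game ρ).Pos × (B.game ρ).Pos) :=
  some (x (.inl ()), x (.inr ()))

/-- The inclusion of the game of `A, B` into that of `A * B`. -/
def mulHom (ε : Polarity) (A B : Formula Var) :
    Hom (((one A).append (one B)).game ρ) (.mul ε (A.game ρ) (B.game ρ)) where
  pos := mulPos ρ A B
  trans
    | ⟨x, .inl _, m, _⟩ => some (.inl (m, x (.inr ())))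
    | ⟨x, .inr _, n, _⟩ => some (.inr (x (.inl ()), n))
  src_trans := by
    rintro ⟨x, _ | _, m, h⟩
    · exact congrArg (fun y => some (y, x (.inr ()))) h
    · exact congrArg (fun y => some (x (.inl ()), y)) h
  tgt_trans := by
    rintro ⟨x, _ | _, m, h⟩
    · exact congrArg some (Prod.ext (PiTrans.tgt_self x _ m h).symm
        (PiTrans.tgt_of_ne x _ m h (by simp)).symm)
    · exact congrArg some (Prod.ext (PiTrans.tgt_of_ne x _ m h (by simp)).symm
        (PiTrans.tgt_self x _ m h).symm)

theorem mulHom_isTiled (ε : Polarity) (A B : Formula Var) : (mulHom ρ ε A B).IsTiled := by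
  apply Hom.isTiled_of_pi
  · rintro ⟨x, _ | _, m, h⟩ <;> rfl
  · rintro (_ | _) a b c d x y z ha hb hc hd ht rfl rfl -
    · have h1 := PiTrans.tgt_of_ne x _ a ha (j := .inr ()) (by simp)
      have h2 := PiTrans.tgt_of_ne x _ c hc (j := .inr ()) (by simp)
      simp only [mulHom]
      rw [h1, h2]
      exact .mk (.left _ ht)
    · have h1 := PiTrans.tgt_of_ne x _ a ha (j := .inl ()) (by simp)
      have h2 := PiTrans.tgt_of_ne x _ c hc (j := .inl ()) (by simp)
      simp only [mulHom]
      rw [h1, h2]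
      exact .mk (.right _ ht)
  · rintro (_ | _) (_ | _) a c x y z ha hb hc hd hne rfl rfl -
    · exact absurd rfl hne
    · have h1 := PiTrans.tgt_self x _ a ha
      have h2 := PiTrans.tgt_self x _ c hc
      simp only [mulHom]
      rw [h1, h2]
      exact .mk (.leftRight ha rfl hc rfl)
    · have h1 := PiTrans.tgt_self x _ a ha
      have h2 := PiTrans.tgt_self x _ c hc
      simp only [mulHom]
      rw [h1, h2]
      exact .mk (.rightLeft hc rfl ha rfl)
    · exact absurd rfl hne

/-- A morphism from the game of `A` seen as one from the game of the sequent `A`. -/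
def oneHom {A : Formula Var} {H : AsyncGame.{u}} (f : Hom (A.game ρ) H) :
    Hom ((one A).game ρ) H where
  pos x := f.pos (x ())
  trans t := f.trans t.move
  src_trans t := (f.src_trans _).trans (congrArg f.pos t.src_eq)
  tgt_trans t := (f.tgt_trans _).trans
    (congrArg f.pos (PiTrans.tgt_self t.pos t.idx t.move t.src_eq).symm)

theorem oneHom_isTiled {A : Formula Var} {H : AsyncGame.{u}} {f : Hom (A.game ρ) H}
    (hf : f.IsTiled) : (oneHom ρ f).IsTiled := by
  apply Hom.isTiled_of_pi
  · exact fun m => hf.pol m.move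
  · exact fun i a b c d x y z ha hb hc hd ht h h' _ => hf.tile ht
  · exact fun i j a c x y z ha hb hc hd hne => absurd rfl hne

theorem addHomL_isTiled (ε : Polarity) (G H : AsyncGame.{u}) : (addHomL ε G H).IsTiled :=
  ⟨fun h => .left h, fun _ => rfl⟩

theorem addHomR_isTiled (ε : Polarity) (G H : AsyncGame.{u}) : (addHomR ε G H).IsTiled :=
  ⟨fun h => .right h, fun _ => rfl⟩

namespace Rule

variable {Θ : Sequent Var} {C : Formula Var}

/-- The polarity of the connective introduced by a rule. -/
def pol : Rule Θ C → Polarity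
  | .par _ _ | .withL _ _ | .withR _ _ => .O
  | .tens _ _ | .plusL _ _ | .plusR _ _ => .P

/-- The inclusion of the game of the subformulas into that of the formula. -/
def hom : Rule Θ C → Hom (Θ.game ρ) (C.game ρ)
  | .par A B => mulHom ρ .O A B
  | .tens A B => mulHom ρ .P A B
  | .withL A B => oneHom ρ (addHomL .O (A.game ρ) (B.game ρ))
  | .withR A B => oneHom ρ (addHomR .O (A.game ρ) (B.game ρ))
  | .plusL A B => oneHom ρ (addHomL .P (A.game ρ) (B.game ρ))
  | .plusR A B => oneHom ρ (addHomR .P (A.game ρ) (B.game ρ))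

/-- The transition introducing the connective. -/
def root : Rule Θ C → (C.game ρ).Trans
  | .par _ _ => (none : Option _)
  | .tens _ _ => (none : Option _)
  | .withL _ _ => AsyncGame.AddTrans.chooseL
  | .withR _ _ => AsyncGame.AddTrans.chooseR
  | .plusL _ _ => AsyncGame.AddTrans.chooseL
  | .plusR _ _ => AsyncGame.AddTrans.chooseR

theorem hom_isTiled (R : Rule Θ C) : (R.hom ρ).IsTiled := by
  cases R
  · exact mulHom_isTiled _ _ _ _
  · exact mulHom_isTiled _ _ _ _
  · exact oneHom_isTiled _ (addHomL_isTiled _ _ _)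
  · exact oneHom_isTiled _ (addHomR_isTiled _ _ _)
  · exact oneHom_isTiled _ (addHomL_isTiled _ _ _)
  · exact oneHom_isTiled _ (addHomR_isTiled _ _ _)

theorem root_src (R : Rule Θ C) : (C.game ρ).src (R.root ρ) = (C.game ρ).init := by
  cases R <;> rfl

theorem root_tgt (R : Rule Θ C) :
    (C.game ρ).tgt (R.root ρ) = (R.hom ρ).pos (Θ.game ρ).init := by
  cases R <;> rfl

theorem root_pol (R : Rule Θ C) : (C.game ρ).pol (R.root ρ) = R.pol := by
  cases R <;> rfl

theorem pol_of_isAsync (R : Rule Θ C) (h : C.IsAsync) : R.pol = .O := by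
  cases R <;> first | rfl | exact h.elim

/-- The position of `Γ, C` corresponding to a position of `Γ, Θ`. -/
def ctxPos (R : Rule Θ C) (Γ : Sequent Var) (x : ∀ i, (((Γ.append Θ).fml i).game ρ).Pos) :
    ∀ i, (((Γ.append (one C)).fml i).game ρ).Pos
  | .inl i => x (.inl i)
  | .inr _ => (R.hom ρ).pos fun k => x (.inr k)

/-- Compatibility of targets with the restriction of positions from `Γ, Θ` to `Θ`; it reduces
statements on `ctxHom` to statements on `R.hom`. -/
theorem tgt_inr {Γ : Sequent Var} (x : ∀ i, (((Γ.append Θ).fml i).game ρ).Pos) (k : Θ.ι)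
    (m : ((Θ.fml k).game ρ).Trans) (h : ((Θ.fml k).game ρ).src m = x (.inr k)) :
    (fun j => (PiTrans.mk (G := fun i => ((Γ.append Θ).fml i).game ρ) x (.inr k) m h).tgt (.inr j))
      = (PiTrans.mk (G := fun i => (Θ.fml i).game ρ) (fun j => x (.inr j)) k m h).tgt := by
  funext j
  by_cases hj : j = k
  · subst hj
    exact (PiTrans.tgt_self x (.inr j) m h).trans (Sequent.tgt_self ρ _ j m h).symm
  · exact (PiTrans.tgt_of_ne x (.inr k) m h (by simpa using hj)).trans
      (Sequent.tgt_of_ne ρ (fun j => x (.inr j)) k m h hj).symm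

/-- The inclusion of the game of `Γ, Θ` into that of `Γ, C`. -/
def ctxHom (R : Rule Θ C) (Γ : Sequent Var) :
    Hom ((Γ.append Θ).game ρ) ((Γ.append (one C)).game ρ) where
  pos := R.ctxPos ρ Γ
  trans
    | ⟨x, .inl i, m, h⟩ => ⟨R.ctxPos ρ Γ x, .inl i, m, h⟩
    | ⟨x, .inr k, m, h⟩ => ⟨R.ctxPos ρ Γ x, .inr (), (R.hom ρ).trans ⟨fun k => x (.inr k), k, m, h⟩,
        (R.hom ρ).src_trans _⟩
  src_trans := by rintro ⟨x, i | k, m, h⟩ <;> rfl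
  tgt_trans := by
    rintro ⟨x, i | k, m, h⟩ <;> funext j <;> rcases j with j | j
    · by_cases hj : j = i
      · subst hj
        exact (PiTrans.tgt_self _ _ _ _).trans (PiTrans.tgt_self x _ m h).symm
      · exact (PiTrans.tgt_of_ne _ _ _ _ (by simpa using hj)).trans
          (PiTrans.tgt_of_ne x _ m h (by simpa using hj)).symm
    · refine (PiTrans.tgt_of_ne _ _ _ _ (by simp)).trans ?_
      refine congrArg (R.hom ρ).pos (funext fun k => ?_)
      exact (PiTrans.tgt_of_ne x _ m h (by simp)).symm
    · exact (PiTrans.tgt_of_ne _ _ _ _ (by simp)).trans (PiTrans.tgt_of_ne x _ m h (by simp)).symm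
    · refine (PiTrans.tgt_self _ _ _ _).trans (((R.hom ρ).tgt_trans _).trans ?_)
      exact congrArg (R.hom ρ).pos (tgt_inr ρ x k m h).symm

/-- The formulas of `Θ` are all merged into the component `C`, so tiles inside `Θ` come from tiles
of `C` through `R.hom`, while tiles involving `Γ` keep their form. -/
theorem ctxHom_isTiled (R : Rule Θ C) (Γ : Sequent Var) : (R.ctxHom ρ Γ).IsTiled := by
  apply Hom.isTiled_of_pi
  · rintro ⟨x, i | k, m, h⟩
    · rfl
    · exact (R.hom_isTiled ρ).pol _
  · rintro (i | k) a b c d x y z ha hb hc hd ht hy hz ht'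
    · exact Hom.pi_tile _ ht' (.inl ⟨.inl i, a, b, c, d, ht, rfl, rfl, rfl, rfl⟩)
    · refine Hom.pi_tile _ ht' (.inl ⟨.inr (), _, _, _, _, ?_, rfl, rfl, rfl, rfl⟩)
      exact (R.hom_isTiled ρ).tile (m := ⟨fun j => x (.inr j), k, a, ha⟩)
        (p := ⟨fun j => y (.inr j), k, b, hb⟩) (n := ⟨fun j => x (.inr j), k, c, hc⟩)
        (q := ⟨fun j => z (.inr j), k, d, hd⟩) ⟨rfl,
        (congrArg (fun y j => y (.inr j)) hy).trans (tgt_inr ρ x k a ha),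
        (congrArg (fun y j => y (.inr j)) hz).trans (tgt_inr ρ x k c hc),
        .inl ⟨k, a, b, c, d, ht, rfl, rfl, rfl, rfl⟩⟩
  · rintro (i | k) (j | l) a c x y z ha hb hc hd hne hy hz ht'
    · exact Hom.pi_tile _ ht' (.inr ⟨by simpa [ctxHom] using hne, rfl, rfl⟩)
    · refine Hom.pi_tile _ ht' (.inr ⟨by simp [ctxHom], ?_, rfl⟩)
      subst hy hz
      refine Sigma.ext rfl (heq_of_eq ?_)
      -- For a multiplicative connective, the copy in `C` of a transition of one subformula records
      -- the position in the other one. A transition of `Γ` leaves it unchanged, so both copies have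
      -- the same label.
      have : (fun j => (PiTrans.mk (G := fun i => ((Γ.append Θ).fml i).game ρ)
          x (.inl i) a ha).tgt (.inr j)) = fun j => x (.inr j) :=
        funext fun j => PiTrans.tgt_of_ne x _ a ha (by simp)
      simp only [ctxHom, PiTrans.lab, this]
      rfl
    · refine Hom.pi_tile _ ht' (.inr ⟨by simp [ctxHom], rfl, ?_⟩)
      subst hy hz
      refine Sigma.ext rfl (heq_of_eq ?_)
      have : (fun i => (PiTrans.mk (G := fun i => ((Γ.append Θ).fml i).game ρ)
          x (.inl j) c hc).tgt (.inr i)) = fun j => x (.inr j) :=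
        funext fun j => PiTrans.tgt_of_ne x _ c hc (by simp)
      simp only [ctxHom, PiTrans.lab, this]
      rfl
    -- Independent transitions of two subformulas of `C`: they now lie in one component, and form a
    -- tile of the game of `C` itself.
    · refine Hom.pi_tile _ ht' (.inl ⟨.inr (), _, _, _, _, ?_, rfl, rfl, rfl, rfl⟩)
      have hne' : k ≠ l := fun h => hne (congrArg _ h)
      exact (R.hom_isTiled ρ).tile (m := ⟨fun j => x (.inr j), k, a, ha⟩)
        (p := ⟨fun j => y (.inr j), l, c, hb⟩) (n := ⟨fun j => x (.inr j), l, c, hc⟩)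
        (q := ⟨fun j => z (.inr j), k, a, hd⟩) ⟨rfl,
        (congrArg (fun y j => y (.inr j)) hy).trans (tgt_inr ρ x k a ha),
        (congrArg (fun y j => y (.inr j)) hz).trans (tgt_inr ρ x l c hc),
        .inr ⟨hne', rfl, rfl⟩⟩

/-- The transition of `Γ, C` introducing the connective of `C`. -/
def ctxRoot (R : Rule Θ C) (Γ : Sequent Var) : ((Γ.append (one C)).game ρ).Trans :=
  ⟨fun i => (((Γ.append (one C)).fml i).game ρ).init, .inr (), R.root ρ, R.root_src ρ⟩

theorem ctxRoot_tgt (R : Rule Θ C) (Γ : Sequent Var) :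
    ((Γ.append (one C)).game ρ).tgt (R.ctxRoot ρ Γ) =
      (R.ctxHom ρ Γ).pos ((Γ.append Θ).game ρ).init := by
  funext j
  rcases j with j | j
  · exact PiTrans.tgt_of_ne _ _ _ _ (by simp)
  · exact (PiTrans.tgt_self _ _ _ _).trans (R.root_tgt ρ)

end Rule

/-! ### Renumbering and juxtaposition of games -/

theorem castPos_castPos {A B C : Formula Var} (h : A = B) (h' : B = C) (x : (A.game ρ).Pos) :
    castPos ρ h' (castPos ρ h x) = castPos ρ (h.trans h') x := by subst h; rfl

theorem castTrans_castTrans {A B C : Formula Var} (h : A = B) (h' : B = C)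
    (x : (A.game ρ).Trans) :
    castTrans ρ h' (castTrans ρ h x) = castTrans ρ (h.trans h') x := by subst h; rfl

theorem castTrans_tile {A B : Formula Var} (h : A = B) {a b c d : (A.game ρ).Trans}
    (ht : (A.game ρ).tile a b c d) : (B.game ρ).tile (castTrans ρ h a) (castTrans ρ h b)
      (castTrans ρ h c) (castTrans ρ h d) := by subst h; exact ht

theorem pol_castTrans {A B : Formula Var} (h : A = B) (m : (A.game ρ).Trans) :
    (B.game ρ).pol (castTrans ρ h m) = (A.game ρ).pol m := by subst h; rfl

theorem exchHom_isTiled {Γ Δ : Sequent Var} (e : Γ.ι ≃ Δ.ι) (h : ∀ i, Γ.fml i = Δ.fml (e i)) :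
    (exchHom ρ e h).IsTiled := by
  apply Hom.isTiled_of_pi
  · rintro ⟨x, i, m, hm⟩
    exact pol_castTrans ρ _ _
  · intro i a b c d x y z ha hb hc hd ht hy hz ht'
    exact Hom.pi_tile _ ht' (.inl ⟨e i, _, _, _, _, castTrans_tile ρ (h i) ht, rfl, rfl, rfl, rfl⟩)
  · intro i j a c x y z ha hb hc hd hne hy hz ht'
    exact Hom.pi_tile _ ht' (.inr ⟨by simpa [exchHom] using hne, rfl, rfl⟩)

theorem exchHom_init {Γ Δ : Sequent Var} (e : Γ.ι ≃ Δ.ι) (h : ∀ i, Γ.fml i = Δ.fml (e i)) :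
    (exchHom ρ e h).pos (Γ.game ρ).init = (Δ.game ρ).init := by
  funext j
  obtain ⟨k, rfl⟩ := e.surjective j
  exact (exchPos_apply ρ e h _ k).trans (castPos_init ρ (h k))

theorem exchHom_trans {Γ Δ Θ : Sequent Var} (a : Iso Γ Δ) (b : Iso Δ Θ) (t : (Γ.game ρ).Trans) :
    (exchHom ρ b.e b.h).trans ((exchHom ρ a.e a.h).trans t) =
      (exchHom ρ (a.trans b).e (a.trans b).h).trans t := by
  obtain ⟨x, i, m, hm⟩ := t
  refine PiTrans.ext_lab ?_ ?_
  · funext j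
    obtain ⟨k, rfl⟩ := (a.trans b).e.surjective j
    refine Eq.trans ?_ (exchPos_apply ρ (a.trans b).e (a.trans b).h x k).symm
    refine (exchPos_apply ρ b.e b.h _ (a.e k)).trans ?_
    refine (congrArg _ (exchPos_apply ρ a.e a.h x k)).trans ?_
    exact castPos_castPos ρ _ _ _
  · exact Sigma.ext rfl (heq_of_eq (castTrans_castTrans ρ _ _ _))

/-- The position of `Γ, Δ` corresponding to positions of `Γ` and `Δ`. -/
def mixPos (Γ Δ : Sequent Var) (x : ∀ i, ((Γ.fml i).game ρ).Pos)
    (y : ∀ i, ((Δ.fml i).game ρ).Pos) : ∀ i, (((Γ.append Δ).fml i).game ρ).Pos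
  | .inl i => x i
  | .inr j => y j

/-- The product of the games of `Γ` and `Δ` is included in that of `Γ, Δ`. -/
def mixHom (Γ Δ : Sequent Var) :
    Hom (.prod (Γ.game ρ) (Δ.game ρ)) ((Γ.append Δ).game ρ) where
  pos x := mixPos ρ Γ Δ x.1 x.2
  trans
    | .inl (⟨x, i, m, h⟩, y) => ⟨mixPos ρ Γ Δ x y, .inl i, m, h⟩
    | .inr (x, ⟨y, j, n, h⟩) => ⟨mixPos ρ Γ Δ x y, .inr j, n, h⟩
  src_trans := by rintro (⟨⟨x, i, m, h⟩, y⟩ | ⟨x, ⟨y, i, n, h⟩⟩) <;> rfl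
  tgt_trans := by
    rintro (⟨⟨x, i, m, h⟩, y⟩ | ⟨x, ⟨y, i, m, h⟩⟩) <;> funext j <;> rcases j with j | j
    · by_cases hj : j = i
      · subst hj
        exact (PiTrans.tgt_self _ _ _ _).trans (PiTrans.tgt_self x _ m h).symm
      · exact (PiTrans.tgt_of_ne _ _ _ _ (by simpa using hj)).trans
          (PiTrans.tgt_of_ne x _ m h (by simpa using hj)).symm
    · exact PiTrans.tgt_of_ne _ _ _ _ (by simp)
    · exact PiTrans.tgt_of_ne _ _ _ _ (by simp)
    · by_cases hj : j = i
      · subst hj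
        exact (PiTrans.tgt_self _ _ _ _).trans (PiTrans.tgt_self y _ m h).symm
      · exact (PiTrans.tgt_of_ne _ _ _ _ (by simpa using hj)).trans
          (PiTrans.tgt_of_ne y _ m h (by simpa using hj)).symm

theorem mixHom_init (Γ Δ : Sequent Var) : (mixHom ρ Γ Δ).pos (AsyncGame.init _) = AsyncGame.init _ := by
  funext j
  rcases j with j | j <;> rfl

/-- Tiles inside one factor keep their labels up to an injection of indices; the tiles of the
product mixing the two factors become tiles between two different components. -/
theorem mixHom_isTiled (Γ Δ : Sequent Var) : (mixHom ρ Γ Δ).IsTiled := by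
  let lL : (Σ i, ((Γ.fml i).game ρ).Trans) → Σ i, (((Γ.append Δ).fml i).game ρ).Trans :=
    fun l => ⟨.inl l.1, l.2⟩
  let lR : (Σ i, ((Δ.fml i).game ρ).Trans) → Σ i, (((Γ.append Δ).fml i).game ρ).Trans :=
    fun l => ⟨.inr l.1, l.2⟩
  constructor
  · intro m p n q ht
    refine Hom.pi_tile _ ht ?_
    cases ht with
    | left y h =>
      obtain ⟨-, -, -, ⟨i, a, b, c, d, ht', e1, e2, e3, e4⟩ | ⟨hne, e1, e2⟩⟩ := h
      · refine .inl ⟨.inl i, a, b, c, d, ht', ?_⟩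
        exact ⟨congrArg lL e1, congrArg lL e2, congrArg lL e3, congrArg lL e4⟩
      · exact .inr ⟨fun h => hne (Sum.inl_injective h),
          congrArg lL e1, congrArg lL e2⟩
    | right y h =>
      obtain ⟨-, -, -, ⟨i, a, b, c, d, ht', e1, e2, e3, e4⟩ | ⟨hne, e1, e2⟩⟩ := h
      · refine .inl ⟨.inr i, a, b, c, d, ht', ?_⟩
        exact ⟨congrArg lR e1, congrArg lR e2, congrArg lR e3, congrArg lR e4⟩
      · exact .inr ⟨fun h => hne (Sum.inr_injective h),
          congrArg lR e1, congrArg lR e2⟩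
    | leftRight h1 h2 h3 h4 => exact .inr ⟨Sum.inl_ne_inr, rfl, rfl⟩
    | rightLeft h1 h2 h3 h4 => exact .inr ⟨Sum.inr_ne_inl, rfl, rfl⟩
  · rintro (⟨⟨x, i, m, h⟩, y⟩ | ⟨x, ⟨y, i, n, h⟩⟩) <;> rfl

end

end MALL

namespace MALL

open AsyncGame (Hom PiTrans)
open Sequent

variable {Var : Type v}

/-! ### Families of strategies -/

/-- A non-empty strategy on the game of `Γ`, for every interpretation of the variables. -/
structure Strat (Γ : Sequent Var) where
  strat : ∀ ρ : Var → AsyncGame.{u}, Strategy (Γ.game ρ)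
  nil_mem : ∀ ρ, [] ∈ (strat ρ).plays

namespace Strat

variable {Γ Γ' Δ Δ' Θ Ω K : Sequent Var}

theorem ext_strat {σ τ : Strat.{u} Γ} (h : ∀ ρ, σ.strat ρ = τ.strat ρ) : σ = τ := by
  cases σ; cases τ
  congr
  exact funext h

/-- `σ ≤ τ` if `σ` is included in the smallest courteous strategy containing `τ`. -/
instance : Preorder (Strat.{u} Γ) where
  le σ τ := ∀ ρ, σ.strat ρ ≤ (τ.strat ρ).deseq
  le_refl σ ρ := Strategy.le_deseq _
  le_trans _ _ _ h h' ρ := Strategy.le_trans' (h ρ) (Strategy.deseq_mono (h' ρ))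

theorem le_of_subset {σ τ : Strat.{u} Γ} (h : ∀ ρ, σ.strat ρ ≤ τ.strat ρ) : σ ≤ τ :=
  fun ρ => Strategy.le_trans' (h ρ) (Strategy.le_deseq _)

/-- Renumbering of the formulas of a sequent. -/
noncomputable def ex (σ : Strat.{u} Γ) (a : Iso Γ Δ) : Strat.{u} Δ where
  strat ρ := (σ.strat ρ).image (exchHom ρ a.e a.h) (exchHom_init ρ _ _)
  nil_mem ρ := ⟨[], σ.nil_mem ρ, rfl⟩

theorem ex_mono (a : Iso Γ Δ) {σ τ : Strat.{u} Γ} (h : σ ≤ τ) : σ.ex a ≤ τ.ex a :=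
  fun ρ => Strategy.le_trans' (Strategy.image_mono (hf' := exchHom_init ρ _ _) (h ρ))
    (Strategy.image_deseq_le (exchHom_isTiled ρ _ _) _ _)

@[simp] theorem ex_ex (σ : Strat.{u} Γ) (a : Iso Γ Δ) (b : Iso Δ Θ) :
    (σ.ex a).ex b = σ.ex (a.trans b) :=
  ext_strat fun ρ => Strategy.image_image (hf := exchHom_init ρ _ _) (hg := exchHom_init ρ _ _)
    (hh := exchHom_init ρ _ _) _ (exchHom_trans ρ a b)

/-- A renumbering is determined by its action on indices. All equations between composites of
renumberings are checked through this lemma, by cases on the part of the sequent in which an index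
lies. -/
theorem ex_congr (σ : Strat.{u} Γ) {a b : Iso Γ Δ} (h : ∀ i, a.e i = b.e i) :
    σ.ex a = σ.ex b := congrArg _ (Iso.ext' h)

theorem ex_refl (σ : Strat.{u} Γ) : σ.ex (Iso.refl Γ) = σ :=
  ext_strat fun ρ => Strategy.image_id (hf := exchHom_init ρ _ _) _ fun _ => rfl

theorem ex_eq_self (σ : Strat.{u} Γ) {a : Iso Γ Γ} (h : ∀ i, a.e i = i) : σ.ex a = σ :=
  (σ.ex_congr h).trans σ.ex_refl

/-- The juxtaposition of two strategies. -/
noncomputable def mix (σ : Strat.{u} Γ) (τ : Strat.{u} Δ) : Strat.{u} (Γ.append Δ) where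
  strat ρ := ((σ.strat ρ).prod (τ.strat ρ)).image (mixHom ρ Γ Δ) (mixHom_init ρ Γ Δ)
  nil_mem ρ := ⟨[], ⟨⟨_, rfl⟩, σ.nil_mem ρ, τ.nil_mem ρ⟩, rfl⟩

/-- Rests on `Strategy.prod_le_deseq`, that is, on the commutation of courtesy closure with
interleaving in each argument. -/
theorem mix_mono {σ σ' : Strat.{u} Γ} {τ τ' : Strat.{u} Δ} (h : σ ≤ σ') (h' : τ ≤ τ') :
    σ.mix τ ≤ σ'.mix τ' :=
  fun ρ => Strategy.le_trans' (Strategy.image_mono (hf' := mixHom_init ρ _ _)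
    (Strategy.prod_le_deseq (h ρ) (h' ρ)))
    (Strategy.image_deseq_le (mixHom_isTiled ρ _ _) _ _)

theorem mix_ex_left (σ : Strat.{u} Γ) (τ : Strat.{u} Δ) (a : Iso Γ Γ') :
    (σ.ex a).mix τ = (σ.mix τ).ex (a.left Δ) := by
  refine ext_strat fun ρ => ?_
  have h : ((exchHom ρ a.e a.h).prodLeft (Δ.game ρ)).pos (AsyncGame.init _) = AsyncGame.init _ :=
    congrArg (·, _) (exchHom_init ρ _ _)
  have h' : ((mixHom ρ Γ' Δ).comp ((exchHom ρ a.e a.h).prodLeft (Δ.game ρ))).pos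
      (AsyncGame.init _) = AsyncGame.init _ :=
    (congrArg (mixHom ρ Γ' Δ).pos h).trans (mixHom_init ρ _ _)
  dsimp only [ex, mix]
  rw [Strategy.image_prod _ _ _ _ h, Strategy.image_image (hh := h') _ fun _ => rfl]
  refine Eq.symm (Strategy.image_image _ ?_)
  rintro (⟨⟨x, i, m, hm⟩, y⟩ | ⟨x, ⟨y, i, n, hn⟩⟩)
  · refine PiTrans.ext_lab (funext fun j => ?_) rfl
    rcases j with j | j <;> rfl
  · refine PiTrans.ext_lab (funext fun j => ?_) rfl
    rcases j with j | j <;> rfl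

theorem mix_comm (σ : Strat.{u} Γ) (τ : Strat.{u} Δ) :
    τ.mix σ = (σ.mix τ).ex (Iso.comm Γ Δ) := by
  refine ext_strat fun ρ => ?_
  dsimp only [ex, mix]
  rw [← Strategy.image_prodSwap]
  have h : ((mixHom ρ Δ Γ).comp (AsyncGame.prodSwap (Γ.game ρ) (Δ.game ρ))).pos
      (AsyncGame.init _) = AsyncGame.init _ := mixHom_init ρ _ _
  refine (Strategy.image_image (hh := h) _ fun _ => rfl).trans (Eq.symm (Strategy.image_image _ ?_))
  rintro (⟨⟨x, i, m, hm⟩, y⟩ | ⟨x, ⟨y, i, n, hn⟩⟩)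
  · refine PiTrans.ext_lab (funext fun j => ?_) rfl
    rcases j with j | j <;> rfl
  · refine PiTrans.ext_lab (funext fun j => ?_) rfl
    rcases j with j | j <;> rfl

theorem mix_ex_right (σ : Strat.{u} Γ) (τ : Strat.{u} Δ) (a : Iso Δ Δ') :
    σ.mix (τ.ex a) = (σ.mix τ).ex (Iso.right Γ a) := by
  rw [mix_comm (τ.ex a), mix_ex_left, mix_comm σ, ex_ex, ex_ex]
  refine ex_congr _ ?_
  rintro (i | i) <;> rfl

/-- Juxtapositions commute. -/
theorem mix_mix_le (σ : Strat.{u} Γ) (τ : Strat.{u} Δ) (υ : Strat.{u} Θ) :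
    (σ.mix τ).mix υ ≤ ((σ.mix υ).mix τ).ex (Iso.swap Γ Θ Δ) := by
  refine le_of_subset fun ρ => ?_
  rintro _ ⟨t, ⟨⟨z, hz⟩, ⟨w, hw, h1⟩, h2⟩, rfl⟩
  obtain ⟨⟨x', y'⟩, hw'⟩ := hw.1
  change (AsyncGame.prod ((Γ.append Δ).game ρ) (Θ.game ρ)).IsPath (_, _) t z at hz
  rw [← mixHom_init] at hz
  obtain ⟨t, rfl, rfl, ⟨⟨x₁, y₁⟩, z₁⟩, h4⟩ := Strategy.exists_map_prodLeft (mixHom ρ Γ Δ) hw' h1 hz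
  -- The regrouping of `(Γ ‖ Δ) ‖ Θ` as `(Γ ‖ Θ) ‖ Δ`. It keeps the three projections (`e1`, `e2`,
  -- `e3`), and membership depends only on them.
  let f : Hom (AsyncGame.prod (.prod (Γ.game ρ) (Δ.game ρ)) (Θ.game ρ))
      (AsyncGame.prod (.prod (Γ.game ρ) (Θ.game ρ)) (Δ.game ρ)) :=
    { pos := fun x => ((x.1.1, x.2), x.1.2)
      trans := fun
        | .inl (.inl (m, y), z) => .inl (.inl (m, z), y)
        | .inl (.inr (x, n), z) => .inr ((x, z), n)
        | .inr ((x, y), k) => .inl (.inr (x, k), y)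
      src_trans := by rintro (⟨⟨m, y⟩ | ⟨x, n⟩, z⟩ | ⟨⟨x, y⟩, k⟩) <;> rfl
      tgt_trans := by rintro (⟨⟨m, y⟩ | ⟨x, n⟩, z⟩ | ⟨⟨x, y⟩, k⟩) <;> rfl }
  have e1 : ∀ t, AsyncGame.projL (AsyncGame.projL (t.map f.trans)) =
      AsyncGame.projL (AsyncGame.projL t) := by
    intro t
    induction t with
    | nil => rfl
    | cons m t ih =>
      rcases m with ⟨⟨m, y⟩ | ⟨x, n⟩, z⟩ | ⟨⟨x, y⟩, k⟩
      · exact congrArg (_ :: ·) ih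
      · exact ih
      · exact ih
  have e2 : ∀ t, AsyncGame.projR (AsyncGame.projL (t.map f.trans)) = AsyncGame.projR t := by
    intro t
    induction t with
    | nil => rfl
    | cons m t ih =>
      rcases m with ⟨⟨m, y⟩ | ⟨x, n⟩, z⟩ | ⟨⟨x, y⟩, k⟩
      · exact ih
      · exact ih
      · exact congrArg (_ :: ·) ih
  have e3 : ∀ t, AsyncGame.projR (t.map f.trans) = AsyncGame.projR (AsyncGame.projL t) := by
    intro t
    induction t with
    | nil => rfl
    | cons m t ih =>
      rcases m with ⟨⟨m, y⟩ | ⟨x, n⟩, z⟩ | ⟨⟨x, y⟩, k⟩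
      · exact ih
      · exact congrArg (_ :: ·) ih
      · exact ih
  have h5 := f.isPath h4
  have h6 := ((mixHom ρ Γ Θ).prodLeft (Δ.game ρ)).isPath h5
  change (AsyncGame.prod ((Γ.append Θ).game ρ) (Δ.game ρ)).IsPath
    ((mixHom ρ Γ Θ).pos (AsyncGame.init _), _) _ _ at h6
  rw [mixHom_init] at h6
  refine ⟨_, ⟨(t.map f.trans).map ((mixHom ρ Γ Θ).prodLeft (Δ.game ρ)).trans,
    ⟨⟨_, h6⟩, ⟨AsyncGame.projL (t.map f.trans),
      ⟨⟨_, AsyncGame.isPath_projL h5⟩, ?_, ?_⟩, ?_⟩, ?_⟩, rfl⟩, ?_⟩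
  · exact (congrArg (· ∈ _) (e1 t)).mpr hw.2.1
  · refine (congrArg (· ∈ _) (e2 t)).mpr ?_
    exact (congrArg (· ∈ _) (Strategy.projR_map_prodLeft (mixHom ρ Γ Δ) t)).mp h2
  · exact Strategy.projL_map_prodLeft (mixHom ρ Γ Θ) _
  · refine (congrArg (· ∈ _) (Strategy.projR_map_prodLeft (mixHom ρ Γ Θ) _)).mpr ?_
    exact (congrArg (· ∈ _) (e3 t)).mpr hw.2.2
  · simp only [List.map_map]
    refine List.map_congr_left fun m _ => ?_
    rcases m with ⟨⟨⟨x, i, m, hm⟩, y⟩ | ⟨x, ⟨y, i, m, hm⟩⟩, z⟩ | ⟨⟨x, y⟩, ⟨z, i, m, hm⟩⟩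
    all_goals
      refine PiTrans.ext_lab (funext fun j => ?_) rfl
      rcases j with (j | j) | j <;> rfl

end Strat

-- Introduction rules as operations on strategies, and their permutations.

namespace Rule

variable {Γ Γ' Θ Θ' K : Sequent Var} {C C' : Formula Var}

/-- The strategy which starts by introducing the connective of `C`. -/
noncomputable def op (R : Rule Θ C) (σ : Strat.{u} (Γ.append Θ)) : Strat.{u} (Γ.append (one C)) where
  strat ρ := (σ.strat ρ).guard (R.ctxHom ρ Γ) (R.ctxRoot ρ Γ) rfl (R.ctxRoot_tgt ρ Γ)
  nil_mem _ := .inl rfl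

theorem op_mono (R : Rule Θ C) {σ τ : Strat.{u} (Γ.append Θ)} (h : σ ≤ τ) : R.op σ ≤ R.op τ :=
  fun ρ => Strategy.le_trans' (Strategy.guard_mono (hr := rfl) (hr' := R.ctxRoot_tgt ρ Γ) (h ρ))
    (Strategy.guard_deseq_le (R.ctxHom_isTiled ρ Γ) _ _ _)

theorem op_ex (R : Rule Θ C) (σ : Strat.{u} (Γ.append Θ)) (a : Iso Γ Γ') :
    R.op (σ.ex (a.left Θ)) = (R.op σ).ex (a.left (one C)) := by
  refine Strat.ext_strat fun ρ => (Strategy.image_guard (hr := rfl)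
    (hr' := R.ctxRoot_tgt ρ Γ) (hg := exchHom_init ρ _ _) (hf' := exchHom_init ρ _ _)
    (hr'' := rfl) (hr''' := R.ctxRoot_tgt ρ Γ') _ ?_ ?_).symm
  · rintro ⟨x, i | i, m, hm⟩
    · refine PiTrans.ext_lab (funext fun j => ?_) rfl
      rcases j with j | j <;> rfl
    · refine PiTrans.ext_lab (funext fun j => ?_) rfl
      rcases j with j | j <;> rfl
  · refine PiTrans.ext_lab (funext fun j => ?_) rfl
    rcases j with j | j
    · obtain ⟨k, rfl⟩ := a.e.surjective j
      exact (exchPos_apply ρ (a.left (one C)).e (a.left (one C)).h _ (.inl k)).trans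
        (castPos_init ρ _)
    · rfl

/-- Starting with the transition of `R` and then interleaving with `κ` is a particular interleaving,
hence the inclusion for rules of any polarity. -/
theorem op_mix_le (R : Rule Θ C) (σ : Strat.{u} (Γ.append Θ)) (κ : Strat.{u} K) :
    R.op ((σ.mix κ).ex (Iso.swap Γ Θ K)) ≤ ((R.op σ).mix κ).ex (Iso.swap Γ (one C) K) := by
  refine Strat.le_of_subset fun ρ => ?_
  rintro _ (rfl | ⟨_, ⟨_, ⟨t, ht, rfl⟩, rfl⟩, rfl⟩)
  · exact Strat.nil_mem _ ρ
  · refine ⟨_, ⟨_, Strategy.guard_prod_le _ _ _ _ rfl (R.ctxRoot_tgt ρ Γ) (κ.nil_mem ρ)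
      (.inr ⟨t, ht, rfl⟩), rfl⟩, ?_⟩
    simp only [List.map_cons, List.map_map]
    congr 1
    · refine PiTrans.ext_lab (funext fun j => ?_) rfl
      rcases j with (j | j) | j <;> rfl
    · refine List.map_congr_left fun m _ => ?_
      rcases m with ⟨⟨x, i | i, m, hm⟩, y⟩ | ⟨x, ⟨y, i, n, hn⟩⟩
      all_goals
        refine PiTrans.ext_lab (funext fun j => ?_) rfl
        rcases j with (j | j) | j <;> rfl

/-- An introduction rule of a positive connective may be delayed after the plays of a strategy in
parallel. -/
theorem mix_op_le (R : Rule Θ C) (hR : R.pol = .P) (σ : Strat.{u} (Γ.append Θ))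
    (κ : Strat.{u} K) :
    (R.op σ).mix κ ≤ (R.op ((σ.mix κ).ex (Iso.swap Γ Θ K))).ex (Iso.swap Γ K (one C)) := by
  intro ρ
  -- Here the plays of `κ` may precede the transition of `R`; this is where `R` has to be positive.
  have h := Strategy.prod_guard_le (σ.strat ρ) (κ.strat ρ) (R.ctxHom ρ Γ) (R.ctxRoot ρ Γ) rfl
    (R.ctxRoot_tgt ρ Γ) (σ.nil_mem ρ) ((R.root_pol ρ).trans hR)
  refine Strategy.le_trans' (Strategy.image_mono (hf' := mixHom_init ρ _ _) h) (Strategy.le_trans'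
    (Strategy.image_deseq_le (mixHom_isTiled ρ _ _) _ _) (Strategy.deseq_mono
    (Strategy.le_trans' ?_ (Strategy.le_deseq _))))
  rintro _ ⟨_, rfl | ⟨t, ht, rfl⟩, rfl⟩
  · exact Strat.nil_mem _ ρ
  · refine ⟨_, .inr ⟨_, ⟨_, ⟨t, ht, rfl⟩, rfl⟩, rfl⟩, ?_⟩
    simp only [List.map_cons, List.map_map]
    congr 1
    · refine PiTrans.ext_lab (funext fun j => ?_) rfl
      rcases j with (j | j) | j <;> rfl
    · refine List.map_congr_left fun m _ => ?_
      rcases m with ⟨⟨x, i | i, m, hm⟩, y⟩ | ⟨x, ⟨y, i, n, hn⟩⟩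
      all_goals
        refine PiTrans.ext_lab (funext fun j => ?_) rfl
        rcases j with (j | j) | j <;> rfl

/-- A rule may be permuted below another one if the connective introduced by the former is
negative or that introduced by the latter is positive. -/
theorem op_op_le (R : Rule Θ C) (R' : Rule Θ' C') (h : R.pol = .O ∨ R'.pol = .P)
    (σ : Strat.{u} ((Γ.append Θ).append Θ')) :
    R.op ((R'.op σ).ex (Iso.swap Γ Θ (one C'))) ≤
      (R'.op ((R.op (σ.ex (Iso.swap Γ Θ Θ'))).ex (Iso.swap Γ Θ' (one C)))).ex
        (Iso.swap Γ (one C) (one C')) := by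
  intro ρ
  set τ := (R'.op ((R.op (σ.ex (Iso.swap Γ Θ Θ'))).ex (Iso.swap Γ Θ' (one C)))).ex
        (Iso.swap Γ (one C) (one C')) with hτ
  -- The play opening with `R'` and then `R` is in `τ` by definition (`mem`). Both opening
  -- transitions start from initial positions of different components, so they form a tile, and
  -- exchanging them gives the play opening with `R`.
  have key : ∀ t ∈ (σ.strat ρ).plays, R.ctxRoot ρ (Γ.append (one C')) ::
      (((R'.ctxRoot ρ (Γ.append Θ) :: t.map (R'.ctxHom ρ (Γ.append Θ)).trans).map
        (exchHom ρ (Iso.swap Γ Θ (one C')).e (Iso.swap Γ Θ (one C')).h).trans).map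
        (R.ctxHom ρ (Γ.append (one C'))).trans) ∈ (τ.strat ρ).deseq.plays := by
    intro t ht
    have mem : _ ∈ (τ.strat ρ).deseq.plays :=
      Strategy.le_deseq _ ⟨_, .inr ⟨_, ⟨_, .inr ⟨_, ⟨t, ht, rfl⟩, rfl⟩, rfl⟩, rfl⟩, rfl⟩
    simp only [List.map_cons, List.map_map] at mem ⊢
    refine Eq.mp ?_ (Strategy.deseq_courteous (τ.strat ρ) [] _ _ _
      (R.ctxRoot ρ (Γ.append (one C')))
      ((R.ctxHom ρ (Γ.append (one C'))).trans
        ((exchHom ρ (Iso.swap Γ Θ (one C')).e (Iso.swap Γ Θ (one C')).h).trans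
          (R'.ctxRoot ρ (Γ.append Θ)))) ?_ ?_ mem)
    · rw [List.nil_append]
      congr 3
      refine List.map_congr_left fun m _ => ?_
      rcases m with ⟨x, (i | i) | i, m, hm⟩
      all_goals
        refine PiTrans.ext_lab (funext fun j => ?_) rfl
        rcases j with (j | j) | j <;> rfl
    · refine ⟨?_, ?_, ?_, .inr ⟨?_, rfl, rfl⟩⟩
      · funext j
        rcases j with (j | j) | j <;> rfl
      · refine Eq.trans ?_ ((exchHom ρ (Iso.swap Γ (one C) (one C')).e
          (Iso.swap Γ (one C) (one C')).h).tgt_trans (R'.ctxRoot ρ (Γ.append (one C)))).symm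
        refine congrArg (exchHom ρ (Iso.swap Γ (one C) (one C')).e
          (Iso.swap Γ (one C) (one C')).h).pos ?_
        refine Eq.trans ?_ (R'.ctxRoot_tgt ρ _).symm
        funext j
        rcases j with (j | j) | j <;> rfl
      · refine Eq.trans ?_ (R.ctxRoot_tgt ρ _).symm
        funext j
        rcases j with (j | j) | j <;> rfl
      · exact fun h => Sum.inl_ne_inr h
    -- In the tile to be exchanged, the first transition is that of `R'` and the second that of `R`,
    -- which gives the two cases of courtesy.
    · rcases h with h | h
      · exact .inr ((R.root_pol ρ).trans h)
      · exact .inl ((R'.root_pol ρ).trans h)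
  rintro _ (rfl | ⟨_, ⟨_, rfl | ⟨t, ht, rfl⟩, rfl⟩, rfl⟩)
  · exact Strategy.le_deseq _ (τ.nil_mem ρ)
  -- Only `R` has been played: a prefix of the play in which `R'` follows at once.
  · exact (τ.strat ρ).deseq.prefix_closed _ _ (key [] (σ.nil_mem ρ))
  · exact key t ht

end Rule

end MALL

namespace MALL

open Sequent

variable {Var : Type v}

/-! ### Operations on a part of a sequent -/

/-- An operation on strategies which acts on the part `Θ` of a sequent, replacing it by `Ω`. -/
structure Transformer (Θ Ω : Sequent Var) where
  app : ∀ {Γ : Sequent Var}, Strat.{u} (Γ.append Θ) → Strat.{u} (Γ.append Ω)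
  mono : ∀ {Γ : Sequent Var} {σ τ : Strat.{u} (Γ.append Θ)}, σ ≤ τ → app σ ≤ app τ
  natural : ∀ {Γ Γ' : Sequent Var} (σ : Strat.{u} (Γ.append Θ)) (a : Iso Γ Γ'),
    app (σ.ex (a.left Θ)) = (app σ).ex (a.left Ω)

namespace Transformer

variable {Γ Γ' Θ Θ' Ω Ω' Ξ K : Sequent Var} {C : Formula Var}

noncomputable def ofRule (R : Rule Θ C) : Transformer.{u} Θ (one C) where
  app := R.op
  mono := R.op_mono
  natural := R.op_ex

/-- With `κ` the strategy of the other premise, this is the branching part of a tensor rule, seen as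
a unary operation: the whole sequent `K` joins the active part. -/
noncomputable def ofMix (Θ : Sequent Var) (κ : Strat.{u} K) :
    Transformer.{u} Θ (Θ.append K) where
  app {Γ} σ := (σ.mix κ).ex (Iso.assoc Γ Θ K)
  mono h := Strat.ex_mono _ (Strat.mix_mono h le_rfl)
  natural σ a := by
    rw [Strat.mix_ex_left, Strat.ex_ex, Strat.ex_ex]
    refine Strat.ex_congr _ ?_
    rintro ((i | i) | i) <;> rfl

noncomputable def reindex (b : Iso Θ Ω) : Transformer.{u} Θ Ω where
  app {Γ} σ := σ.ex (Iso.right Γ b)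
  mono h := Strat.ex_mono _ h
  natural σ a := by
    rw [Strat.ex_ex, Strat.ex_ex]
    refine Strat.ex_congr _ ?_
    rintro (i | i) <;> rfl

/-- Lets `Φ` act when the active part contains further formulas `Ξ`, such as the context brought by
the other premise of a tensor rule. -/
noncomputable def frame (Ξ : Sequent Var) (Φ : Transformer.{u} Θ Ω) :
    Transformer.{u} (Ξ.append Θ) (Ξ.append Ω) where
  app {Γ} σ := (Φ.app (σ.ex (Iso.assoc Γ Ξ Θ).symm)).ex (Iso.assoc Γ Ξ Ω)
  mono h := Strat.ex_mono _ (Φ.mono (Strat.ex_mono _ h))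
  natural {Γ Γ'} σ a := by
    have h : (σ.ex (a.left (Ξ.append Θ))).ex (Iso.assoc Γ' Ξ Θ).symm =
        (σ.ex (Iso.assoc Γ Ξ Θ).symm).ex ((a.left Ξ).left Θ) := by
      rw [Strat.ex_ex, Strat.ex_ex]
      refine Strat.ex_congr _ ?_
      rintro (i | i | i) <;> rfl
    rw [h, Φ.natural, Strat.ex_ex, Strat.ex_ex]
    refine Strat.ex_congr _ ?_
    rintro ((i | i) | i) <;> rfl

def comp (Ψ : Transformer.{u} Ω Ξ) (Φ : Transformer.{u} Θ Ω) : Transformer.{u} Θ Ξ where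
  app σ := Ψ.app (Φ.app σ)
  mono h := Ψ.mono (Φ.mono h)
  natural σ a := by rw [Φ.natural, Ψ.natural]

/-- `Φ` may be permuted below `Ψ`. -/
def Comm (Φ : Transformer.{u} Θ Ω) (Ψ : Transformer.{u} Θ' Ω') : Prop :=
  ∀ (Γ : Sequent Var) (σ : Strat.{u} ((Γ.append Θ).append Θ')),
    Φ.app ((Ψ.app σ).ex (Iso.swap Γ Θ Ω')) ≤
      (Ψ.app ((Φ.app (σ.ex (Iso.swap Γ Θ Θ'))).ex (Iso.swap Γ Θ' Ω))).ex (Iso.swap Γ Ω Ω')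

theorem swap_swap (σ : Strat.{u} ((Γ.append Θ).append Θ')) :
    (σ.ex (Iso.swap Γ Θ Θ')).ex (Iso.swap Γ Θ' Θ) = σ := by
  rw [Strat.ex_ex]
  refine Strat.ex_eq_self _ ?_
  rintro ((i | i) | i) <;> rfl

/-- `Φ` passes below `Ψ'` and then below `Ψ`; monotonicity of `Ψ'` allows the second permutation to
be made under it. -/
theorem Comm.comp_right {Φ : Transformer.{u} Θ Ω} {Ψ : Transformer.{u} Θ' Ω'}
    {Ψ' : Transformer.{u} Ω' Ξ} (h : Comm Φ Ψ) (h' : Comm Φ Ψ') : Comm Φ (Ψ'.comp Ψ) := by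
  intro Γ σ
  refine (h' _ (Ψ.app σ)).trans (Strat.ex_mono _ (Ψ'.mono ?_))
  refine (Strat.ex_mono _ (h _ σ)).trans (le_of_eq ?_)
  rw [swap_swap]

theorem Comm.comp_left {Φ : Transformer.{u} Θ Ω} {Φ' : Transformer.{u} Ω Ξ}
    {Ψ : Transformer.{u} Θ' Ω'} (h : Comm Φ Ψ) (h' : Comm Φ' Ψ) : Comm (Φ'.comp Φ) Ψ := by
  intro Γ σ
  refine (Φ'.mono (h _ σ)).trans ((h' _ _).trans (le_of_eq ?_))
  rw [swap_swap]
  rfl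

/-- Renumbering a part of the context of `Φ` commutes with `Φ` by naturality, here as an equality.
-/
theorem comm_reindex_right (Φ : Transformer.{u} Θ Ω) (b : Iso Θ' Ω') : Comm Φ (reindex b) := by
  intro Γ σ
  refine le_of_eq ?_
  have h : ((reindex b).app σ).ex (Iso.swap Γ Θ Ω') =
      (σ.ex (Iso.swap Γ Θ Θ')).ex ((Iso.right Γ b).left Θ) := by
    change (σ.ex _).ex _ = _
    rw [Strat.ex_ex, Strat.ex_ex]
    refine Strat.ex_congr _ ?_
    rintro ((i | i) | i) <;> rfl
  rw [h, Φ.natural]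
  change _ = ((Strat.ex _ _).ex _).ex _
  rw [Strat.ex_ex, Strat.ex_ex]
  refine Strat.ex_congr _ ?_
  rintro ((i | i) | i) <;> rfl

theorem comm_reindex_left (b : Iso Θ Ω) (Ψ : Transformer.{u} Θ' Ω') : Comm (reindex b) Ψ := by
  intro Γ σ
  refine le_of_eq ?_
  have h : ((reindex b).app (σ.ex (Iso.swap Γ Θ Θ'))).ex (Iso.swap Γ Θ' Ω) =
      σ.ex ((Iso.right Γ b).left Θ') := by
    change ((σ.ex _).ex _).ex _ = _
    rw [Strat.ex_ex, Strat.ex_ex]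
    refine Strat.ex_congr _ ?_
    rintro ((i | i) | i) <;> rfl
  rw [h, Ψ.natural]
  change (Strat.ex _ _).ex _ = _
  rw [Strat.ex_ex, Strat.ex_ex]
  refine Strat.ex_congr _ ?_
  rintro ((i | i) | i) <;> rfl

/-- Operations act over an arbitrary context, so `Ξ` may be counted as part of the context of both;
the rest is naturality and bookkeeping of renumberings. -/
theorem Comm.frame_right {Φ : Transformer.{u} Θ Ω} {Ψ : Transformer.{u} Θ' Ω'} (h : Comm Φ Ψ)
    (Ξ : Sequent Var) : Comm Φ (frame Ξ Ψ) := by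
  intro Γ σ
  -- `σ` with `Ξ` moved into the context, to which the commutation of `Φ` and `Ψ` applies.
  set σ' : Strat.{u} (((Γ.append Ξ).append Θ).append Θ') :=
    (σ.ex (Iso.assoc (Γ.append Θ) Ξ Θ').symm).ex ((Iso.swap Γ Θ Ξ).left Θ') with hσ'
  have e1 : ((frame Ξ Ψ).app σ).ex (Iso.swap Γ Θ (Ξ.append Ω')) =
      ((Ψ.app σ').ex (Iso.swap (Γ.append Ξ) Θ Ω')).ex ((Iso.assoc Γ Ξ Ω').left Θ) := by
    rw [hσ', Ψ.natural]
    change (Strat.ex _ _).ex _ = _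
    rw [Strat.ex_ex, Strat.ex_ex, Strat.ex_ex]
    refine Strat.ex_congr _ ?_
    rintro (((i | i) | i) | i) <;> rfl
  have e2 : (((Φ.app (σ.ex (Iso.swap Γ Θ (Ξ.append Θ')))).ex
        (Iso.swap Γ (Ξ.append Θ') Ω)).ex (Iso.assoc (Γ.append Ω) Ξ Θ').symm) =
      ((Φ.app (σ'.ex (Iso.swap (Γ.append Ξ) Θ Θ'))).ex (Iso.swap (Γ.append Ξ) Θ' Ω)).ex
        ((Iso.swap Γ Ξ Ω).left Θ') := by
    have e3 : σ'.ex (Iso.swap (Γ.append Ξ) Θ Θ') =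
        (σ.ex (Iso.swap Γ Θ (Ξ.append Θ'))).ex ((Iso.assoc Γ Ξ Θ').symm.left Θ) := by
      rw [hσ', Strat.ex_ex, Strat.ex_ex, Strat.ex_ex]
      refine Strat.ex_congr _ ?_
      rintro ((i | i) | i | i) <;> rfl
    rw [e3, Φ.natural, Strat.ex_ex, Strat.ex_ex, Strat.ex_ex]
    refine Strat.ex_congr _ ?_
    rintro ((i | i | i) | i) <;> rfl
  rw [e1, Φ.natural]
  refine (Strat.ex_mono _ (h _ σ')).trans (le_of_eq ?_)
  change _ = ((Ψ.app _).ex _).ex _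
  rw [e2, Ψ.natural]
  simp only [Strat.ex_ex]
  refine Strat.ex_congr _ ?_
  rintro (((i | i) | i) | i) <;> rfl

theorem Comm.frame_left {Φ : Transformer.{u} Θ Ω} {Ψ : Transformer.{u} Θ' Ω'} (h : Comm Φ Ψ)
    (Ξ : Sequent Var) : Comm (frame Ξ Φ) Ψ := by
  intro Γ σ
  set σ' : Strat.{u} (((Γ.append Ξ).append Θ).append Θ') :=
    σ.ex ((Iso.assoc Γ Ξ Θ).symm.left Θ') with hσ'
  have e0 : σ = σ'.ex ((Iso.assoc Γ Ξ Θ).left Θ') := by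
    rw [hσ', Strat.ex_ex]
    refine (Strat.ex_eq_self _ ?_).symm
    rintro ((i | i | i) | i) <;> rfl
  have e1 : ((Ψ.app σ).ex (Iso.swap Γ (Ξ.append Θ) Ω')).ex (Iso.assoc (Γ.append Ω') Ξ Θ).symm =
      ((Ψ.app σ').ex (Iso.swap (Γ.append Ξ) Θ Ω')).ex ((Iso.swap Γ Ξ Ω').left Θ) := by
    rw [e0, Ψ.natural, Strat.ex_ex, Strat.ex_ex, Strat.ex_ex]
    refine Strat.ex_congr _ ?_
    rintro (((i | i) | i) | i) <;> rfl
  have e2 : (((frame Ξ Φ).app (σ.ex (Iso.swap Γ (Ξ.append Θ) Θ'))).ex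
        (Iso.swap Γ Θ' (Ξ.append Ω))) =
      ((Φ.app (σ'.ex (Iso.swap (Γ.append Ξ) Θ Θ'))).ex (Iso.swap (Γ.append Ξ) Θ' Ω)).ex
        ((Iso.assoc Γ Ξ Ω).left Θ') := by
    have e3 : (σ.ex (Iso.swap Γ (Ξ.append Θ) Θ')).ex (Iso.assoc (Γ.append Θ') Ξ Θ).symm =
        (σ'.ex (Iso.swap (Γ.append Ξ) Θ Θ')).ex ((Iso.swap Γ Ξ Θ').left Θ) := by
      rw [hσ', Strat.ex_ex, Strat.ex_ex, Strat.ex_ex]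
      refine Strat.ex_congr _ ?_
      rintro ((i | i | i) | i) <;> rfl
    change ((Φ.app _).ex _).ex _ = _
    rw [e3, Φ.natural]
    simp only [Strat.ex_ex]
    refine Strat.ex_congr _ ?_
    rintro (((i | i) | i) | i) <;> rfl
  change (Φ.app _).ex _ ≤ _
  rw [e1, Φ.natural, Strat.ex_ex]
  refine (Strat.ex_mono _ (h _ σ')).trans (le_of_eq ?_)
  rw [e2, Ψ.natural]
  simp only [Strat.ex_ex]
  refine Strat.ex_congr _ ?_
  rintro (((i | i) | i) | i) <;> rfl

/-- `op_mix_le` up to renumbering; valid for rules of both polarities. -/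
theorem comm_ofRule_ofMix (R : Rule Θ C) (Θ' : Sequent Var) (κ : Strat.{u} K) :
    Comm (ofRule R) (ofMix Θ' κ) := by
  intro Γ σ
  have e0 := (swap_swap σ).symm
  set σ' := σ.ex (Iso.swap Γ Θ Θ')
  have e1 : ((ofMix Θ' κ).app σ).ex (Iso.swap Γ Θ (Θ'.append K)) =
      ((σ'.mix κ).ex (Iso.swap (Γ.append Θ') Θ K)).ex ((Iso.assoc Γ Θ' K).left Θ) := by
    change ((σ.mix κ).ex _).ex _ = _
    rw [e0, Strat.mix_ex_left, Strat.ex_ex, Strat.ex_ex, Strat.ex_ex]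
    refine Strat.ex_congr _ ?_
    rintro (((i | i) | i) | i) <;> rfl
  rw [e1, (ofRule R).natural]
  refine (Strat.ex_mono _ (R.op_mix_le σ' κ)).trans (le_of_eq ?_)
  change _ = (((((ofRule R).app σ').ex _).mix κ).ex _).ex _
  rw [Strat.mix_ex_left, Strat.ex_ex, Strat.ex_ex, Strat.ex_ex]
  refine Strat.ex_congr _ ?_
  rintro (((i | i) | i) | i) <;> rfl

/-- `mix_op_le` up to renumbering: the rule above which a juxtaposition is moved down must be
positive, so that its transition can be delayed. -/
theorem comm_ofMix_ofRule (R : Rule Θ' C) (hR : R.pol = .P) (Θ : Sequent Var) (κ : Strat.{u} K) :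
    Comm (ofMix Θ κ) (ofRule R) := by
  intro Γ σ
  change ((((ofRule R).app σ).ex _).mix κ).ex _ ≤ _
  rw [Strat.mix_ex_left, Strat.ex_ex]
  refine (Strat.ex_mono _ (R.mix_op_le hR σ κ)).trans (le_of_eq ?_)
  have e : ((ofMix Θ κ).app (σ.ex (Iso.swap Γ Θ Θ'))).ex (Iso.swap Γ Θ' (Θ.append K)) =
      ((σ.mix κ).ex (Iso.swap (Γ.append Θ) Θ' K)).ex ((Iso.assoc Γ Θ K).left Θ') := by
    change (((σ.ex _).mix κ).ex _).ex _ = _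
    rw [Strat.mix_ex_left, Strat.ex_ex, Strat.ex_ex, Strat.ex_ex]
    refine Strat.ex_congr _ ?_
    rintro (((i | i) | i) | i) <;> rfl
  rw [e, (ofRule R).natural, Strat.ex_ex, Strat.ex_ex]
  refine Strat.ex_congr _ ?_
  rintro (((i | i) | i) | i) <;> rfl

/-- Two successive juxtapositions describe the same three-fold interleavings in either order
(`mix_mix_le`). -/
theorem comm_ofMix_ofMix (Θ Θ' : Sequent Var) (κ : Strat.{u} K) (κ' : Strat.{u} Ξ) :
    Comm (ofMix Θ κ) (ofMix Θ' κ') := by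
  intro Γ σ
  change ((((σ.mix κ').ex _).ex _).mix κ).ex _ ≤ ((((((σ.ex _).mix κ).ex _).ex _).mix κ').ex _).ex _
  simp only [Strat.mix_ex_left, Strat.ex_ex]
  refine (Strat.ex_mono _ (Strat.mix_mix_le σ κ' κ)).trans (le_of_eq ?_)
  rw [Strat.ex_ex]
  refine Strat.ex_congr _ ?_
  rintro ((((i | i) | i) | i) | i) <;> rfl

/-- An operation below which all the rules may be permuted. -/
structure Permutable (Ψ : Transformer.{u} Θ' Ω') : Prop where
  rule : ∀ {Θ C} (R : Rule Θ C), Comm (ofRule R) Ψ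
  mix : ∀ (Θ : Sequent Var) {K} (κ : Strat.{u} K), Comm (ofMix Θ κ) Ψ

/-- Positivity is what lets the transition of this rule be delayed after that of any other rule, or
after the plays of any strategy in parallel. -/
theorem permutable_ofRule (R : Rule Θ C) (hR : R.pol = .P) : (ofRule.{u} R).Permutable where
  rule R' _ σ := R'.op_op_le R (.inr hR) σ
  mix Θ _ κ := comm_ofMix_ofRule R hR Θ κ

theorem permutable_ofMix (Θ : Sequent Var) (κ : Strat.{u} K) : (ofMix Θ κ).Permutable where
  rule R := comm_ofRule_ofMix R Θ κ
  mix Θ' _ κ' := comm_ofMix_ofMix Θ' Θ κ' κ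

theorem permutable_reindex (b : Iso Θ Ω) : (reindex.{u} b).Permutable where
  rule _ := comm_reindex_right _ b
  mix _ _ _ := comm_reindex_right _ b

theorem Permutable.comp {Φ : Transformer.{u} Θ Ω} {Ψ : Transformer.{u} Ω Ξ}
    (hΨ : Ψ.Permutable) (hΦ : Φ.Permutable) : (Ψ.comp Φ).Permutable where
  rule R := (hΦ.rule R).comp_right (hΨ.rule R)
  mix Θ _ κ := (hΦ.mix Θ κ).comp_right (hΨ.mix Θ κ)

theorem Permutable.frame {Φ : Transformer.{u} Θ Ω} (hΦ : Φ.Permutable) (Ξ : Sequent Var) :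
    (frame Ξ Φ).Permutable where
  rule R := (hΦ.rule R).frame_right Ξ
  mix Θ _ κ := (hΦ.mix Θ κ).frame_right Ξ

/-! ### The tensor rule -/

variable {Δ : Sequent Var} {A B : Formula Var}

/-- `A, Δ, B` renumbered as `Δ, A, B`. -/
def tensIsoR (A B : Formula Var) (Δ : Sequent Var) :
    Iso ((one A).append (Δ.append (one B))) (Δ.append ((one A).append (one B))) :=
  (Iso.assoc _ _ _).symm.trans (((Iso.comm _ _).left _).trans (Iso.assoc _ _ _))

/-- `B, Γ, A` renumbered as `Γ, A, B`. -/
def tensIsoL (A B : Formula Var) (Γ : Sequent Var) :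
    Iso ((one B).append (Γ.append (one A))) (Γ.append ((one A).append (one B))) :=
  (tensIsoR B A Γ).trans (Iso.right Γ (Iso.comm _ _))

/-- The tensor rule with a given second premise. -/
noncomputable def tensR (A : Formula Var) (τ : Strat.{u} (Δ.append (one B))) :
    Transformer.{u} (one A) (Δ.append (one (.tens A B))) :=
  (frame Δ (ofRule (.tens A B))).comp ((reindex (tensIsoR A B Δ)).comp (ofMix (one A) τ))

/-- The tensor rule with a given first premise. -/
noncomputable def tensL (B : Formula Var) (σ : Strat.{u} (Γ.append (one A))) :
    Transformer.{u} (one B) (Γ.append (one (.tens A B))) :=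
  (frame Γ (ofRule (.tens A B))).comp ((reindex (tensIsoL A B Γ)).comp (ofMix (one B) σ))

theorem permutable_tensR (A : Formula Var) (τ : Strat.{u} (Δ.append (one B))) :
    (tensR A τ).Permutable :=
  ((permutable_ofRule (.tens A B) rfl).frame Δ).comp
    ((permutable_reindex _).comp (permutable_ofMix _ _))

theorem permutable_tensL (B : Formula Var) (σ : Strat.{u} (Γ.append (one A))) :
    (tensL B σ).Permutable :=
  ((permutable_ofRule (.tens A B) rfl).frame Γ).comp
    ((permutable_reindex _).comp (permutable_ofMix _ _))

/-- The tensor rule is a juxtaposition, a renumbering and a framed unary rule, each of which may be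
permuted below `Ψ`. Permutability thus extends from unary rules to tensor rules. -/
theorem Permutable.comm_tensR {Ψ : Transformer.{u} Θ' Ω'} (h : Ψ.Permutable) (A : Formula Var)
    (τ : Strat.{u} (Δ.append (one B))) : Comm (tensR A τ) Ψ :=
  ((h.mix _ _).comp_left (comm_reindex_left _ _)).comp_left ((h.rule _).frame_left Δ)

theorem Permutable.comm_tensL {Ψ : Transformer.{u} Θ' Ω'} (h : Ψ.Permutable) (B : Formula Var)
    (σ : Strat.{u} (Γ.append (one A))) : Comm (tensL B σ) Ψ :=
  ((h.mix _ _).comp_left (comm_reindex_left _ _)).comp_left ((h.rule _).frame_left Γ)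

end Transformer

open Transformer

variable {Γ Δ : Sequent Var} {A B : Formula Var}

/-- The strategy of the tensor rule. -/
noncomputable def Strat.tens (σ : Strat.{u} (Γ.append (one A))) (τ : Strat.{u} (Δ.append (one B))) :
    Strat.{u} ((Γ.append Δ).append (one (.tens A B))) :=
  ((tensR A τ).app σ).ex (Iso.assoc _ _ _).symm

/-- The premise of the tensor rule, as a single sequent. -/
def tensIso (Γ Δ : Sequent Var) (A B : Formula Var) :
    Iso ((Γ.append (one A)).append (Δ.append (one B)))
      ((Γ.append Δ).append ((one A).append (one B))) :=
  (Iso.assoc _ _ _).trans ((Iso.right Γ (tensIsoR A B Δ)).trans (Iso.assoc _ _ _).symm)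

/-- A description symmetric in the two premises, close to the interpretation of the tensor rule on
proofs; it gives monotonicity in both arguments. -/
theorem Strat.tens_eq (σ : Strat.{u} (Γ.append (one A))) (τ : Strat.{u} (Δ.append (one B))) :
    σ.tens τ = (Rule.tens A B).op ((σ.mix τ).ex (tensIso Γ Δ A B)) := by
  change ((((ofRule (.tens A B)).app ((((σ.mix τ).ex _).ex _).ex _)).ex _)).ex _ = _
  rw [Strat.ex_ex, Strat.ex_ex, Strat.ex_ex]
  refine (Strat.ex_eq_self _ ?_).trans ?_
  · rintro ((i | i) | i) <;> rfl
  · rfl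

/-- Juxtaposition is commutative up to renumbering, so the tensor may equally be seen as an
operation on its second premise. Arguments on an operation applied to one premise then apply to
either. -/
theorem Strat.tens_eq_tensL (σ : Strat.{u} (Γ.append (one A)))
    (τ : Strat.{u} (Δ.append (one B))) :
    σ.tens τ = (((tensL B σ).app τ).ex (Iso.assoc _ _ _).symm).ex ((Iso.comm Δ Γ).left _) := by
  have h : (((((τ.mix σ).ex (Iso.assoc Δ (one B) (Γ.append (one A)))).ex
      (Iso.right Δ (tensIsoL A B Γ))).ex (Iso.assoc _ _ _).symm)) =
      ((σ.mix τ).ex (tensIso Γ Δ A B)).ex ((Iso.comm Γ Δ).left _) := by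
    rw [Strat.mix_comm σ τ]
    simp only [Strat.ex_ex]
    refine Strat.ex_congr _ ?_
    rintro ((i | i) | (i | i)) <;> rfl
  rw [Strat.tens_eq]
  change _ = ((((ofRule (.tens A B)).app (Strat.ex _ _)).ex _).ex _).ex _
  erw [h]
  rw [(ofRule (.tens A B)).natural]
  simp only [Strat.ex_ex]
  refine (Strat.ex_eq_self _ ?_).symm
  rintro ((i | i) | i) <;> rfl

theorem Strat.tens_mono {σ σ' : Strat.{u} (Γ.append (one A))}
    {τ τ' : Strat.{u} (Δ.append (one B))} (h : σ ≤ σ') (h' : τ ≤ τ') :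
    σ.tens τ ≤ σ'.tens τ' := by
  rw [Strat.tens_eq, Strat.tens_eq]
  exact Rule.op_mono _ (Strat.ex_mono _ (Strat.mix_mono h h'))

end MALL

namespace MALL

open Sequent Transformer

variable {Var : Type v}

/-! ### Splitting of renumberings -/

namespace Sequent

/-- The sequent without one of its formulas. -/
abbrev erase (Γ : Sequent Var) (j : Γ.ι) : Sequent Var :=
  ⟨{i // i ≠ j}, inferInstance, fun i => Γ.fml i⟩

open Classical in
/-- A formula may be put at the end of a sequent. -/
noncomputable def extract (Γ : Sequent Var) (j : Γ.ι) :
    Iso Γ ((Γ.erase j).append (one (Γ.fml j))) where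
  e :=
    { toFun := fun i => if h : i = j then .inr () else .inl ⟨i, h⟩
      invFun := Sum.elim Subtype.val fun _ => j
      left_inv := by
        intro i
        by_cases h : i = j <;> simp [h]
      right_inv := by
        rintro (⟨i, h⟩ | i)
        · simp [h]
        · simp }
  h := by
    intro i
    by_cases h : i = j
    · subst h; simp
    · simp [h]

namespace Iso

variable {Γ Γ₁ Γ₂ X Y : Sequent Var} {A C D : Formula Var}

/-- A bijection of disjoint sums fixing the last point restricts to the complements of this point.
-/
theorem cancel (c : Iso (X.append (one C)) (Y.append (one D))) (h : c.e (.inr ()) = .inr ()) :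
    C = D ∧ ∃ b : Iso X Y, ∀ i, c.e i = Sum.map b.e id i := by
  refine ⟨(c.h (.inr ())).trans (by rw [h]; rfl), ?_⟩
  have h1 : ∀ x, ∃ y, c.e (.inl x) = .inl y := by
    intro x
    rcases h2 : c.e (.inl x) with y | y
    · exact ⟨y, rfl⟩
    · exact absurd (c.e.injective (h2.trans h.symm)) (by simp)
  choose f hf using h1
  have hf' : f.Bijective := by
    constructor
    · intro x x' hx
      have := c.e.injective ((hf x).trans ((congrArg _ hx).trans (hf x').symm))
      simpa using this
    · intro y
      rcases h2 : c.e.symm (.inl y) with x | x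
      · refine ⟨x, Sum.inl_injective ((hf x).symm.trans ?_)⟩
        rw [← h2, Equiv.apply_symm_apply]
      · rw [Equiv.symm_apply_eq] at h2
        exact absurd (h2.trans h) (by simp)
  refine ⟨⟨Equiv.ofBijective f hf', fun i => ?_⟩, ?_⟩
  · have := c.h (.inl i)
    rw [hf] at this
    exact this
  · rintro (i | i)
    · exact hf i
    · exact h

/-- Putting the formula `A` at the end of `Γ₁` leaves a renumbering that fixes the last formula, to
which `cancel` applies. Used to locate a formula of the conclusion of a binary rule in one of its
premises. -/
theorem split_left (e : Iso (Γ₁.append Γ₂) (Γ.append (one A))) {j : Γ₁.ι}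
    (h : e.e.symm (.inr ()) = .inl j) :
    ∃ (Γ' : Sequent Var) (a : Iso Γ₁ (Γ'.append (one A))) (b : Iso (Γ'.append Γ₂) Γ),
      e = ((a.left Γ₂).trans (swap Γ' (one A) Γ₂)).trans (b.left (one A)) := by
  have h1 : e.e (.inl j) = .inr () := by rw [← h, Equiv.apply_symm_apply]
  have h2 : Γ₁.fml j = A := by
    have := e.h (.inl j)
    rw [h1] at this
    exact this
  subst h2
  set a := Γ₁.extract j
  set c := (a.left Γ₂).trans (swap (Γ₁.erase j) (one (Γ₁.fml j)) Γ₂)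
  obtain ⟨-, b, hb⟩ := (c.symm.trans e).cancel h1
  refine ⟨Γ₁.erase j, a, b, ext' fun i => ?_⟩
  have h3 := hb (c.e i)
  have h4 : (c.symm.trans e).e (c.e i) = e.e i := congrArg e.e (c.e.symm_apply_apply i)
  exact h4.symm.trans h3

theorem split_right (e : Iso (Γ₁.append Γ₂) (Γ.append (one A))) {j : Γ₂.ι}
    (h : e.e.symm (.inr ()) = .inr j) :
    ∃ (Γ' : Sequent Var) (a : Iso Γ₂ (Γ'.append (one A))) (b : Iso (Γ₁.append Γ') Γ),
      e = ((right Γ₁ a).trans (assoc Γ₁ Γ' (one A)).symm).trans (b.left (one A)) := by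
  have h1 : e.e (.inr j) = .inr () := by rw [← h, Equiv.apply_symm_apply]
  have h2 : Γ₂.fml j = A := by
    have := e.h (.inr j)
    rw [h1] at this
    exact this
  subst h2
  set a := Γ₂.extract j
  set c := (right Γ₁ a).trans (assoc Γ₁ (Γ₂.erase j) (one (Γ₂.fml j))).symm
  obtain ⟨-, b, hb⟩ := (c.symm.trans e).cancel h1
  refine ⟨Γ₂.erase j, a, b, ext' fun i => ?_⟩
  have h3 := hb (c.e i)
  have h4 : (c.symm.trans e).e (c.e i) = e.e i := congrArg e.e (c.e.symm_apply_apply i)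
  exact h4.symm.trans h3

end Iso

end Sequent

/-! ### Sizes -/

/-- The number of symbols of a formula. -/
def Formula.size : Formula Var → ℕ
  | .var _ => 1
  | .covar _ => 1
  | .par A B => A.size + B.size + 1
  | .tens A B => A.size + B.size + 1
  | .with A B => A.size + B.size + 1
  | .plus A B => A.size + B.size + 1

namespace Sequent

/-- The number of symbols of a sequent. -/
noncomputable def size (Γ : Sequent Var) : ℕ :=
  haveI := Fintype.ofFinite Γ.ι
  ∑ i, (Γ.fml i).size

theorem size_eq (Γ : Sequent Var) [Fintype Γ.ι] : Γ.size = ∑ i, (Γ.fml i).size := by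
  unfold size
  congr!

theorem Iso.size_eq {Γ Δ : Sequent Var} (a : Iso Γ Δ) : Γ.size = Δ.size := by
  have := Fintype.ofFinite Γ.ι
  have := Fintype.ofFinite Δ.ι
  rw [Sequent.size_eq, Sequent.size_eq]
  exact Fintype.sum_equiv a.e _ _ fun i => by rw [a.h]

@[simp] theorem size_append (Γ Δ : Sequent Var) : (Γ.append Δ).size = Γ.size + Δ.size := by
  have := Fintype.ofFinite Γ.ι
  have := Fintype.ofFinite Δ.ι
  rw [Sequent.size_eq, Sequent.size_eq, Sequent.size_eq]
  exact Fintype.sum_sum_type _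

@[simp] theorem size_one (A : Formula Var) : (one A).size = A.size := by
  rw [Sequent.size_eq]
  exact Fintype.sum_unique _

end Sequent

/-- The measure on which the inductions rest: decomposing a formula of the context makes the context
smaller. -/
theorem Rule.size_lt {Θ : Sequent Var} {C : Formula Var} (R : Rule Θ C) : Θ.size < C.size := by
  cases R <;> simp only [size_append, size_one, Formula.size] <;> omega

/-! ### The semantic focusing calculus -/

/-- The strategy introducing a formula by all its introduction rules. -/
noncomputable def Strat.neg {Γ : Sequent Var} (D : Formula Var)
    (σ : ∀ Θ, Rule Θ D → Strat.{u} (Γ.append Θ)) : Strat.{u} (Γ.append (one D)) where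
  strat ρ :=
    { plays := {s | s = [] ∨ ∃ (Θ : Sequent Var) (R : Rule Θ D), s ∈ ((R.op (σ Θ R)).strat ρ).plays}
      isPlay := by
        rintro _ (rfl | ⟨Θ, R, h⟩)
        · exact ⟨_, rfl⟩
        · exact Strategy.isPlay _ _ h
      prefix_closed := by
        rintro s t (h | ⟨Θ, R, h⟩)
        · exact .inl (List.append_eq_nil_iff.1 h).1
        · exact .inr ⟨Θ, R, Strategy.prefix_closed _ _ _ h⟩ }
  nil_mem _ := .inl rfl

namespace Strat

variable {Γ Γ' : Sequent Var} {D : Formula Var}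

theorem le_neg (σ : ∀ Θ, Rule Θ D → Strat.{u} (Γ.append Θ)) {Θ} (R : Rule Θ D) :
    R.op (σ Θ R) ≤ neg D σ :=
  le_of_subset fun _ _ h => .inr ⟨Θ, R, h⟩

theorem neg_le {σ : ∀ Θ, Rule Θ D → Strat.{u} (Γ.append Θ)} {τ : Strat.{u} (Γ.append (one D))}
    (h : ∀ Θ (R : Rule Θ D), R.op (σ Θ R) ≤ τ) : neg D σ ≤ τ := by
  rintro ρ s (rfl | ⟨Θ, R, hs⟩)
  · exact Strategy.le_deseq _ (τ.nil_mem ρ)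
  · exact h Θ R ρ hs

end Strat

theorem Rule.exists_of_isAsync {D : Formula Var} (h : D.IsAsync) :
    ∃ Θ, Nonempty (Rule Θ D) := by
  match D, h with
  | .par A B, _ => exact ⟨_, ⟨.par A B⟩⟩
  | .with A B, _ => exact ⟨_, ⟨.withL A B⟩⟩

/-- Prefixing by a transition distributes over the union of the rules introducing `D`, so a bound
may be checked rule by rule. -/
theorem Rule.op_neg_le {Γ Γ' Θ : Sequent Var} {C D : Formula Var} (R : Rule Θ C) (hD : D.IsAsync)
    {σ : ∀ Θ, Rule Θ D → Strat.{u} (Γ.append Θ)} {a : Iso (Γ.append (one D)) (Γ'.append Θ)}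
    {τ : Strat.{u} (Γ'.append (one C))}
    (h : ∀ Θ' (R' : Rule Θ' D), R.op ((R'.op (σ Θ' R')).ex a) ≤ τ) :
    R.op ((Strat.neg D σ).ex a) ≤ τ := by
  -- An actual rule for `D` is needed to bound the play consisting of the transition of `R` alone.
  obtain ⟨Θ', ⟨R'⟩⟩ := Rule.exists_of_isAsync hD
  rintro ρ _ (rfl | ⟨_, ⟨_, rfl | ⟨Θ₁, R₁, hs⟩, rfl⟩, rfl⟩)
  · exact Strategy.le_deseq _ (τ.nil_mem ρ)
  · exact h Θ' R' ρ (.inr ⟨_, ⟨_, .inl rfl, rfl⟩, rfl⟩)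
  · exact h Θ₁ R₁ ρ (.inr ⟨_, ⟨_, hs, rfl⟩, rfl⟩)

/-- The copy-cat strategies. -/
def Strat.copycat (A : Formula Var) : Strat.{u} ((nil.cons A).cons A.neg) where
  strat ρ := MALL.copycat ρ A
  nil_mem ρ := by
    refine ⟨⟨_, rfl⟩, fun t ht => ⟨[], [], [], ?_⟩⟩
    obtain rfl := List.prefix_nil.1 ht
    exact ⟨.refl _, .refl _, by simp, by simp⟩

/-- The formulas of an axiom, the second one first. -/
def axIso (A B : Formula Var) : Iso ((nil.cons A).cons B) ((one B).append (one A)) where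
  e :=
    { toFun
        | none => .inl ()
        | some none => .inr ()
      invFun
        | .inl _ => none
        | .inr _ => some none
      left_inv := by rintro (_ | _ | ⟨⟨⟩⟩) <;> rfl
      right_inv := by rintro (_ | _) <;> rfl }
  h := by rintro (_ | _ | ⟨⟨⟩⟩) <;> rfl

mutual

/-- The strategies which contain that of a focusing proof, up to courtesy. -/
inductive NF : ∀ {Γ : Sequent Var}, Strat.{u} Γ → Prop
  | neg {Γ : Sequent Var} {D : Formula Var} (hD : D.IsAsync)
      (σ : ∀ Θ, Rule Θ D → Strat.{u} (Γ.append Θ)) : (∀ Θ R, NF (σ Θ R)) → NF (Strat.neg D σ)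
  | ex {Γ Δ : Sequent Var} {σ : Strat.{u} Γ} (a : Iso Γ Δ) : NF σ → NF (σ.ex a)
  | focus {Γ : Sequent Var} {C : Formula Var} {σ : Strat.{u} (Γ.append (one C))} :
      (∀ i, ¬ (Γ.fml i).IsAsync) → C.IsPositive → FO σ → NF σ
  | le {Γ : Sequent Var} {σ τ : Strat.{u} Γ} : σ ≤ τ → NF σ → NF τ

/-- The strategies which contain that of a proof focused on the last formula, up to courtesy. -/
inductive FO : ∀ {Γ : Sequent Var} {C : Formula Var}, Strat.{u} (Γ.append (one C)) → Prop
  | axVar (X : Var) : FO ((Strat.copycat (.var X)).ex (axIso (.var X) (.covar X)))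
  | axCovar (X : Var) : FO (((Strat.copycat (.covar X)).ex (axIso (.covar X) (.var X))).ex
      (Iso.comm (one (.var X)) (one (.covar X))))
  | tens {Γ Δ : Sequent Var} {A B : Formula Var} {σ : Strat.{u} (Γ.append (one A))}
      {τ : Strat.{u} (Δ.append (one B))} : FO σ → FO τ → FO (σ.tens τ)
  | plusL {Γ : Sequent Var} {A : Formula Var} (B : Formula Var)
      {σ : Strat.{u} (Γ.append (one A))} : FO σ → FO ((Rule.plusL A B).op σ)
  | plusR {Γ : Sequent Var} (A : Formula Var) {B : Formula Var}
      {σ : Strat.{u} (Γ.append (one B))} : FO σ → FO ((Rule.plusR A B).op σ)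
  | ex {Γ Δ : Sequent Var} {C : Formula Var} {σ : Strat.{u} (Γ.append (one C))} (a : Iso Γ Δ) :
      FO σ → FO (σ.ex (a.left (one C)))
  | release {Γ : Sequent Var} {C : Formula Var} {σ : Strat.{u} (Γ.append (one C))} :
      C.IsNegative → NF σ → FO σ
  | le {Γ : Sequent Var} {C : Formula Var} {σ τ : Strat.{u} (Γ.append (one C))} :
      σ ≤ τ → FO σ → FO τ

end

theorem Formula.not_isAsync_of_isPositive {A : Formula Var} (h : A.IsPositive) : ¬ A.IsAsync := by
  cases A <;> simp_all [Formula.IsPositive, Formula.IsAsync]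

/-- Negative connectives may be introduced last. -/
theorem NF.invert {X : Sequent Var} {σ : Strat.{u} X} (hσ : NF σ) :
    ∀ {Γ : Sequent Var} {D : Formula Var} (e : Iso X (Γ.append (one D))), D.IsAsync →
      ∃ σ' : ∀ Θ, Rule Θ D → Strat.{u} (Γ.append Θ), (∀ Θ R, NF (σ' Θ R)) ∧
        Strat.neg D σ' ≤ σ.ex e := by
  refine NF.rec (motive_1 := fun {X} (σ : Strat.{u} X) _ => ∀ {Γ : Sequent Var} {D : Formula Var}
    (e : Iso X (Γ.append (one D))), D.IsAsync → ∃ σ' : ∀ Θ, Rule Θ D → Strat.{u} (Γ.append Θ),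
    (∀ Θ R, NF (σ' Θ R)) ∧ Strat.neg D σ' ≤ σ.ex e) (motive_2 := fun _ _ => True)
    ?_ ?_ ?_ ?_ ?_ ?_ ?_ ?_ ?_ ?_ ?_ ?_ hσ
  · intro Γ₀ D₀ hD₀ σ₀ hσ₀ ih Γ D e hD
    rcases h : e.e.symm (.inr ()) with j | j
    · obtain ⟨Γ', a, b, rfl⟩ := e.split_left h
      -- `D` is another formula than the one introduced last: it is inverted in every premise, and
      -- the rules for `D₀` are put back above those for `D`.
      have ih' := fun Θ₀ R₀ => ih Θ₀ R₀ ((a.left Θ₀).trans (Iso.swap Γ' (one D) Θ₀)) hD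
      choose σ₁ h1 h2 using ih'
      refine ⟨fun Θ R => ((Strat.neg D₀ fun Θ₀ R₀ => (σ₁ Θ₀ R₀ Θ R).ex (Iso.swap Γ' Θ₀ Θ)).ex
        (Iso.swap Γ' Θ (one D₀))).ex (b.left Θ), fun Θ R => ?_, Strat.neg_le fun Θ R => ?_⟩
      · exact .ex _ (.ex _ (.neg hD₀ _ fun Θ₀ R₀ => .ex _ (h1 _ _ _ _)))
      · rw [Rule.op_ex, ← Strat.ex_ex]
        refine Strat.ex_mono _ (R.op_neg_le hD₀ fun Θ₀ R₀ => ?_)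
        -- `R` introduces a negative connective, so it may be permuted below `R₀` whatever the
        -- latter.
        refine (R.op_op_le R₀ (.inl (R.pol_of_isAsync hD)) _).trans ?_
        rw [swap_swap, ← Strat.ex_ex]
        refine Strat.ex_mono _ ?_
        have h3 := Strat.ex_mono (Iso.swap Γ' Θ₀ (one D)) ((Strat.le_neg (σ₁ Θ₀ R₀) R).trans (h2 Θ₀ R₀))
        refine (R₀.op_mono h3).trans ?_
        rw [← Strat.ex_ex, swap_swap, Rule.op_ex]
        exact Strat.ex_mono _ (Strat.le_neg σ₀ R₀)
    · have h' : e.e (.inr ()) = .inr () := by rw [Equiv.symm_apply_eq] at h; exact h.symm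
      obtain ⟨rfl, a, ha⟩ := e.cancel h'
      obtain rfl : e = a.left (one D₀) := Iso.ext' ha
      refine ⟨fun Θ R => (σ₀ Θ R).ex (a.left Θ), fun Θ R => .ex _ (hσ₀ Θ R),
        Strat.neg_le fun Θ R => ?_⟩
      rw [Rule.op_ex]
      exact Strat.ex_mono _ (Strat.le_neg σ₀ R)
  · intro Γ Δ σ a _ ih Γ' D e hD
    rw [Strat.ex_ex]
    exact ih _ hD
  -- No formula can be decomposed when a positive phase starts, so `D` cannot occur there.
  · intro Γ₀ C σ h hC _ _ Γ D e hD
    have h1 := e.h (e.e.symm (.inr ()))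
    rw [Equiv.apply_symm_apply] at h1
    generalize e.e.symm (.inr ()) = k at h1
    rcases k with j | j
    · exact (h j ((congrArg Formula.IsAsync h1).mpr hD)).elim
    · exact (Formula.not_isAsync_of_isPositive hC ((congrArg Formula.IsAsync h1).mpr hD)).elim
  · intro Γ σ τ h _ ih Γ' D e hD
    obtain ⟨σ', h1, h2⟩ := ih e hD
    exact ⟨σ', h1, h2.trans (Strat.ex_mono _ h)⟩
  all_goals intros; trivial

/-- In a sequent without negative connectives, one focuses on a formula or on another one. -/
theorem NF.choose_focus {X : Sequent Var} {σ : Strat.{u} X} (hσ : NF σ) :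
    ∀ {Γ : Sequent Var} {A : Formula Var} (e : Iso X (Γ.append (one A))),
      (∀ i, ¬ (Γ.fml i).IsAsync) → A.IsPositive → FO (σ.ex e) ∨
        ∃ (Γ' : Sequent Var) (C : Formula Var) (a : Iso Γ (Γ'.append (one C))), C.IsPositive ∧
          FO (((σ.ex e).ex (a.left (one A))).ex (Iso.swap Γ' (one C) (one A))) := by
  refine NF.rec (motive_1 := fun {X} (σ : Strat.{u} X) _ => ∀ {Γ : Sequent Var} {A : Formula Var}
    (e : Iso X (Γ.append (one A))), (∀ i, ¬ (Γ.fml i).IsAsync) → A.IsPositive → FO (σ.ex e) ∨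
    ∃ (Γ' : Sequent Var) (C : Formula Var) (a : Iso Γ (Γ'.append (one C))), C.IsPositive ∧
    FO (((σ.ex e).ex (a.left (one A))).ex (Iso.swap Γ' (one C) (one A))))
    (motive_2 := fun _ _ => True) ?_ ?_ ?_ ?_ ?_ ?_ ?_ ?_ ?_ ?_ ?_ ?_ hσ
  · intro Γ₀ D₀ hD₀ σ₀ hσ₀ ih Γ A e hΓ hA
    have h1 := e.h (.inr ())
    generalize e.e (.inr ()) = k at h1
    rcases k with j | j
    · exact (hΓ j ((congrArg Formula.IsAsync h1).mp hD₀)).elim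
    · exact (Formula.not_isAsync_of_isPositive hA ((congrArg Formula.IsAsync h1).mp hD₀)).elim
  · intro Γ Δ σ a _ ih Γ' D e
    rw [Strat.ex_ex]
    exact ih _
  · intro Γ₀ C σ h hC hσ _ Γ A e hΓ hA
    rcases h : e.e.symm (.inr ()) with j | j
    · obtain ⟨Γ', a, b, rfl⟩ := e.split_left h
      -- `A` lies in the context of the focus `C`, so `C` is the other formula chosen.
      refine .inr ⟨Γ', C, b.symm, hC, ?_⟩
      have h1 : ((σ.ex (((a.left (one C)).trans (Iso.swap Γ' (one A) (one C))).trans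
          (b.left (one A)))).ex (b.symm.left (one A))).ex (Iso.swap Γ' (one C) (one A)) =
          σ.ex (a.left (one C)) := by
        rw [Strat.ex_ex, Strat.ex_ex]
        refine Strat.ex_congr _ fun i => ?_
        change (Iso.swap Γ' (one C) (one A)).e ((b.symm.left (one A)).e ((b.left (one A)).e
          ((Iso.swap Γ' (one A) (one C)).e ((a.left (one C)).e i)))) = _
        have h2 : ∀ k, (b.symm.left (one A)).e ((b.left (one A)).e k) = k := by
          rintro (k | k)
          · exact congrArg Sum.inl (b.e.symm_apply_apply k)
          · rfl
        rw [h2]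
        rcases (a.left (one C)).e i with (k | k) | k <;> rfl
      rw [h1]
      exact .ex _ hσ
    · have h' : e.e (.inr ()) = .inr () := by rw [Equiv.symm_apply_eq] at h; exact h.symm
      obtain ⟨rfl, a, ha⟩ := e.cancel h'
      obtain rfl : e = a.left (one C) := Iso.ext' ha
      exact .inl (.ex _ hσ)
  · intro Γ σ τ h _ ih Γ' D e hΓ hA
    rcases ih e hΓ hA with h1 | ⟨Γ'', C, a, hC, h1⟩
    · exact .inl (.le (Strat.ex_mono _ h) h1)
    · exact .inr ⟨Γ'', C, a, hC, .le (Strat.ex_mono _ (Strat.ex_mono _ (Strat.ex_mono _ h))) h1⟩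
  all_goals intros; trivial

end MALL

-- Positive rules preserve focused normal forms.

namespace MALL

open Sequent Transformer

variable {Var : Type v}

namespace Transformer

variable {Γ Γ' Θ Θ' Ω Ω' Ξ : Sequent Var}

/-- The operation, not on the last formulas of a sequent but on the last but `Ξ`. -/
noncomputable def under (Φ : Transformer.{u} Θ Ω) (σ : Strat.{u} ((Γ.append Θ).append Ξ)) :
    Strat.{u} ((Γ.append Ω).append Ξ) :=
  (Φ.app (σ.ex (Iso.swap Γ Θ Ξ))).ex (Iso.swap Γ Ξ Ω)

theorem under_mono (Φ : Transformer.{u} Θ Ω) {σ τ : Strat.{u} ((Γ.append Θ).append Ξ)}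
    (h : σ ≤ τ) : Φ.under σ ≤ Φ.under τ :=
  Strat.ex_mono _ (Φ.mono (Strat.ex_mono _ h))

/-- The commutation in the form used below, with both operations acting on places fixed in advance.
-/
theorem Comm.app_under_le {Φ : Transformer.{u} Θ Ω} {Ψ : Transformer.{u} Θ' Ω'} (h : Comm Φ Ψ)
    (σ : Strat.{u} ((Γ.append Θ').append Θ)) : Φ.app (Ψ.under σ) ≤ Ψ.under (Φ.app σ) := by
  have := h Γ (σ.ex (Iso.swap Γ Θ' Θ))
  rwa [swap_swap] at this

/-- Singles out a part `Ξ` of the context on which another rule is going to act. -/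
theorem under_swap (Φ : Transformer.{u} Θ Ω) (σ : Strat.{u} (Γ.append Θ))
    (a : Iso Γ (Γ'.append Ξ)) :
    Φ.under ((σ.ex (a.left Θ)).ex (Iso.swap Γ' Ξ Θ)) =
      ((Φ.app σ).ex (a.left Ω)).ex (Iso.swap Γ' Ξ Ω) := by
  unfold under
  rw [swap_swap, Φ.natural]

end Transformer

namespace NF

variable {Γ Δ Ω : Sequent Var} {A B C : Formula Var}

theorem of_ex {σ : Strat.{u} Γ} (a : Iso Γ Δ) (h : NF (σ.ex a)) : NF σ := by
  have h1 : (σ.ex a).ex a.symm = σ := by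
    rw [Strat.ex_ex]
    exact Strat.ex_eq_self _ fun i => a.e.symm_apply_apply i
  rw [← h1]
  exact h.ex _

/-- The negative formula of the context is inverted in the premise, and its rules are permuted below
`T`. Above them, `T` acts over a smaller context, where the induction hypothesis applies. -/
theorem app_of_isAsync {T : Transformer.{u} (one A) Ω} (hT : T.Permutable) {i : Γ.ι}
    (hi : (Γ.fml i).IsAsync)
    (ih : ∀ {Γ' : Sequent Var} {σ : Strat.{u} (Γ'.append (one A))}, Γ'.size < Γ.size → NF σ →
      NF (T.app σ)) {σ : Strat.{u} (Γ.append (one A))} (hσ : NF σ) : NF (T.app σ) := by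
  set a := Γ.extract i
  obtain ⟨σ', h1, h2⟩ := hσ.invert ((a.left (one A)).trans (Iso.swap _ _ _)) hi
  rw [← Strat.ex_ex] at h2
  refine of_ex (a.left Ω) (of_ex (Iso.swap _ _ _) ?_)
  rw [← under_swap]
  refine .le ((Strat.neg_le fun Θ R => ?_).trans (T.under_mono h2))
    (.neg hi (fun Θ R => T.under (σ' Θ R)) fun Θ R => ?_)
  · exact ((hT.rule R).app_under_le _).trans (T.under_mono (Strat.le_neg σ' R))
  -- The context now has the immediate subformulas `Θ` in place of the formula decomposed.
  · refine .ex _ (ih ?_ (.ex _ (h1 Θ R)))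
    rw [a.size_eq, size_append, size_append, size_one]
    exact Nat.add_lt_add_left R.size_lt _

end NF

/-- `T` is pushed up through a positive phase focused on a formula `C` other than `A`: each rule of
the phase is permuted below `T`. At the end of the phase, `ih` applies to `T` over a context of size
less than `n`. The initial focus may have total size exactly `n`; it must then be positive, so that
the phase cannot end before `C` has been decomposed. -/
theorem FO.under {Ω : Sequent Var} {A : Formula Var} (hA : A.IsPositive)
    {T : Transformer.{u} (one A) Ω} (hT : T.Permutable) (n : ℕ)
    (ih : ∀ {Γ' : Sequent Var} {σ : Strat.{u} (Γ'.append (one A))}, Γ'.size < n → NF σ →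
      NF (T.app σ)) {X : Sequent Var} {C : Formula Var} {σ : Strat.{u} (X.append (one C))}
    (hσ : FO σ) : ∀ {Γ : Sequent Var} (e : Iso X (Γ.append (one A))), Γ.size + C.size ≤ n →
      (Γ.size + C.size < n ∨ C.IsPositive) → FO (T.under (σ.ex (e.left (one C)))) := by
  refine FO.rec (motive_1 := fun _ _ => True) (motive_2 := fun {X C} (σ : Strat.{u} _) _ =>
    ∀ {Γ : Sequent Var} (e : Iso X (Γ.append (one A))), Γ.size + C.size ≤ n →
      (Γ.size + C.size < n ∨ C.IsPositive) → FO (T.under (σ.ex (e.left (one C)))))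
    ?_ ?_ ?_ ?_ ?_ ?_ ?_ ?_ ?_ ?_ ?_ ?_ hσ
  case refine_1 | refine_2 | refine_3 | refine_4 => intros; trivial
  -- In a focused axiom, the only formula besides the focus is the dual of a variable, which is
  -- negative, whereas `A` is positive.
  · intro X Γ e
    have : Formula.covar X = A := (e.h (e.e.symm (.inr ()))).trans
      (congrArg (Γ.append (one A)).fml (e.e.apply_symm_apply (.inr ())))
    subst this
    exact hA.elim
  · intro X Γ e
    have : Formula.covar X = A := (e.h (e.e.symm (.inr ()))).trans
      (congrArg (Γ.append (one A)).fml (e.e.apply_symm_apply (.inr ())))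
    subst this
    exact hA.elim
  · intro Γ₁ Γ₂ A₁ B₁ σ τ hσ hτ ihσ ihτ Γ e hn hn'
    simp only [Formula.size] at hn
    rcases h : e.e.symm (.inr ()) with j | j
    · obtain ⟨Γ', a, b, rfl⟩ := e.split_left h
      have h1 := b.size_eq
      rw [size_append] at h1
      have h2 := ihσ a (by omega) (.inl (by omega))
      refine .le ?_ (FO.ex ((Iso.swap Γ' Ω Γ₂).trans (b.left Ω)) (.tens h2 hτ))
      -- `A` belongs to the first premise: `T` goes up into it, and the other premise is the
      -- parameter `τ` of the tensor operation permuted below `T`.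
      have h3 := (hT.comm_tensR A₁ τ).app_under_le (σ.ex (a.left (one A₁)))
      refine (Strat.ex_mono _ (Strat.ex_mono _ h3)).trans (le_of_eq ?_)
      unfold Transformer.under Strat.tens
      rw [(tensR A₁ τ).natural]
      generalize (tensR A₁ τ).app σ = κ
      have h4 : ((κ.ex (Iso.assoc Γ₁ Γ₂ (one (.tens A₁ B₁))).symm).ex
          ((((a.left Γ₂).trans (Iso.swap Γ' (one A) Γ₂)).trans (b.left (one A))).left
            (one (.tens A₁ B₁)))).ex (Iso.swap Γ (one A) (one (.tens A₁ B₁))) =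
          ((κ.ex (a.left _)).ex (Iso.swap Γ' (one A) _)).ex
            (((Iso.assoc Γ' Γ₂ (one (.tens A₁ B₁))).symm.trans (b.left _)).left (one A)) := by
        simp only [Strat.ex_ex]
        refine Strat.ex_congr _ ?_
        rintro (i | i | i)
        · change (Iso.swap _ _ _).e (Sum.map (Sum.map b.e id ∘ (Iso.swap Γ' (one A) Γ₂).e) id
            (Sum.inl (Sum.inl (a.e i)))) = (Iso.left _ _).e ((Iso.swap _ _ _).e (Sum.inl (a.e i)))
          rcases a.e i with k | k <;> rfl
        · rfl
        · rfl
      rw [h4, T.natural]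
      simp only [Strat.ex_ex]
      refine Strat.ex_congr _ ?_
      rintro ((i | i | i) | i) <;> rfl
    · obtain ⟨Γ', a, b, rfl⟩ := e.split_right h
      have h1 := b.size_eq
      rw [size_append] at h1
      have h2 := ihτ a (by omega) (.inl (by omega))
      refine .le ?_ (FO.ex ((Iso.assoc Γ₁ Γ' Ω).symm.trans (b.left Ω)) (.tens hσ h2))
      rw [Strat.tens_eq_tensL, Strat.tens_eq_tensL]
      -- The symmetric case, with the first premise as a parameter.
      have h3 := (hT.comm_tensL B₁ σ).app_under_le (τ.ex (a.left (one B₁)))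
      refine (Strat.ex_mono _ (Strat.ex_mono _ (Strat.ex_mono _ h3))).trans (le_of_eq ?_)
      unfold Transformer.under
      rw [(tensL B₁ σ).natural]
      generalize (tensL B₁ σ).app τ = κ
      have h4 : (((κ.ex (Iso.assoc Γ₂ Γ₁ (one (.tens A₁ B₁))).symm).ex ((Iso.comm Γ₂ Γ₁).left _)).ex
          ((((Iso.right Γ₁ a).trans (Iso.assoc Γ₁ Γ' (one A)).symm).trans (b.left (one A))).left
            (one (.tens A₁ B₁)))).ex (Iso.swap Γ (one A) (one (.tens A₁ B₁))) =
          ((κ.ex (a.left _)).ex (Iso.swap Γ' (one A) _)).ex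
            (((Iso.assoc Γ' Γ₁ (one (.tens A₁ B₁))).symm.trans
              (((Iso.comm Γ' Γ₁).trans b).left _)).left (one A)) := by
        simp only [Strat.ex_ex]
        refine Strat.ex_congr _ ?_
        rintro (i | i | i)
        · change (Iso.swap _ _ _).e (Sum.map (Sum.map b.e id ∘ (Iso.assoc Γ₁ Γ' (one A)).symm.e) id
            (Sum.inl (Sum.inr (a.e i)))) = (Iso.left _ _).e ((Iso.swap _ _ _).e (Sum.inl (a.e i)))
          rcases a.e i with k | k <;> rfl
        · rfl
        · rfl
      rw [h4, T.natural]
      simp only [Strat.ex_ex]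
      refine Strat.ex_congr _ ?_
      rintro ((i | i | i) | i) <;> rfl
  · intro Γ₁ A₁ B₁ σ hσ ihσ Γ e hn hn'
    simp only [Formula.size] at hn
    refine .le ?_ (.plusL B₁ (ihσ e (by omega) (.inl (by omega))))
    rw [← Rule.op_ex]
    exact (hT.rule _).app_under_le _
  · intro Γ₁ A₁ B₁ σ hσ ihσ Γ e hn hn'
    simp only [Formula.size] at hn
    refine .le ?_ (.plusR A₁ (ihσ e (by omega) (.inl (by omega))))
    rw [← Rule.op_ex]
    exact (hT.rule _).app_under_le _
  · intro X Y C σ a hσ ihσ Γ e hn hn'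
    have h1 : (σ.ex (a.left (one C))).ex (e.left (one C)) = σ.ex ((a.trans e).left (one C)) := by
      rw [Strat.ex_ex]
      refine Strat.ex_congr _ ?_
      rintro (i | i) <;> rfl
    rw [h1]
    exact ihσ _ hn hn'
  -- The phase ends: `C` joins the context of `T`, and as `C` is negative the size condition is
  -- strict.
  · intro X C σ hC hσ _ Γ e hn hn'
    refine .release hC (.ex _ (ih ?_ (.ex _ (.ex _ hσ))))
    rw [size_append, size_one]
    exact hn'.resolve_right hC
  · intro X C σ τ h _ ihσ Γ e hn hn'
    exact .le (T.under_mono (Strat.ex_mono _ h)) (ihσ e hn hn')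

namespace NF

variable {Γ Δ Ω : Sequent Var} {A B C : Formula Var}

/-- Without formulas to decompose in the context, the premise is focused. Either the focus is on `A`
(or `A` is negative and a focus on it is released at once), and `T` can prolong it. Or it is on
another formula `C`, and `FO.under` turns it into a positive phase on `C` below `T`, which is
legitimate because `Ω` contains nothing to decompose. -/
theorem focus_or_app (hΓ : ∀ i, ¬ (Γ.fml i).IsAsync) (hΩ : ∀ i, ¬ (Ω.fml i).IsAsync)
    {T : Transformer.{u} (one A) Ω} (hT : T.Permutable)
    (ih : ∀ {Γ' : Sequent Var} {σ : Strat.{u} (Γ'.append (one A))}, Γ'.size < Γ.size → NF σ →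
      NF (T.app σ)) {σ : Strat.{u} (Γ.append (one A))} (hσ : NF σ) : FO σ ∨ NF (T.app σ) := by
  by_cases hA : A.IsPositive
  swap
  · exact .inl (.release hA hσ)
  rcases hσ.choose_focus (Iso.refl _) hΓ hA with h | ⟨Γ', C, a, hC, h⟩ <;>
    rw [Strat.ex_refl] at h
  · exact .inl h
  refine .inr (of_ex (a.left Ω) (of_ex (Iso.swap _ _ _) ?_))
  rw [← under_swap]
  have h1 := a.size_eq
  rw [size_append, size_one] at h1
  have h2 := FO.under hA hT Γ.size ih h (Iso.refl _) h1.symm.le (.inr hC)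
  rw [Strat.ex_eq_self (a := (Iso.refl (Γ'.append (one A))).left (one C))
    _ (by rintro (i | i) <;> rfl)] at h2
  refine .focus ?_ hC h2
  rintro (i | i)
  · have h3 := a.h (a.e.symm (.inl i))
    rw [Equiv.apply_symm_apply] at h3
    exact fun h4 => hΓ _ ((congrArg Formula.IsAsync h3).mpr h4)
  · exact hΩ i

/-- Induction on the total size of the two contexts, treating the rule as an operation on one
premise and then on the other. If neither reduction succeeds, both premises are focused on the
active formulas and the tensor rule starts a positive phase. -/
theorem tens {σ : Strat.{u} (Γ.append (one A))} {τ : Strat.{u} (Δ.append (one B))} (hσ : NF σ)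
    (hτ : NF τ) : NF (σ.tens τ) := by
  induction hn : Γ.size + Δ.size using Nat.strong_induction_on generalizing Γ Δ with
  | _ n ih =>
    subst hn
    have ihR : ∀ {Γ' : Sequent Var} {σ : Strat.{u} (Γ'.append (one A))}, Γ'.size < Γ.size → NF σ →
        NF ((tensR A τ).app σ) := fun hlt h =>
      of_ex (Iso.assoc _ _ _).symm (ih _ (Nat.add_lt_add_right hlt _) h hτ rfl)
    have ihL : ∀ {Δ' : Sequent Var} {τ : Strat.{u} (Δ'.append (one B))}, Δ'.size < Δ.size → NF τ →
        NF ((tensL B σ).app τ) := fun {Δ' τ} hlt h => by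
      have := ih _ (Nat.add_lt_add_left hlt _) hσ h rfl
      rw [Strat.tens_eq_tensL] at this
      exact of_ex (Iso.assoc _ _ _).symm (of_ex _ this)
    by_cases hΓ : ∃ i, (Γ.fml i).IsAsync
    · obtain ⟨i, hi⟩ := hΓ
      exact .ex _ (app_of_isAsync (permutable_tensR A τ) hi ihR hσ)
    by_cases hΔ : ∃ i, (Δ.fml i).IsAsync
    · obtain ⟨i, hi⟩ := hΔ
      rw [Strat.tens_eq_tensL]
      exact .ex _ (.ex _ (app_of_isAsync (permutable_tensL B σ) hi ihL hτ))
    push Not at hΓ hΔ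
    rcases focus_or_app hΓ (by rintro (i | i); exacts [hΔ i, id]) (permutable_tensR A τ) ihR hσ
      with h1 | h1
    · rcases focus_or_app hΔ (by rintro (i | i); exacts [hΓ i, id]) (permutable_tensL B σ) ihL hτ
        with h2 | h2
      · exact .focus (by rintro (i | i); exacts [hΓ i, hΔ i]) trivial (.tens h1 h2)
      · rw [Strat.tens_eq_tensL]
        exact .ex _ (.ex _ h2)
    · exact .ex _ h1

/-- The unary counterpart of the argument for the tensor, by induction on the size of the context.
-/
theorem op {R : Rule (one A) C} (hR : R.pol = .P) (hC : C.IsPositive)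
    (hF : ∀ {Γ : Sequent Var} {σ : Strat.{u} (Γ.append (one A))}, FO σ → FO (R.op σ))
    {σ : Strat.{u} (Γ.append (one A))} (hσ : NF σ) : NF (R.op σ) := by
  induction hn : Γ.size using Nat.strong_induction_on generalizing Γ with
  | _ n ih =>
    subst hn
    have ih' : ∀ {Γ' : Sequent Var} {σ : Strat.{u} (Γ'.append (one A))}, Γ'.size < Γ.size → NF σ →
        NF ((ofRule R).app σ) := fun hlt h => ih _ hlt h rfl
    by_cases hΓ : ∃ i, (Γ.fml i).IsAsync
    · obtain ⟨i, hi⟩ := hΓ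
      exact app_of_isAsync (permutable_ofRule R hR) hi ih' hσ
    push Not at hΓ
    rcases focus_or_app hΓ (fun _ => Formula.not_isAsync_of_isPositive hC) (permutable_ofRule R hR)
      ih' hσ with h | h
    · exact .focus hΓ hC (hF h)
    · exact h

end NF

end MALL

namespace MALL

open AsyncGame (Hom PiTrans)
open Sequent Transformer

variable {Var : Type v}

/-! ### The strategies of proofs -/

/-- The last formula of a sequent. -/
def consIso (Γ : Sequent Var) (A : Formula Var) : Iso (Γ.cons A) (Γ.append (one A)) where
  e :=
    { toFun
        | none => .inr ()
        | some i => .inl i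
      invFun
        | .inl i => some i
        | .inr _ => none
      left_inv := by rintro (_ | _) <;> rfl
      right_inv := by rintro (_ | _) <;> rfl }
  h := by rintro (_ | _) <;> rfl

/-- The last two formulas of a sequent. -/
def consIso₂ (Γ : Sequent Var) (A B : Formula Var) :
    Iso ((Γ.cons A).cons B) (Γ.append ((one A).append (one B))) where
  e :=
    { toFun
        | none => .inr (.inr ())
        | some none => .inr (.inl ())
        | some (some i) => .inl i
      invFun
        | .inl i => some (some i)
        | .inr (.inl _) => some none
        | .inr (.inr _) => none
      left_inv := by rintro (_ | _ | _) <;> rfl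
      right_inv := by rintro (_ | _ | _) <;> rfl }
  h := by rintro (_ | _ | _) <;> rfl

theorem Strat.ex_symm_ex {Γ Δ : Sequent Var} (σ : Strat.{u} Δ) (a : Iso Γ Δ) :
    (σ.ex a.symm).ex a = σ := by
  rw [Strat.ex_ex]
  exact Strat.ex_eq_self _ fun i => a.e.apply_symm_apply i

namespace Proof

/-- The strategies interpreting a proof. -/
noncomputable def strat {Γ : Sequent Var} (π : Proof Γ) : Strat.{u} Γ where
  strat ρ := π.interp ρ
  nil_mem ρ := by
    induction π with
    | ax A => exact (Strat.copycat A).nil_mem ρ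
    | exch e h π ih => exact ⟨[], ih, rfl⟩
    | par | tens | plusL | plusR => exact .inl rfl
    | _ => exact .inl (.inl rfl)

variable {Γ Δ : Sequent Var} {A B : Formula Var}

/-- Passes from the interpretation of proofs, where the last formula is added by `cons`, to the
operations on rules, where it is a separate part of the sequent. -/
theorem image_guard_cons {ρ : Var → AsyncGame.{u}} {Θ : Sequent Var} {C : Formula Var}
    {G : AsyncGame.{u}} (R : Rule Θ C) (σ : Strategy G) {f : Hom G ((Γ.cons C).game ρ)}
    {r : ((Γ.cons C).game ρ).Trans} (hr) (hr') {f' : Hom G ((Γ.append Θ).game ρ)} (hf')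
    (e : ∀ m, (exchHom ρ (consIso Γ C).e (consIso Γ C).h).trans (f.trans m) =
      (R.ctxHom ρ Γ).trans (f'.trans m))
    (er : (exchHom ρ (consIso Γ C).e (consIso Γ C).h).trans r = R.ctxRoot ρ Γ) :
    (σ.guard f r hr hr').image (exchHom ρ (consIso Γ C).e (consIso Γ C).h)
      (exchHom_init ρ (consIso Γ C).e (consIso Γ C).h) =
    (σ.image f' hf').guard (R.ctxHom ρ Γ) (R.ctxRoot ρ Γ) rfl (R.ctxRoot_tgt ρ Γ) :=
  Strategy.image_guard σ e er

theorem strat_par (π : Proof ((Γ.cons A).cons B)) :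
    (Proof.par π).strat.{u}.ex (consIso Γ (.par A B)) =
      (Rule.par A B).op (π.strat.ex (consIso₂ Γ A B)) := by
  refine Strat.ext_strat fun ρ => ?_
  refine image_guard_cons _ _ rfl (rootTrans_tgt ρ rfl fun _ => rfl)
    (exchHom_init ρ (consIso₂ Γ A B).e (consIso₂ Γ A B).h) ?_ ?_
  · rintro ⟨x, _ | _ | i, m, hm⟩ <;>
    · refine PiTrans.ext_lab (funext fun j => ?_) rfl
      rcases j with j | j <;> rfl
  · refine PiTrans.ext_lab (funext fun j => ?_) rfl
    rcases j with j | j <;> rfl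

theorem strat_tens (π₁ : Proof (Γ.cons A)) (π₂ : Proof (Δ.cons B)) :
    (Proof.tens π₁ π₂).strat.{u}.ex (consIso (Γ.append Δ) (.tens A B)) =
      (π₁.strat.ex (consIso Γ A)).tens (π₂.strat.ex (consIso Δ B)) := by
  rw [Strat.tens_eq, Strat.mix_ex_left, Strat.mix_ex_right, Strat.ex_ex, Strat.ex_ex]
  refine Strat.ext_strat fun ρ => ?_
  set a := (Iso.right (Γ.cons A) (consIso Δ B)).trans (((consIso Γ A).left _).trans
    (tensIso Γ Δ A B))
  have ha : ((exchHom ρ a.e a.h).comp (mixHom ρ (Γ.cons A) (Δ.cons B))).pos (AsyncGame.init _) =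
    AsyncGame.init _ := (congrArg (exchHom ρ a.e a.h).pos (mixHom_init ρ _ _)).trans
      (exchHom_init ρ a.e a.h)
  have h : (((π₁.strat.mix π₂.strat).ex a).strat ρ) =
      ((π₁.interp ρ).prod (π₂.interp ρ)).image _ ha :=
    Strategy.image_image (hf := mixHom_init ρ _ _) (hg := exchHom_init ρ a.e a.h) _ fun _ => rfl
  dsimp only [Rule.op]
  rw [h]
  refine image_guard_cons _ _ rfl (rootTrans_tgt ρ rfl (by rintro (_ | _) <;> rfl)) ha ?_ ?_
  · rintro (⟨⟨x, _ | i, m, hm⟩, y⟩ | ⟨x, ⟨y, _ | i, m, hm⟩⟩) <;>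
    · refine PiTrans.ext_lab (funext fun j => ?_) rfl
      rcases j with (j | j) | j <;> rfl
  · refine PiTrans.ext_lab (funext fun j => ?_) rfl
    rcases j with (j | j) | j <;> rfl

theorem image_guard_consHom {ρ : Var → AsyncGame.{u}} {C : Formula Var} (R : Rule (one A) C)
    (σ : Strategy ((Γ.cons A).game ρ)) {f : Hom (A.game ρ) (C.game ρ)} {r : (C.game ρ).Trans}
    (hr) (hr') (hf : R.hom ρ = oneHom ρ f) (h : r = R.root ρ) :
    (σ.guard (consHom ρ Γ f) (rootTrans ρ Γ C r hr) rfl hr').image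
      (exchHom ρ (consIso Γ C).e (consIso Γ C).h)
      (exchHom_init ρ (consIso Γ C).e (consIso Γ C).h) =
    (σ.image (exchHom ρ (consIso Γ A).e (consIso Γ A).h)
      (exchHom_init ρ (consIso Γ A).e (consIso Γ A).h)).guard (R.ctxHom ρ Γ) (R.ctxRoot ρ Γ) rfl
      (R.ctxRoot_tgt ρ Γ) := by
  subst h
  have h1 : ∀ x, (R.hom ρ).pos x = f.pos (x ()) := fun x => by rw [hf]; rfl
  have h2 : ∀ t, (R.hom ρ).trans t = f.trans t.move := fun x => by rw [hf]; rfl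
  refine image_guard_cons _ _ _ _ _ ?_ ?_
  · rintro ⟨x, _ | i, m, hm⟩
    · refine PiTrans.ext_lab (funext fun j => ?_) (Sigma.ext rfl (heq_of_eq
        (h2 ⟨fun _ => x none, (), m, hm⟩).symm))
      rcases j with j | j
      exacts [rfl, (h1 fun _ => x none).symm]
    · refine PiTrans.ext_lab (funext fun j => ?_) rfl
      rcases j with j | j
      exacts [rfl, (h1 fun _ => x none).symm]
  · refine PiTrans.ext_lab (funext fun j => ?_) rfl
    rcases j with j | j <;> rfl

theorem strat_plusL (π : Proof (Γ.cons A)) :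
    (Proof.plusL (B := B) π).strat.{u}.ex (consIso Γ (.plus A B)) =
      (Rule.plusL A B).op (π.strat.ex (consIso Γ A)) :=
  Strat.ext_strat fun ρ => image_guard_consHom (.plusL A B) (π.interp ρ) rfl
    (rootTrans_tgt ρ rfl fun _ => rfl) rfl rfl

theorem strat_plusR (π : Proof (Γ.cons B)) :
    (Proof.plusR (A := A) π).strat.{u}.ex (consIso Γ (.plus A B)) =
      (Rule.plusR A B).op (π.strat.ex (consIso Γ B)) :=
  Strat.ext_strat fun ρ => image_guard_consHom (.plusR A B) (π.interp ρ) rfl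
    (rootTrans_tgt ρ rfl fun _ => rfl) rfl rfl

/-- The two premises of an `&` rule are treated as two unary rules, whose strategies are united. -/
theorem plays_strat_with (π₁ : Proof (Γ.cons A)) (π₂ : Proof (Γ.cons B))
    (ρ : Var → AsyncGame.{u}) :
    (((Proof.with π₁ π₂).strat.ex (consIso Γ (.with A B))).strat ρ).plays =
      (((Rule.withL A B).op (π₁.strat.ex (consIso Γ A))).strat ρ).plays ∪
      (((Rule.withR A B).op (π₂.strat.ex (consIso Γ B))).strat ρ).plays := by
  have h1 := image_guard_consHom (.withL A B) (π₁.interp ρ) rfl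
    (rootTrans_tgt ρ rfl fun _ => rfl) rfl rfl
  have h2 := image_guard_consHom (.withR A B) (π₂.interp ρ) rfl
    (rootTrans_tgt ρ rfl fun _ => rfl) rfl rfl
  dsimp only [Rule.op, Strat.ex, strat]
  rw [← h1, ← h2]
  ext s
  constructor
  · rintro ⟨t, ht | ht, rfl⟩
    · exact .inl ⟨t, ht, rfl⟩
    · exact .inr ⟨t, ht, rfl⟩
  · rintro (⟨t, ht, rfl⟩ | ⟨t, ht, rfl⟩)
    · exact ⟨t, .inl ht, rfl⟩
    · exact ⟨t, .inr ht, rfl⟩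

theorem strat_exch (a : Iso Γ Δ) (π : Proof Γ) :
    (Proof.exch a.e a.h π).strat.{u} = π.strat.ex a := rfl

/-- The exchanges surrounding a rule of the focusing proof cancel those of the semantic calculus. -/
theorem strat_exch_symm_ex_le (a : Iso Γ Δ) {π : Proof Δ} {σ : Strat.{u} Δ} (h : π.strat ≤ σ) :
    (Proof.exch a.symm.e a.symm.h π).strat.ex a ≤ σ := by
  rwa [strat_exch, Strat.ex_symm_ex]

end Proof

/-- A focused strategy contains that of a focusing proof, up to courtesy. -/
theorem NF.exists_proof {Γ : Sequent Var} {σ : Strat.{u} Γ} (hσ : NF σ) :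
    ∃ π : Proof Γ, π.IsFocusing ∧ π.strat ≤ σ := by
  refine NF.rec (motive_1 := fun {Γ} σ _ => ∃ π : Proof Γ, π.IsFocusing ∧ π.strat ≤ σ)
    (motive_2 := fun {Γ C} σ _ => ∃ π : Proof (Γ.append (one C)), π.IsFocusedOn (.inr ()) ∧
      π.strat ≤ σ) ?_ ?_ ?_ ?_ ?_ ?_ ?_ ?_ ?_ ?_ ?_ ?_ hσ
  · intro Γ D hD σ _ ih
    match D, hD with
    | .par A B, _ =>
      obtain ⟨π, h, h'⟩ := ih _ (.par A B)
      -- Exchange rules are inserted on both sides of each rule; they preserve focusing.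
      refine ⟨.exch _ (consIso _ _).h (.par (.exch _ (consIso₂ _ _ _).symm.h π)),
        .exch _ _ (.par (.exch _ _ h)), ?_⟩
      rw [Proof.strat_exch, Proof.strat_par]
      refine ((Rule.op_mono _ ?_).trans (Strat.le_neg σ (.par A B)))
      exact Proof.strat_exch_symm_ex_le _ h'
    | .with A B, _ =>
      obtain ⟨π₁, h1, h1'⟩ := ih _ (.withL A B)
      obtain ⟨π₂, h2, h2'⟩ := ih _ (.withR A B)
      refine ⟨.exch _ (consIso _ _).h (.with (.exch _ (consIso _ _).symm.h π₁)
        (.exch _ (consIso _ _).symm.h π₂)), .exch _ _ (.with (.exch _ _ h1) (.exch _ _ h2)), ?_⟩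
      intro ρ s hs
      rcases (Proof.plays_strat_with _ _ ρ).subset hs with hs | hs
      · refine ((Rule.op_mono _ ?_).trans (Strat.le_neg σ (.withL A B))) ρ hs
        exact Proof.strat_exch_symm_ex_le _ h1'
      · refine ((Rule.op_mono _ ?_).trans (Strat.le_neg σ (.withR A B))) ρ hs
        exact Proof.strat_exch_symm_ex_le _ h2'
  · rintro Γ Δ σ a _ ⟨π, h, h'⟩
    exact ⟨.exch a.e a.h π, .exch _ _ h, Strat.ex_mono _ h'⟩
  · rintro Γ C σ hΓ hC _ ⟨π, h, h'⟩
    refine ⟨π, .focus (.inr ()) ?_ hC h, h'⟩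
    rintro (i | i)
    exacts [hΓ i, Formula.not_isAsync_of_isPositive hC]
  · rintro Γ σ τ h1 _ ⟨π, h, h'⟩
    exact ⟨π, h, h'.trans h1⟩
  · exact fun X => ⟨.exch _ (axIso _ _).h (.ax (.var X)), .exch _ _ (.axVar X), le_rfl⟩
  · exact fun X => ⟨.exch _ (Iso.comm _ _).h (.exch _ (axIso _ _).h (.ax (.covar X))),
      .exch _ _ (.exch _ _ (.axCovar X)), le_rfl⟩
  · rintro Γ Δ A B σ τ _ _ ⟨π₁, h1, h1'⟩ ⟨π₂, h2, h2'⟩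
    refine ⟨.exch _ (consIso _ _).h (.tens (.exch _ (consIso _ _).symm.h π₁)
      (.exch _ (consIso _ _).symm.h π₂)), .exch _ _ (.tens (.exch _ _ h1) (.exch _ _ h2)), ?_⟩
    rw [Proof.strat_exch, Proof.strat_tens]
    refine Strat.tens_mono ?_ ?_
    · exact Proof.strat_exch_symm_ex_le _ h1'
    · exact Proof.strat_exch_symm_ex_le _ h2'
  · rintro Γ A B σ _ ⟨π, h, h'⟩
    refine ⟨.exch _ (consIso _ _).h (.plusL (.exch _ (consIso _ _).symm.h π)),
      .exch _ _ (.plusL (.exch _ _ h)), ?_⟩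
    rw [Proof.strat_exch, Proof.strat_plusL]
    exact Rule.op_mono _ (Proof.strat_exch_symm_ex_le _ h')
  · rintro Γ A B σ _ ⟨π, h, h'⟩
    refine ⟨.exch _ (consIso _ _).h (.plusR (.exch _ (consIso _ _).symm.h π)),
      .exch _ _ (.plusR (.exch _ _ h)), ?_⟩
    rw [Proof.strat_exch, Proof.strat_plusR]
    exact Rule.op_mono _ (Proof.strat_exch_symm_ex_le _ h')
  · rintro Γ Δ C σ a _ ⟨π, h, h'⟩
    exact ⟨.exch _ (a.left (one C)).h π, .exch _ _ h, Strat.ex_mono _ h'⟩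
  · rintro Γ C σ hC _ ⟨π, h, h'⟩
    exact ⟨π, .release _ hC h, h'⟩
  · rintro Γ C σ τ h1 _ ⟨π, h, h2⟩
    exact ⟨π, h, h2.trans h1⟩

/-- The strategies of the premises of an `&` rule. -/
def Strat.withCases {Γ : Sequent Var} {A B : Formula Var} (σ : Strat.{u} (Γ.append (one A)))
    (τ : Strat.{u} (Γ.append (one B))) : ∀ Θ, Rule Θ (.with A B) → Strat.{u} (Γ.append Θ)
  | _, .withL _ _ => σ
  | _, .withR _ _ => τ

/-- The strategies of the premise of a `⅋` rule. -/
def Strat.parCases {Γ : Sequent Var} {A B : Formula Var}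
    (σ : Strat.{u} (Γ.append ((one A).append (one B)))) :
    ∀ Θ, Rule Θ (.par A B) → Strat.{u} (Γ.append Θ)
  | _, .par _ _ => σ

namespace NF

variable {Γ : Sequent Var} {A B : Formula Var}

theorem par {σ : Strat.{u} (Γ.append ((one A).append (one B)))} (h : NF σ) :
    NF ((Rule.par A B).op σ) :=
  .le (Strat.neg_le fun _ R => by cases R; exact le_rfl)
    (.neg (D := .par A B) trivial (Strat.parCases σ) fun _ R => by cases R; exact h)

theorem of_op_le {σ : Strat.{u} (Γ.append (one A))} {τ : Strat.{u} (Γ.append (one B))}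
    {υ : Strat.{u} (Γ.append (one (.with A B)))} (h : NF σ) (h' : NF τ)
    (hσ : (Rule.withL A B).op σ ≤ υ) (hτ : (Rule.withR A B).op τ ≤ υ) : NF υ :=
  .le (Strat.neg_le fun _ R => by cases R <;> assumption)
    (.neg (D := .with A B) trivial (Strat.withCases σ τ) fun _ R => by cases R <;> assumption)

theorem plusL (B : Formula Var) {σ : Strat.{u} (Γ.append (one A))} (h : NF σ) :
    NF ((Rule.plusL A B).op σ) :=
  NF.op (C := .plus A B) rfl trivial (.plusL B) h

theorem plusR (A : Formula Var) {σ : Strat.{u} (Γ.append (one B))} (h : NF σ) :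
    NF ((Rule.plusR A B).op σ) :=
  NF.op (C := .plus A B) rfl trivial (.plusR A) h

end NF

/-- Every rule preserves `NF`, positive ones by the permutation argument and negative ones by
definition. Only axioms on arbitrary formulas remain, isolated as the hypothesis `h`. -/
theorem Proof.strat_nf {Γ : Sequent Var} (h : ∀ A : Formula Var, NF (Strat.copycat.{u} A))
    (π : Proof Γ) : NF π.strat.{u} := by
  induction π with
  | ax A => exact h A
  | par π ih =>
    refine .of_ex (consIso _ _) ?_
    rw [Proof.strat_par]
    exact .par (ih.ex _)
  | tens π₁ π₂ ih₁ ih₂ =>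
    refine .of_ex (consIso _ _) ?_
    rw [Proof.strat_tens]
    exact (ih₁.ex _).tens (ih₂.ex _)
  | plusL π ih =>
    refine .of_ex (consIso _ _) ?_
    rw [Proof.strat_plusL]
    exact .plusL _ (ih.ex _)
  | plusR π ih =>
    refine .of_ex (consIso _ _) ?_
    rw [Proof.strat_plusR]
    exact .plusR _ (ih.ex _)
  | exch e h π ih => exact ih.ex ⟨e, h⟩
  -- The remaining case is the `&` rule.
  | _ π₁ π₂ ih₁ ih₂ =>
    refine .of_ex (consIso _ _) (.of_op_le (ih₁.ex (consIso _ _)) (ih₂.ex (consIso _ _))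
      (Strat.le_of_subset fun ρ s hs => ?_) (Strat.le_of_subset fun ρ s hs => ?_))
    · exact (Proof.plays_strat_with π₁ π₂ ρ).superset (.inl hs)
    · exact (Proof.plays_strat_with π₁ π₂ ρ).superset (.inr hs)

end MALL

namespace MALL

open AsyncGame (Hom PiTrans)

/-! ### Homotopy -/

namespace AsyncGraph.Homotopic

variable {G H : AsyncGraph.{u}}

theorem refl (s : List G.Trans) : G.Homotopic s s := Relation.EqvGen.refl s

theorem trans {s t r : List G.Trans} (h : G.Homotopic s t) (h' : G.Homotopic t r) :
    G.Homotopic s r := Relation.EqvGen.trans _ _ _ h h'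

theorem symm {s t : List G.Trans} (h : G.Homotopic s t) : G.Homotopic t s :=
  Relation.EqvGen.symm _ _ h

theorem of_tile {m p n q : G.Trans} (h : G.tile m p n q) (b : List G.Trans) :
    G.Homotopic (m :: p :: b) (n :: q :: b) :=
  .rel _ _ ⟨[], b, m, p, n, q, h, rfl, rfl⟩

theorem append_left {s t : List G.Trans} (r : List G.Trans) (h : G.Homotopic s t) :
    G.Homotopic (r ++ s) (r ++ t) := by
  induction h with
  | rel s t h =>
    obtain ⟨a, b, m, p, n, q, ht, rfl, rfl⟩ := h
    exact .rel _ _ ⟨r ++ a, b, m, p, n, q, ht, by simp, by simp⟩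
  | refl s => exact refl _
  | symm s t _ ih => exact ih.symm
  | trans s t r _ _ ih ih' => exact ih.trans ih'

theorem append_right {s t : List G.Trans} (r : List G.Trans) (h : G.Homotopic s t) :
    G.Homotopic (s ++ r) (t ++ r) := by
  induction h with
  | rel s t h =>
    obtain ⟨a, b, m, p, n, q, ht, rfl, rfl⟩ := h
    exact .rel _ _ ⟨a, b ++ r, m, p, n, q, ht, by simp, by simp⟩
  | refl s => exact refl _
  | symm s t _ ih => exact ih.symm
  | trans s t r _ _ ih ih' => exact ih.trans ih'

theorem cons (m : G.Trans) {s t : List G.Trans} (h : G.Homotopic s t) :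
    G.Homotopic (m :: s) (m :: t) :=
  h.append_left [m]

theorem map {f : G.Trans → H.Trans}
    (hf : ∀ {m p n q}, G.tile m p n q → H.tile (f m) (f p) (f n) (f q)) {s t : List G.Trans}
    (h : G.Homotopic s t) : H.Homotopic (s.map f) (t.map f) := by
  induction h with
  | rel s t h =>
    obtain ⟨a, b, m, p, n, q, ht, rfl, rfl⟩ := h
    exact .rel _ _ ⟨a.map f, b.map f, _, _, _, _, hf ht, by simp, by simp⟩
  | refl s => exact refl _
  | symm s t _ ih => exact ih.symm
  | trans s t r _ _ ih ih' => exact ih.trans ih'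

theorem isPath_iff {s t : List G.Trans} (h : G.Homotopic s t) {x y : G.Pos} :
    G.IsPath x s y ↔ G.IsPath x t y := by
  induction h with
  | rel s t h =>
    obtain ⟨a, b, m, p, n, q, ht, rfl, rfl⟩ := h
    exact ⟨IsPath.exchange ht, IsPath.exchange (G.tile_symm ht)⟩
  | refl s => exact Iff.rfl
  | symm s t _ ih => exact ih.symm
  | trans s t r _ _ ih ih' => exact ih.trans ih'

end AsyncGraph.Homotopic

open AsyncGraph

namespace AsyncGame

variable {G H G' H' : AsyncGame.{u}}

/-- Injectivity on positions suffices: only the sources and targets of successive transitions have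
to match. -/
theorem Hom.isPath_of_map {f : Hom G H} (hf : f.pos.Injective) {x : G.Pos} {z : H.Pos}
    {s : List G.Trans} (h : H.IsPath (f.pos x) (s.map f.trans) z) : ∃ y, G.IsPath x s y := by
  induction s generalizing x with
  | nil => exact ⟨x, rfl⟩
  | cons m s ih =>
    obtain ⟨h1, h2⟩ := h
    rw [f.tgt_trans] at h2
    rw [f.src_trans] at h1
    obtain ⟨y, hy⟩ := ih h2
    exact ⟨y, hf h1, hy⟩

theorem homotopic_inLeft_append (n : H.Trans) {x x' : G.Pos} {s : List G.Trans}
    (h : G.IsPath x s x') : (G.prod H).Homotopic (.inr (x, n) :: inLeft (H.tgt n) s)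
      (inLeft (H.src n) s ++ [.inr (x', n)]) := by
  induction s generalizing x with
  | nil =>
    obtain rfl : x = x' := h
    exact .refl _
  | cons m s ih =>
    refine (Homotopic.of_tile (G := (G.prod H).toAsyncGraph)
      (ProdTile.rightLeft h.1 rfl rfl rfl) _).trans ?_
    exact (ih h.2).cons _

/-- A normal form for paths of a product: all the transitions of the first component are moved
before those of the second, one tile at a time. -/
theorem homotopic_inLeft_inRight {x x' : G.Pos} {y y' : H.Pos}
    {s : List (G.Trans × H.Pos ⊕ G.Pos × H.Trans)} (h : (G.prod H).IsPath (x, y) s (x', y')) :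
    (G.prod H).Homotopic s (inLeft y (projL s) ++ inRight x' (projR s)) := by
  induction s generalizing x y with
  | nil => exact .refl _
  | cons m s ih =>
    obtain ⟨h1, h2⟩ := h
    rcases m with ⟨m, z⟩ | ⟨z, n⟩
    · obtain rfl : z = y := congrArg Prod.snd h1
      rw [projL_inl, projR_inl]
      exact (ih h2).cons _
    · obtain rfl : z = x := congrArg Prod.fst h1
      obtain rfl : H.src n = y := congrArg Prod.snd h1
      rw [projL_inr, projR_inr]
      refine ((ih h2).cons _).trans ?_
      have := (homotopic_inLeft_append n (isPath_projL h2)).append_right (inRight x' (projR s))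
      rw [List.append_assoc] at this
      exact this

/-- Paths of a product with homotopic projections are homotopic. -/
theorem homotopic_of_proj {x : G.Pos} {y : H.Pos} {z z' : G.Pos × H.Pos}
    {s t : List (G.Trans × H.Pos ⊕ G.Pos × H.Trans)}
    (hs : (G.prod H).IsPath (x, y) s z) (ht : (G.prod H).IsPath (x, y) t z')
    (hL : G.Homotopic (projL s) (projL t)) (hR : H.Homotopic (projR s) (projR t)) :
    (G.prod H).Homotopic s t := by
  obtain ⟨x', y'⟩ := z
  obtain ⟨x'', y''⟩ := z'
  obtain rfl : x' = x'' := (hL.isPath_iff.1 (isPath_projL hs)).unique (isPath_projL ht)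
  refine (homotopic_inLeft_inRight hs).trans (.trans ?_ (homotopic_inLeft_inRight ht).symm)
  refine .trans (.append_right _ (hL.map (H := (G.prod H).toAsyncGraph) fun h => ?_))
    (.append_left _ (hR.map (H := (G.prod H).toAsyncGraph) fun h => ?_))
  · exact ProdTile.left y h
  · exact ProdTile.right _ h

/-! ### Copy-cat situations -/

/-- The path `y` is, up to homotopy, the copy by `f` of `x`, except for final moves of Opponent
in both. -/
def Copies (f : Hom G H) (x : List G.Trans) (y : List H.Trans) : Prop :=
  ∃ w u v : List G.Trans, G.Homotopic x (w ++ u) ∧ H.Homotopic y ((w ++ v).map f.trans) ∧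
    (∀ m ∈ u, G.pol m = .O) ∧ ∀ m ∈ v, G.pol m = .P

theorem copies_nil (f : Hom G H) : Copies f [] [] :=
  ⟨[], [], [], .refl _, .refl _, by simp, by simp⟩

theorem copies_left (f : Hom G H) {m : G.Trans} (h : G.pol m = .O) : Copies f [m] [] :=
  ⟨[], [m], [], .refl _, .refl _, by simpa using h, by simp⟩

theorem copies_right (f : Hom G H) {m : G.Trans} (h : G.pol m = .P) : Copies f [] [f.trans m] :=
  ⟨[], [], [m], .refl _, .refl _, by simp, by simpa using h⟩

/-- An initial transition `r` and its copy are added to the common part `w`, so no condition on the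
polarity of `r` is needed. -/
theorem Copies.map {f : Hom G H} {x : List G.Trans} {y : List H.Trans} (h : Copies f x y)
    {F : Hom G' H'} {g : Hom G G'} {k : Hom H H'} (hg : g.IsTiled) (hk : k.IsTiled)
    (e : ∀ m, F.trans (g.trans m) = k.trans (f.trans m)) (r : G'.Trans) :
    Copies F (r :: x.map g.trans) (F.trans r :: y.map k.trans) := by
  obtain ⟨w, u, v, h1, h2, h3, h4⟩ := h
  refine ⟨r :: w.map g.trans, u.map g.trans, v.map g.trans, ?_, ?_, ?_, ?_⟩
  · have := (h1.map hg.tile).cons r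
    rwa [List.map_append] at this
  · have := (h2.map hk.tile).cons (F.trans r)
    simpa [e, Function.comp_def] using this
  · simpa [hg.pol] using h3
  · simpa [hg.pol] using h4

/-- The product of two morphisms. -/
def Hom.prodMap (f : Hom G H) (g : Hom G' H') : Hom (G.prod G') (H.prod H') where
  pos := Prod.map f.pos g.pos
  trans := Sum.map (Prod.map f.trans g.pos) (Prod.map f.pos g.trans)
  src_trans := by rintro (⟨m, y⟩ | ⟨x, n⟩) <;> simp [f.src_trans, g.src_trans]
  tgt_trans := by rintro (⟨m, y⟩ | ⟨x, n⟩) <;> simp [f.tgt_trans, g.tgt_trans]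

theorem projL_map_prodMap (f : Hom G H) (g : Hom G' H')
    (s : List (G.Trans × G'.Pos ⊕ G.Pos × G'.Trans)) :
    projL (s.map (f.prodMap g).trans) = (projL s).map f.trans := by
  induction s with
  | nil => rfl
  | cons m s ih =>
    rcases m with m | m
    · exact congrArg (f.trans m.1 :: ·) ih
    · exact ih

theorem projR_map_prodMap (f : Hom G H) (g : Hom G' H')
    (s : List (G.Trans × G'.Pos ⊕ G.Pos × G'.Trans)) :
    projR (s.map (f.prodMap g).trans) = (projR s).map g.trans := by
  induction s with
  | nil => rfl
  | cons m s ih =>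
    rcases m with m | m
    · exact ih
    · exact congrArg (g.trans m.2 :: ·) ih

/-- Concatenating the three parts of the two copy-cat situations, first component first, gives paths
with the right projections up to homotopy; `homotopic_of_proj` concludes. -/
theorem Copies.prod {f : Hom G H} {g : Hom G' H'} (hf : f.pos.Injective) (hg : g.pos.Injective)
    (hf' : f.pos G.init = H.init) (hg' : g.pos G'.init = H'.init)
    {x : List (G.prod G').Trans} {y : List (H.prod H').Trans}
    (hx : (G.prod G').IsPlay x) (hy : (H.prod H').IsPlay y)
    (hL : Copies f (projL x) (projL y)) (hR : Copies g (projR x) (projR y)) :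
    Copies (f.prodMap g) x y := by
  obtain ⟨w₁, u₁, v₁, hx₁, hy₁, hu₁, hv₁⟩ := hL
  obtain ⟨w₂, u₂, v₂, hx₂, hy₂, hu₂, hv₂⟩ := hR
  obtain ⟨⟨x₁, x₂⟩, hx⟩ := hx
  obtain ⟨⟨y₁, y₂⟩, hy⟩ := hy
  obtain ⟨z₁, hw₁, hp₁⟩ := G.isPath_append.1 (hx₁.isPath_iff.1 (isPath_projL hx))
  obtain ⟨z₂, hw₂, hp₂⟩ := G'.isPath_append.1 (hx₂.isPath_iff.1 (isPath_projR hx))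
  -- The hypothesis on `y` only says that the image of `w₁ · v₁` is a path; injectivity on positions
  -- brings it back to `G`.
  obtain ⟨q₁, hq₁⟩ : ∃ q, G.IsPath G.init (w₁ ++ v₁) q := by
    have := hy₁.isPath_iff.1 (isPath_projL hy)
    rw [← hf'] at this
    exact Hom.isPath_of_map hf this
  obtain ⟨q₂, hq₂⟩ : ∃ q, G'.IsPath G'.init (w₂ ++ v₂) q := by
    have := hy₂.isPath_iff.1 (isPath_projR hy)
    rw [← hg'] at this
    exact Hom.isPath_of_map hg this
  obtain ⟨z, hz, hq₁⟩ := G.isPath_append.1 hq₁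
  obtain rfl := hz.unique hw₁
  obtain ⟨z', hz', hq₂⟩ := G'.isPath_append.1 hq₂
  obtain rfl := hz'.unique hw₂
  have hw : (G.prod G').IsPath (G.init, G'.init) (inLeft G'.init w₁ ++ inRight z w₂) (z, z') :=
    (isPath_inLeft _ hw₁).append (isPath_inRight _ hw₂)
  -- The fixed coordinates are the endpoints reached so far in the other component: `w₁` ends at
  -- `z`, `w₂` at `z'`, `w₁ · u₁` at `x₁` and `w₁ · v₁` at `q₁`.
  refine ⟨inLeft G'.init w₁ ++ inRight z w₂, inLeft z' u₁ ++ inRight x₁ u₂,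
    inLeft z' v₁ ++ inRight q₁ v₂, ?_, ?_, ?_, ?_⟩
  · refine homotopic_of_proj hx (hw.append ((isPath_inLeft _ hp₁).append (isPath_inRight _ hp₂)))
      ?_ ?_
    · simpa using hx₁
    · simpa using hx₂
  · have h1 := (f.prodMap g).isPath
      (hw.append ((isPath_inLeft _ hq₁).append (isPath_inRight q₁ hq₂)))
    have h2 : (f.prodMap g).pos (G.init, G'.init) = (H.init, H'.init) :=
      Prod.ext hf' hg'
    rw [h2] at h1
    refine homotopic_of_proj hy h1 ?_ ?_
    · rw [projL_map_prodMap]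
      simpa using hy₁
    · rw [projR_map_prodMap]
      simpa using hy₂
  · intro m hm
    rcases List.mem_append.1 hm with hm | hm
    · obtain ⟨k, hk, rfl⟩ := List.mem_map.1 hm
      exact hu₁ k hk
    · obtain ⟨k, hk, rfl⟩ := List.mem_map.1 hm
      exact hu₂ k hk
  · intro m hm
    rcases List.mem_append.1 hm with hm | hm
    · obtain ⟨k, hk, rfl⟩ := List.mem_map.1 hm
      exact hv₁ k hk
    · obtain ⟨k, hk, rfl⟩ := List.mem_map.1 hm
      exact hv₂ k hk

/-- The inclusion of a game into the game with a new initial position. -/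
def liftHom (ε : Polarity) (G : AsyncGame.{u}) : Hom G (lift ε G) where
  pos := some
  trans := some
  src_trans _ := rfl
  tgt_trans _ := rfl

theorem liftHom_isTiled (ε : Polarity) (G : AsyncGame.{u}) : (liftHom ε G).IsTiled :=
  ⟨.mk, fun _ => rfl⟩

end AsyncGame

open AsyncGame

variable {Var : Type v} (ρ : Var → AsyncGame.{u})

/-! ### The duality of games -/

theorem Formula.src_dualTrans (A : Formula Var) (m : (A.game ρ).Trans) :
    (A.neg.game ρ).src (A.dualTrans ρ m) = A.dualPos ρ ((A.game ρ).src m) := by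
  induction A with
  | var X => rfl
  | covar X => rfl
  | par A B hA hB | tens A B hA hB =>
    rcases m with _ | ⟨m, y⟩ | ⟨x, n⟩
    · rfl
    · exact congrArg (fun z => some (z, B.dualPos ρ y)) (hA m)
    · exact congrArg (fun z => some (A.dualPos ρ x, z)) (hB n)
  | _ A B hA hB =>
    rcases m with _ | _ | m | n
    · rfl
    · rfl
    · exact congrArg (fun z => some (Sum.inl z)) (hA m)
    · exact congrArg (fun z => some (Sum.inr z)) (hB n)

theorem Formula.dualPos_init (A : Formula Var) :
    A.dualPos ρ (A.game ρ).init = (A.neg.game ρ).init := by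
  cases A <;> rfl

theorem Formula.tgt_dualTrans (A : Formula Var) (m : (A.game ρ).Trans) :
    (A.neg.game ρ).tgt (A.dualTrans ρ m) = A.dualPos ρ ((A.game ρ).tgt m) := by
  induction A with
  | var X => rfl
  | covar X => rfl
  | par A B hA hB | tens A B hA hB =>
    rcases m with _ | ⟨m, y⟩ | ⟨x, n⟩
    · exact congrArg some (Prod.ext (A.dualPos_init ρ).symm (B.dualPos_init ρ).symm)
    · exact congrArg (fun z => some (z, B.dualPos ρ y)) (hA m)
    · exact congrArg (fun z => some (A.dualPos ρ x, z)) (hB n)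
  | _ A B hA hB =>
    rcases m with _ | _ | m | n
    · exact congrArg (fun z => some (Sum.inl z)) (A.dualPos_init ρ).symm
    · exact congrArg (fun z => some (Sum.inr z)) (B.dualPos_init ρ).symm
    · exact congrArg (fun z => some (Sum.inl z)) (hA m)
    · exact congrArg (fun z => some (Sum.inr z)) (hB n)

theorem Formula.dualPos_injective (A : Formula Var) : (A.dualPos ρ).Injective := by
  induction A with
  | var X => exact fun _ _ h => h
  | covar X => exact fun _ _ h => h
  | par A B hA hB | tens A B hA hB => exact Option.map_injective (hA.prodMap hB)
  | _ A B hA hB => exact Option.map_injective (hA.sumMap hB)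

/-- The duality, as a morphism. -/
def Formula.dualHom (A : Formula Var) : Hom (A.game ρ) (A.neg.game ρ) where
  pos := A.dualPos ρ
  trans := A.dualTrans ρ
  src_trans := A.src_dualTrans ρ
  tgt_trans := A.tgt_dualTrans ρ

end MALL

namespace MALL

open AsyncGame Sequent
open AsyncGame (Hom PiTrans)

variable {Var : Type v}

/-! ### The parts of a play in the formulas of a sequent -/

namespace AsyncGame.PiTrans

variable {ι : Type} {G : ι → AsyncGame.{u}}

theorem proj_self (x : ∀ i, (G i).Pos) (i : ι) (m : (G i).Trans) (h : (G i).src m = x i) :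
    proj i (PiTrans.mk x i m h) = some m := by
  simp [proj]

theorem proj_of_ne (x : ∀ i, (G i).Pos) (i : ι) (m : (G i).Trans) (h : (G i).src m = x i) {j : ι}
    (hj : i ≠ j) : proj j (PiTrans.mk x i m h) = none := by
  simp [proj, hj]

end AsyncGame.PiTrans

variable (ρ : Var → AsyncGame.{u})

/-- The part of a play in a formula. -/
noncomputable def part {Γ : Sequent Var} (i : Γ.ι) (s : List (Γ.game ρ).Trans) :
    List ((Γ.fml i).game ρ).Trans :=
  s.filterMap (PiTrans.proj (G := fun i => (Γ.fml i).game ρ) i)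

variable {Γ Δ Θ : Sequent Var}

theorem part_cons_self {x : ∀ i, ((Γ.fml i).game ρ).Pos} {i : Γ.ι} {m : ((Γ.fml i).game ρ).Trans}
    {h : ((Γ.fml i).game ρ).src m = x i} (s : List (Γ.game ρ).Trans) :
    part ρ i (PiTrans.mk (G := fun i => (Γ.fml i).game ρ) x i m h :: s) = m :: part ρ i s :=
  List.filterMap_cons_some (PiTrans.proj_self (G := fun i => (Γ.fml i).game ρ) x i m h)

theorem part_cons_of_ne {x : ∀ i, ((Γ.fml i).game ρ).Pos} {i : Γ.ι} {m : ((Γ.fml i).game ρ).Trans}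
    {h : ((Γ.fml i).game ρ).src m = x i} {j : Γ.ι} (hj : i ≠ j) (s : List (Γ.game ρ).Trans) :
    part ρ j (PiTrans.mk (G := fun i => (Γ.fml i).game ρ) x i m h :: s) = part ρ j s :=
  List.filterMap_cons_none (PiTrans.proj_of_ne (G := fun i => (Γ.fml i).game ρ) x i m h hj)

theorem isPath_part {x y : (Γ.game ρ).Pos} {s : List (Γ.game ρ).Trans}
    (h : (Γ.game ρ).IsPath x s y) (i : Γ.ι) : ((Γ.fml i).game ρ).IsPath (x i) (part ρ i s) (y i) := by
  induction s generalizing x with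
  | nil => exact congrFun h i
  | cons t s ih =>
    obtain ⟨z, j, m, hm⟩ := t
    obtain ⟨rfl, h2⟩ := h
    have h3 := ih h2
    by_cases hj : j = i
    · subst hj
      rw [part_cons_self]
      refine ⟨hm, ?_⟩
      rwa [show (Γ.game ρ).tgt ⟨z, j, m, hm⟩ j = _ from Sequent.tgt_self ρ z j m hm] at h3
    · rw [part_cons_of_ne ρ hj]
      rwa [show (Γ.game ρ).tgt ⟨z, j, m, hm⟩ i = _ from
        Sequent.tgt_of_ne ρ z j m hm (Ne.symm hj)] at h3

theorem map_castTrans {A : Formula Var} (h : A = A) (s : List (A.game ρ).Trans) :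
    s.map (castTrans ρ h) = s :=
  List.map_id s

theorem part_map_exchHom (a : Iso Γ Δ) (i : Γ.ι) (s : List (Γ.game ρ).Trans) :
    part ρ (a.e i) (s.map (exchHom ρ a.e a.h).trans) = (part ρ i s).map (castTrans ρ (a.h i)) := by
  induction s with
  | nil => rfl
  | cons t s ih =>
    obtain ⟨z, j, m, hm⟩ := t
    by_cases hj : j = i
    · subst hj
      rw [List.map_cons, part_cons_self, List.map_cons, ← ih]
      exact part_cons_self ρ _
    · rw [List.map_cons, part_cons_of_ne ρ hj, ← ih]
      exact part_cons_of_ne ρ (fun h => hj (a.e.injective h)) _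

theorem part_inl_map_mixHom (i : Γ.ι) (s : List ((Γ.game ρ).prod (Δ.game ρ)).Trans) :
    part ρ (Γ := Γ.append Δ) (.inl i) (s.map (mixHom ρ Γ Δ).trans) = part ρ i (projL s) := by
  induction s with
  | nil => rfl
  | cons t s ih =>
    rcases t with ⟨⟨z, j, m, hm⟩, y⟩ | ⟨x, ⟨z, j, m, hm⟩⟩
    · rw [projL_inl, List.map_cons]
      by_cases hj : j = i
      · subst hj
        rw [part_cons_self, ← ih]
        exact part_cons_self ρ _
      · rw [part_cons_of_ne ρ hj, ← ih]
        exact part_cons_of_ne ρ (by simpa using hj) _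
    · rw [projL_inr, List.map_cons, ← ih]
      exact part_cons_of_ne ρ (by simp) _

theorem part_inr_map_mixHom (i : Δ.ι) (s : List ((Γ.game ρ).prod (Δ.game ρ)).Trans) :
    part ρ (Γ := Γ.append Δ) (.inr i) (s.map (mixHom ρ Γ Δ).trans) = part ρ i (projR s) := by
  induction s with
  | nil => rfl
  | cons t s ih =>
    rcases t with ⟨⟨z, j, m, hm⟩, y⟩ | ⟨x, ⟨z, j, m, hm⟩⟩
    · rw [projR_inl, List.map_cons, ← ih]
      exact part_cons_of_ne ρ (by simp) _
    · rw [projR_inr, List.map_cons]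
      by_cases hj : j = i
      · subst hj
        rw [part_cons_self, ← ih]
        exact part_cons_self ρ _
      · rw [part_cons_of_ne ρ hj, ← ih]
        exact part_cons_of_ne ρ (by simpa using hj) _

theorem part_inl_map_ctxHom {C : Formula Var} (R : Rule Θ C) (i : Γ.ι)
    (s : List ((Γ.append Θ).game ρ).Trans) :
    part ρ (Γ := Γ.append (one C)) (.inl i) (s.map (R.ctxHom ρ Γ).trans) =
      part ρ (Γ := Γ.append Θ) (.inl i) s := by
  induction s with
  | nil => rfl
  | cons t s ih =>
    obtain ⟨z, j | j, m, hm⟩ := t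
    · by_cases hj : j = i
      · subst hj
        exact (part_cons_self ρ _).trans ((congrArg (m :: ·) ih).trans
          (part_cons_self (Γ := Γ.append Θ) ρ s).symm)
      · have hj' : ∀ {X : Type}, (Sum.inl j : Γ.ι ⊕ X) ≠ Sum.inl i := by simpa using hj
        exact (part_cons_of_ne ρ hj' _).trans (ih.trans
          (part_cons_of_ne (Γ := Γ.append Θ) ρ hj' s).symm)
    · exact (part_cons_of_ne ρ Sum.inr_ne_inl _).trans (ih.trans
        (part_cons_of_ne (Γ := Γ.append Θ) ρ Sum.inr_ne_inl s).symm)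

/-- The list `r` is `s` restricted to `Θ`. It is kept as a list of transitions of `Θ` because
`R.hom` also uses the positions they record. -/
theorem part_inr_map_ctxHom {C : Formula Var} (R : Rule Θ C)
    (s : List ((Γ.append Θ).game ρ).Trans) : ∃ r : List (Θ.game ρ).Trans,
    part ρ (Γ := Γ.append (one C)) (.inr ()) (s.map (R.ctxHom ρ Γ).trans) =
      r.map (R.hom ρ).trans ∧ ∀ k, part ρ k r = part ρ (Γ := Γ.append Θ) (.inr k) s := by
  induction s with
  | nil => exact ⟨[], rfl, fun _ => rfl⟩
  | cons t s ih =>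
    obtain ⟨r, h1, h2⟩ := ih
    obtain ⟨z, j | j, m, hm⟩ := t
    · refine ⟨r, ?_, fun k => ?_⟩
      · rw [List.map_cons, ← h1]
        exact part_cons_of_ne ρ (by simp) _
      · rw [part_cons_of_ne ρ (by simp), h2]
    · refine ⟨⟨fun k => z (.inr k), j, m, hm⟩ :: r, ?_, fun k => ?_⟩
      · rw [List.map_cons, List.map_cons, ← h1]
        exact part_cons_self ρ _
      · by_cases hj : j = k
        · subst hj
          exact (part_cons_self ρ r).trans ((congrArg (m :: ·) (h2 j)).trans
            (part_cons_self (Γ := Γ.append Θ) ρ s).symm)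
        · exact (part_cons_of_ne ρ hj r).trans ((h2 k).trans
            (part_cons_of_ne (Γ := Γ.append Θ) ρ (by simpa using hj) s).symm)

theorem map_oneHom {A : Formula Var} {H : AsyncGame.{u}} (f : Hom (A.game ρ) H)
    (r : List ((one A).game ρ).Trans) :
    r.map (oneHom ρ f).trans = (part ρ (Γ := one A) () r).map f.trans := by
  induction r with
  | nil => rfl
  | cons t r ih =>
    obtain ⟨z, ⟨⟩, m, hm⟩ := t
    rw [List.map_cons, ih, part_cons_self, List.map_cons]
    rfl

/-- Passes from the game of the two-formula sequent `A, B`, indexed by a sum, to the binary product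
of games used in multiplicative formulas. -/
theorem exists_map_eq_of_mul {A B : Formula Var} {T : Type*}
    {f : (((one A).append (one B)).game ρ).Trans → T} {g : ((A.game ρ).prod (B.game ρ)).Trans → T}
    (hl : ∀ z m h, f ⟨z, .inl (), m, h⟩ = g (.inl (m, z (.inr ()))))
    (hr : ∀ z m h, f ⟨z, .inr (), m, h⟩ = g (.inr (z (.inl ()), m)))
    (r : List (((one A).append (one B)).game ρ).Trans) :
    ∃ x : List ((A.game ρ).prod (B.game ρ)).Trans, r.map f = x.map g ∧
      projL x = part ρ (Γ := (one A).append (one B)) (.inl ()) r ∧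
      projR x = part ρ (Γ := (one A).append (one B)) (.inr ()) r := by
  induction r with
  | nil => exact ⟨[], rfl, rfl, rfl⟩
  | cons t r ih =>
    obtain ⟨x, h1, h2, h3⟩ := ih
    obtain ⟨z, ⟨⟩ | ⟨⟩, m, hm⟩ := t
    · refine ⟨.inl (m, z (.inr ())) :: x, ?_, ?_, ?_⟩
      · rw [List.map_cons, h1, List.map_cons, ← hl]
      · rw [projL_inl, h2]
        exact (part_cons_self ρ _).symm
      · rw [projR_inl, h3]
        exact (part_cons_of_ne ρ (by simp) _).symm
    · refine ⟨.inr (z (.inl ()), m) :: x, ?_, ?_, ?_⟩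
      · rw [List.map_cons, h1, List.map_cons, ← hr]
      · rw [projL_inr, h2]
        exact (part_cons_of_ne ρ (by simp) _).symm
      · rw [projR_inr, h3]
        exact (part_cons_self ρ _).symm

end MALL

namespace MALL

open AsyncGame Sequent
open AsyncGame (Hom PiTrans)

variable {Var : Type v}

/-! ### Expansion of axioms -/

variable {ρ : Var → AsyncGame.{u}} {Γ Δ Θ : Sequent Var} {A A₁ A₂ B B₁ B₂ C C₁ C₂ : Formula Var}

theorem part_comm (σ : Strat.{u} (Γ.append Δ)) {s : List ((Δ.append Γ).game ρ).Trans}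
    (hs : s ∈ ((σ.ex (Iso.comm Γ Δ)).strat ρ).plays) : ∃ t ∈ (σ.strat ρ).plays,
    (∀ i, part ρ (Γ := Δ.append Γ) (.inr i) s = part ρ (Γ := Γ.append Δ) (.inl i) t) ∧
    ∀ i, part ρ (Γ := Δ.append Γ) (.inl i) s = part ρ (Γ := Γ.append Δ) (.inr i) t := by
  obtain ⟨t, ht, rfl⟩ := hs
  exact ⟨t, ht,
    fun i => (part_map_exchHom ρ (Iso.comm Γ Δ) (.inl i) t).trans (map_castTrans ρ rfl _),
    fun i => (part_map_exchHom ρ (Iso.comm Γ Δ) (.inr i) t).trans (map_castTrans ρ rfl _)⟩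

theorem part_op (R : Rule Θ C) (σ : Strat.{u} (Γ.append Θ))
    {s : List ((Γ.append (one C)).game ρ).Trans} (hs : s ∈ ((R.op σ).strat ρ).plays) : s = [] ∨
    ∃ t ∈ (σ.strat ρ).plays, (∀ i, part ρ (Γ := Γ.append (one C)) (.inl i) s =
      part ρ (Γ := Γ.append Θ) (.inl i) t) ∧ ∃ r : List (Θ.game ρ).Trans,
      part ρ (Γ := Γ.append (one C)) (.inr ()) s = R.root ρ :: r.map (R.hom ρ).trans ∧
      ∀ k, part ρ k r = part ρ (Γ := Γ.append Θ) (.inr k) t := by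
  rcases hs with rfl | ⟨t, ht, rfl⟩
  · exact .inl rfl
  obtain ⟨r, h1, h2⟩ := part_inr_map_ctxHom (Γ := Γ) ρ R t
  refine .inr ⟨t, ht, fun i => ?_, r, ?_, h2⟩
  · exact (part_cons_of_ne (Γ := Γ.append (one C)) ρ Sum.inr_ne_inl _).trans
      (part_inl_map_ctxHom ρ R i t)
  · exact (part_cons_self (Γ := Γ.append (one C)) ρ _).trans (congrArg _ h1)

theorem part_op_one {R : Rule (one A) C} {f : Hom (A.game ρ) (C.game ρ)}
    (hR : R.hom ρ = oneHom ρ f) (σ : Strat.{u} (Γ.append (one A)))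
    {s : List ((Γ.append (one C)).game ρ).Trans} (hs : s ∈ ((R.op σ).strat ρ).plays) : s = [] ∨
    ∃ t ∈ (σ.strat ρ).plays, (∀ i, part ρ (Γ := Γ.append (one C)) (.inl i) s =
      part ρ (Γ := Γ.append (one A)) (.inl i) t) ∧
      part ρ (Γ := Γ.append (one C)) (.inr ()) s =
        R.root ρ :: (part ρ (Γ := Γ.append (one A)) (.inr ()) t).map f.trans := by
  rcases part_op R σ hs with rfl | ⟨t, ht, h1, r, h2, h3⟩
  · exact .inl rfl
  · refine .inr ⟨t, ht, h1, h2.trans (congrArg _ ?_)⟩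
    rw [hR, map_oneHom]
    exact congrArg (List.map f.trans) (h3 ())

/-- That `x` is a play is read off the part of `s` in `C`: after the opening transition, this part
is a path which is the image of `x` by the injective `f`. -/
theorem part_op_mul {R : Rule ((one A).append (one B)) C}
    {f : Hom ((A.game ρ).prod (B.game ρ)) (C.game ρ)} (hf : f.pos.Injective)
    (hl : ∀ z m h, (R.hom ρ).trans ⟨z, .inl (), m, h⟩ = f.trans (.inl (m, z (.inr ()))))
    (hr : ∀ z m h, (R.hom ρ).trans ⟨z, .inr (), m, h⟩ = f.trans (.inr (z (.inl ()), m)))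
    (h0 : (C.game ρ).tgt (R.root ρ) = f.pos ((A.game ρ).init, (B.game ρ).init))
    (σ : Strat.{u} (Γ.append ((one A).append (one B))))
    {s : List ((Γ.append (one C)).game ρ).Trans} (hs : s ∈ ((R.op σ).strat ρ).plays) : s = [] ∨
    ∃ t ∈ (σ.strat ρ).plays, (∀ i, part ρ (Γ := Γ.append (one C)) (.inl i) s =
      part ρ (Γ := Γ.append ((one A).append (one B))) (.inl i) t) ∧
      ∃ x : List ((A.game ρ).prod (B.game ρ)).Trans, ((A.game ρ).prod (B.game ρ)).IsPlay x ∧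
      part ρ (Γ := Γ.append (one C)) (.inr ()) s = R.root ρ :: x.map f.trans ∧
      projL x = part ρ (Γ := Γ.append ((one A).append (one B))) (.inr (.inl ())) t ∧
      projR x = part ρ (Γ := Γ.append ((one A).append (one B))) (.inr (.inr ())) t := by
  obtain ⟨z, hz⟩ := Strategy.isPlay _ _ hs
  have hz := isPath_part ρ hz (.inr ())
  rcases part_op R σ hs with rfl | ⟨t, ht, h1, r, h2, h3⟩
  · exact .inl rfl
  obtain ⟨x, h4, h5, h6⟩ := exists_map_eq_of_mul ρ hl hr r
  rw [h4] at h2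
  refine .inr ⟨t, ht, h1, x, ?_, h2, h5.trans (h3 _), h6.trans (h3 _)⟩
  rw [h2] at hz
  have hz' : (C.game ρ).IsPath ((C.game ρ).tgt (R.root ρ)) (x.map f.trans) (z (.inr ())) := hz.2
  rw [h0] at hz'
  exact Hom.isPath_of_map hf hz'

/-- The four parts of an interleaving group by pairs, each pair coming from one play of one of the
two strategies. -/
theorem part_mix_tensIso (c₁ : Strat.{u} ((one A₁).append (one A₂)))
    (c₂ : Strat.{u} ((one B₁).append (one B₂)))
    {s : List ((((one A₁).append (one B₁)).append ((one A₂).append (one B₂))).game ρ).Trans}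
    (hs : s ∈ (((c₁.mix c₂).ex (tensIso (one A₁) (one B₁) A₂ B₂)).strat ρ).plays) :
    (∃ t ∈ (c₁.strat ρ).plays,
      part ρ (Γ := ((one A₁).append (one B₁)).append ((one A₂).append (one B₂)))
        (.inl (.inl ())) s = part ρ (Γ := (one A₁).append (one A₂)) (.inl ()) t ∧
      part ρ (Γ := ((one A₁).append (one B₁)).append ((one A₂).append (one B₂)))
        (.inr (.inl ())) s = part ρ (Γ := (one A₁).append (one A₂)) (.inr ()) t) ∧
    ∃ t ∈ (c₂.strat ρ).plays,
      part ρ (Γ := ((one A₁).append (one B₁)).append ((one A₂).append (one B₂)))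
        (.inl (.inr ())) s = part ρ (Γ := (one B₁).append (one B₂)) (.inl ()) t ∧
      part ρ (Γ := ((one A₁).append (one B₁)).append ((one A₂).append (one B₂)))
        (.inr (.inr ())) s = part ρ (Γ := (one B₁).append (one B₂)) (.inr ()) t := by
  obtain ⟨_, ⟨q, hq, rfl⟩, rfl⟩ := hs
  set a := tensIso (one A₁) (one B₁) A₂ B₂
  refine ⟨⟨_, hq.2.1, ?_, ?_⟩, ⟨_, hq.2.2, ?_, ?_⟩⟩
  · exact (part_map_exchHom ρ a (.inl (.inl ())) _).trans ((map_castTrans ρ rfl _).trans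
      (part_inl_map_mixHom ρ _ q))
  · exact (part_map_exchHom ρ a (.inl (.inr ())) _).trans ((map_castTrans ρ rfl _).trans
      (part_inl_map_mixHom ρ _ q))
  · exact (part_map_exchHom ρ a (.inr (.inl ())) _).trans ((map_castTrans ρ rfl _).trans
      (part_inr_map_mixHom ρ _ q))
  · exact (part_map_exchHom ρ a (.inr (.inr ())) _).trans ((map_castTrans ρ rfl _).trans
      (part_inr_map_mixHom ρ _ q))

/-- The parts of the plays of the expansion of an axiom on a multiplicative formula. -/
theorem part_par_tens (c₁ : Strat.{u} ((one A₁).append (one A₂)))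
    (c₂ : Strat.{u} ((one B₁).append (one B₂)))
    {s : List (((one (.tens A₂ B₂)).append (one (.par A₁ B₁))).game ρ).Trans}
    (hs : s ∈ (((Rule.par A₁ B₁).op ((c₁.tens c₂).ex (Iso.comm _ _))).strat ρ).plays)
    {P : List ((Formula.par A₁ B₁).game ρ).Trans → List ((Formula.tens A₂ B₂).game ρ).Trans → Prop}
    (hP : P [] []) (hP' : P [(Rule.par A₁ B₁).root ρ] [])
    (h : ∀ (x : List ((A₁.game ρ).prod (B₁.game ρ)).Trans)
      (y : List ((A₂.game ρ).prod (B₂.game ρ)).Trans),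
      ((A₁.game ρ).prod (B₁.game ρ)).IsPlay x → ((A₂.game ρ).prod (B₂.game ρ)).IsPlay y →
      (∃ t ∈ (c₁.strat ρ).plays, projL x = part ρ (Γ := (one A₁).append (one A₂)) (.inl ()) t ∧
        projL y = part ρ (Γ := (one A₁).append (one A₂)) (.inr ()) t) →
      (∃ t ∈ (c₂.strat ρ).plays, projR x = part ρ (Γ := (one B₁).append (one B₂)) (.inl ()) t ∧
        projR y = part ρ (Γ := (one B₁).append (one B₂)) (.inr ()) t) →
      P ((Rule.par A₁ B₁).root ρ :: x.map (liftHom .O _).trans)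
        ((Rule.tens A₂ B₂).root ρ :: y.map (liftHom .P _).trans)) :
    P (part ρ (Γ := (one (.tens A₂ B₂)).append (one (.par A₁ B₁))) (.inr ()) s)
      (part ρ (Γ := (one (.tens A₂ B₂)).append (one (.par A₁ B₁))) (.inl ()) s) := by
  rcases part_op_mul (f := liftHom .O _) (Option.some_injective _) (fun _ _ _ => rfl)
    (fun _ _ _ => rfl) rfl _ hs with rfl | ⟨t, ht, h1, x, hx, h2, h3, h4⟩
  · exact hP
  obtain ⟨t', ht', h5, h6⟩ := part_comm _ ht
  rw [Strat.tens_eq] at ht'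
  rcases part_op_mul (f := liftHom .P _) (Option.some_injective _) (fun _ _ _ => rfl)
    (fun _ _ _ => rfl) rfl _ ht' with rfl | ⟨q, hq, h1', y, hy, h2', h3', h4'⟩
  -- The tensor has not been played yet. The play above the `⅋` is then empty, whence the case
  -- `hP'`.
  · have e := h1 ()
    rw [h6] at e
    rw [h5] at h3 h4
    obtain rfl : x = [] := by
      rcases x with _ | ⟨_ | _, x⟩
      · rfl
      · exact absurd h3 (List.cons_ne_nil _ _)
      · exact absurd h4 (List.cons_ne_nil _ _)
    rw [h2, e]
    exact hP'
  · have e := (h1 ()).trans ((h6 ()).trans h2')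
    rw [h2, e]
    obtain ⟨⟨t₁, ht₁, k1, k2⟩, ⟨t₂, ht₂, k3, k4⟩⟩ := part_mix_tensIso _ _ hq
    exact h x y hx hy
      ⟨t₁, ht₁, h3.trans ((h5 _).trans ((h1' _).trans k1)), h3'.trans k2⟩
      ⟨t₂, ht₂, h4.trans ((h5 _).trans ((h1' _).trans k3)), h4'.trans k4⟩

/-- The parts of the plays of the expansion of an axiom on an additive formula. -/
theorem part_with_plus {R₁ : Rule (one A₁) C₁} {R₂ : Rule (one A₂) C₂}
    {f₁ : Hom (A₁.game ρ) (C₁.game ρ)} {f₂ : Hom (A₂.game ρ) (C₂.game ρ)}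
    (h₁ : R₁.hom ρ = oneHom ρ f₁) (h₂ : R₂.hom ρ = oneHom ρ f₂)
    (c : Strat.{u} ((one A₁).append (one A₂)))
    {s : List (((one C₂).append (one C₁)).game ρ).Trans}
    (hs : s ∈ ((R₁.op ((R₂.op c).ex (Iso.comm _ _))).strat ρ).plays)
    {P : List (C₁.game ρ).Trans → List (C₂.game ρ).Trans → Prop}
    (hP : P [] []) (hP' : P [R₁.root ρ] [])
    (h : ∀ t ∈ (c.strat ρ).plays,
      P (R₁.root ρ :: (part ρ (Γ := (one A₁).append (one A₂)) (.inl ()) t).map f₁.trans)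
        (R₂.root ρ :: (part ρ (Γ := (one A₁).append (one A₂)) (.inr ()) t).map f₂.trans)) :
    P (part ρ (Γ := (one C₂).append (one C₁)) (.inr ()) s)
      (part ρ (Γ := (one C₂).append (one C₁)) (.inl ()) s) := by
  rcases part_op_one h₁ _ hs with rfl | ⟨t, ht, h1, h2⟩
  · exact hP
  obtain ⟨t', ht', h5, h6⟩ := part_comm _ ht
  have e := (h1 ()).trans (h6 ())
  rw [h5] at h2
  rcases part_op_one h₂ _ ht' with rfl | ⟨q, hq, h1', h2'⟩
  · rw [h2, e]
    exact hP'
  · rw [h2, e, h2', h1']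
    exact h q hq

end MALL

-- Copy-cat strategies contain their expansions.

namespace MALL

open AsyncGame Sequent

variable {Var : Type v}

namespace Strat

variable {ρ : Var → AsyncGame.{u}} {A B : Formula Var}

theorem copies_of_mem_copycat {s : List (((one A.neg).append (one A)).game ρ).Trans}
    (hs : s ∈ (((copycat A).ex (axIso A A.neg)).strat ρ).plays) :
    Copies (A.dualHom ρ) (part ρ (Γ := (one A.neg).append (one A)) (.inr ()) s)
      (part ρ (Γ := (one A.neg).append (one A)) (.inl ()) s) := by
  obtain ⟨t, ht, rfl⟩ := hs
  have h := ht.2 t (List.prefix_refl t)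
  have h1 := (part_map_exchHom ρ (axIso A A.neg) (some none) t).trans (map_castTrans ρ rfl _)
  have h2 := (part_map_exchHom ρ (axIso A A.neg) none t).trans (map_castTrans ρ rfl _)
  exact (congrArg₂ (Copies (A.dualHom ρ)) h1 h2).mpr h

theorem copies_of_mem_copycat_comm {s : List (((one A).append (one A.neg)).game ρ).Trans}
    (hs : s ∈ ((((copycat A).ex (axIso A A.neg)).ex (Iso.comm _ _)).strat ρ).plays) :
    Copies (A.dualHom ρ) (part ρ (Γ := (one A).append (one A.neg)) (.inl ()) s)
      (part ρ (Γ := (one A).append (one A.neg)) (.inr ()) s) := by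
  obtain ⟨t, ht, h1, h2⟩ := part_comm _ hs
  rw [h1, h2]
  exact copies_of_mem_copycat ht

/-- The condition on all prefixes in the definition of copy-cat is automatic for a strategy, which
is closed under prefixes. -/
theorem le_copycat {σ : Strat.{u} ((one A.neg).append (one A))}
    (h : ∀ ρ, ∀ s ∈ (σ.strat ρ).plays,
      Copies (A.dualHom ρ) (part ρ (Γ := (one A.neg).append (one A)) (.inr ()) s)
        (part ρ (Γ := (one A.neg).append (one A)) (.inl ()) s)) :
    σ ≤ (copycat A).ex (axIso A A.neg) := by
  rw [← ex_symm_ex σ (axIso A A.neg)]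
  refine ex_mono _ (le_of_subset ?_)
  rintro ρ s hs
  refine ⟨Strategy.isPlay _ _ hs, ?_⟩
  rintro t ⟨r, rfl⟩
  obtain ⟨q, hq, rfl⟩ := Strategy.prefix_closed _ _ _ hs
  have h1 := (part_map_exchHom ρ (axIso A A.neg).symm (.inr ()) q).trans (map_castTrans ρ rfl _)
  have h2 := (part_map_exchHom ρ (axIso A A.neg).symm (.inl ()) q).trans (map_castTrans ρ rfl _)
  exact (congrArg₂ (Copies (A.dualHom ρ)) h1 h2).mpr (h ρ q hq)

theorem le_copycat_comm {σ : Strat.{u} ((one A).append (one A.neg))}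
    (h : ∀ ρ, ∀ s ∈ (σ.strat ρ).plays,
      Copies (A.dualHom ρ) (part ρ (Γ := (one A).append (one A.neg)) (.inl ()) s)
        (part ρ (Γ := (one A).append (one A.neg)) (.inr ()) s)) :
    σ ≤ ((copycat A).ex (axIso A A.neg)).ex (Iso.comm _ _) := by
  have h1 : (σ.ex (Iso.comm (one A) (one A.neg))).ex (Iso.comm _ _) = σ :=
    ex_symm_ex σ (Iso.comm (one A.neg) (one A))
  rw [← h1]
  refine ex_mono _ (le_copycat fun ρ s hs => ?_)
  obtain ⟨t, ht, h2, h3⟩ := part_comm _ hs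
  rw [h2, h3]
  exact h ρ t ht

end Strat

/-- Axioms may be expanded. -/
theorem NF.copycat (A : Formula Var) : NF (Strat.copycat.{u} A) := by
  induction A with
  | var X => exact .of_ex _ (.focus (C := .var X) (fun _ => id) trivial (.axVar X))
  | covar X => exact .of_ex _ (.of_ex _ (.focus (C := .var X) (fun _ => id) trivial (.axCovar X)))
  | par A B hA hB =>
    -- The expansion plays the `⅋`, then the `⊗`, then the copy-cats on the two pairs of dual
    -- subformulas in parallel.
    refine .of_ex (axIso _ _) (.le (Strat.le_copycat fun ρ s hs => ?_)
      (.par (((hA.ex (axIso _ _)).ex (Iso.comm _ _)).tens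
        ((hB.ex (axIso _ _)).ex (Iso.comm _ _)) |>.ex (Iso.comm _ _))))
    refine part_par_tens _ _ hs (copies_nil _) (copies_left _ rfl) ?_
    rintro x y hx hy ⟨t, ht, h1, h2⟩ ⟨t', ht', h1', h2'⟩
    refine Copies.map (f := (A.dualHom ρ).prodMap (B.dualHom ρ)) ?_ (liftHom_isTiled .O _)
      (liftHom_isTiled .P _) (fun _ => rfl) none
    refine .prod (A.dualPos_injective ρ) (B.dualPos_injective ρ) (A.dualPos_init ρ)
      (B.dualPos_init ρ) hx hy ?_ ?_
    · rw [h1, h2]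
      exact Strat.copies_of_mem_copycat_comm ht
    · rw [h1', h2']
      exact Strat.copies_of_mem_copycat_comm ht'
  | tens A B hA hB =>
    refine .of_ex (axIso _ _) (.of_ex (Iso.comm _ _) (.le (Strat.le_copycat_comm fun ρ s hs => ?_)
      (.par ((hA.ex (axIso _ _)).tens (hB.ex (axIso _ _)) |>.ex (Iso.comm _ _)))))
    -- The negative formula, decomposed first, is now the dual: the two arguments of `Copies` are
    -- exchanged, and the opening move alone is a surplus move on the dual side.
    refine part_par_tens _ _ hs (P := fun a b => Copies ((A.tens B).dualHom ρ) b a)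
      (copies_nil _) (copies_right ((A.tens B).dualHom ρ) (m := (Rule.tens A B).root ρ) rfl) ?_
    rintro x y hx hy ⟨t, ht, h1, h2⟩ ⟨t', ht', h1', h2'⟩
    refine Copies.map (f := (A.dualHom ρ).prodMap (B.dualHom ρ)) ?_ (liftHom_isTiled .P _)
      (liftHom_isTiled .O _) (fun _ => rfl) none
    refine .prod (A.dualPos_injective ρ) (B.dualPos_injective ρ) (A.dualPos_init ρ)
      (B.dualPos_init ρ) hy hx ?_ ?_
    · rw [h1, h2]
      exact Strat.copies_of_mem_copycat ht
    · rw [h1', h2']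
      exact Strat.copies_of_mem_copycat ht'
  | plus A B hA hB =>
    refine .of_ex (axIso _ _) (.of_ex (Iso.comm _ _)
      (.of_op_le (.ex (Iso.comm _ _) (.plusL B (hA.ex (axIso _ _))))
        (.ex (Iso.comm _ _) (.plusR A (hB.ex (axIso _ _))))
        (Strat.le_copycat_comm fun ρ s hs => ?_) (Strat.le_copycat_comm fun ρ s hs => ?_)))
    · refine part_with_plus rfl rfl _ hs (P := fun a b => Copies ((A.plus B).dualHom ρ) b a)
        (copies_nil _) (copies_right ((A.plus B).dualHom ρ) (m := (Rule.plusL A B).root ρ) rfl) fun t ht => ?_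
      exact (Strat.copies_of_mem_copycat ht).map (addHomL_isTiled _ _ _) (addHomL_isTiled _ _ _)
        (fun _ => rfl) .chooseL
    · refine part_with_plus rfl rfl _ hs (P := fun a b => Copies ((A.plus B).dualHom ρ) b a)
        (copies_nil _) (copies_right ((A.plus B).dualHom ρ) (m := (Rule.plusR A B).root ρ) rfl) fun t ht => ?_
      exact (Strat.copies_of_mem_copycat ht).map (addHomR_isTiled _ _ _) (addHomR_isTiled _ _ _)
        (fun _ => rfl) .chooseR
  -- The remaining case is `&`; its dual `⊕` answers with the component chosen by Opponent.
  | _ A B hA hB =>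
    refine .of_ex (axIso _ _)
      (.of_op_le (.ex (Iso.comm _ _) (.plusL B.neg ((hA.ex (axIso _ _)).ex (Iso.comm _ _))))
        (.ex (Iso.comm _ _) (.plusR A.neg ((hB.ex (axIso _ _)).ex (Iso.comm _ _))))
        (Strat.le_copycat fun ρ s hs => ?_) (Strat.le_copycat fun ρ s hs => ?_))
    · refine part_with_plus rfl rfl _ hs (copies_nil _) (copies_left _ rfl) fun t ht => ?_
      exact (Strat.copies_of_mem_copycat_comm ht).map (addHomL_isTiled _ _ _)
        (addHomL_isTiled _ _ _) (fun _ => rfl) .chooseL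
    · refine part_with_plus rfl rfl _ hs (copies_nil _) (copies_left _ rfl) fun t ht => ?_
      exact (Strat.copies_of_mem_copycat_comm ht).map (addHomR_isTiled _ _ _)
        (addHomR_isTiled _ _ _) (fun _ => rfl) .chooseR

end MALL

/-- The order on `Strat` is uniform in ρ, so a single proof works for all interpretations; the
second inclusion follows from the first by minimality of the courteous closure. -/
theorem theorem3 {Var : Type v} {Γ : MALL.Sequent Var} (π : MALL.Proof Γ) :
    ∃ π' : MALL.Proof Γ, π'.IsFocusing ∧ ∀ ρ : Var → MALL.AsyncGame.{u},
      π'.interp ρ ≤ π.asyncInterp ρ ∧ π'.asyncInterp ρ ≤ π.asyncInterp ρ := by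
  obtain ⟨π', h, h'⟩ := (π.strat_nf MALL.NF.copycat.{u}).exists_proof
  exact ⟨π', h, fun ρ => ⟨h' ρ, MALL.Strategy.deseq_mono (h' ρ)⟩⟩
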